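/- **Setting.** Let $\Omega\subset\mathbb R^n$ be bounded and open, $\xi\in C^\infty(\overline\Omega)$, $d>0$, $\Omega_s=\{x\in\Omega:\xi(x)>s\}$. Let $A_0u=\sum_{i,j=1}^n a_{ij}(x)\,\partial_i\partial_j u$ with $a_{ij}\in C^1(\mathbb R^n)$. Assume that $A_0$ admits the pointwise Carleman estimate in $\Omega_d$ with the weight $\varphi_\lambda=e^{\lambda\xi}$: there are constants $\lambda_0>1$ and $C,C'>0$ such that for all $\lambda\ge\lambda_0$ and all $u\in C^2(\overline{\Omega_d})$ there is a vector field $U\in C^1(\overline{\Omega_d})$ with $$(A_0u)^2\varphi_\lambda^2\ \ge\ C\lambda|\nabla u|^2\varphi_\lambda^2+C\lambda^3u^2\varphi_\lambda^2+\operatorname{div}U,\qquad |U|\le C'\lambda^3\big(|\nabla u|^2+u^2\big)\varphi_\lambda^2\qquad\text{in }\Omega_d .$$ **The system.** Let $\{\psi_k\}_{k\ge0}$ be the result of the Gram–Schmidt orthonormalization of $t^ke^t$, $k=0,1,\dots$, in $L_2(0,1)$ with scalar product $[\cdot,\cdot]$, let $N\ge1$, and let $M_N$ be the $N\times N$ matrix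 with entries $[\psi_k',\psi_m]$ (row $m$, column $k$; $0\le k,m\le N-1$), which is invertible. For $b=(b_1,\dots,b_n)$ with $b_i\in C^1(\mathbb R^n)$ put $$F_2(x,p,q)=\sum_{i,j}a_{ij}(x)(p_iq_j+q_ip_j)+\sum_i b_i(x)q_i ,$$ and for $V=(v_0,\dots,v_{N-1})$ put $P(x,\nabla V)=M_N^{-1}F(x,\nabla V)$, where $$F_m(x,\nabla V)=-\Big[F_2\Big(x,\sum_k\psi_k\nabla v_k(x),\sum_k\psi_k'\nabla v_k(x)\Big),\psi_m\Big],\qquad 0\le m\le N-1 .$$ The system is $A_0V-P(x,\nabla V)=0$ in $\Omega$, with $A_0$ acting on each component. (It comes from $\sum a_{ij}\partial_i\partial_ju+\sum b_i\partial_iu+a_0u=0$ with $u=e^v$, by differentiation of the equation for $v$ in the source parameter $x_0\in(0,1)$, the truncation $v=\sum_{k<N}v_k(x)\psi_k(x_0)$ and projection on $\psi_0,\dots,\psi_{N-1}$.) **The data.** Let $\Gamma$ be a relatively open part of $\partial\Omega$ of class $C^2$, with $\Omega$ locally on one side of it and with outward unit normal $\nu$, such that $\{x\in\partial\Omega:\xi(x)>d\}\subseteq\Gamma$.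 A solution $V$ has the Cauchy data $p_0=V|_\Gamma$, $p_1=\partial_\nu V|_\Gamma$. The norm of a vector function is the square root of the sum of the squared norms of its components. **Theorem 3.1 (Hölder stability and uniqueness).** Let $K,Z,c>0$ with $\Omega_{d+c}\ne\varnothing$, and let $m=\max_{\overline{\Omega_d}}\xi$. There are constants $\sigma_0\in(0,1)$ and $C_2>0$, which for fixed $A_0$, $d$ and $N$ depend only on $\Omega,K,Z,\xi,m,c$, such that the following holds for all $b$ with $\|b_i\|_{C^1(\overline\Omega)}\le Z$ $(1\le i\le n)$ and all $\Gamma$ as above. Let $V^{(1)},V^{(2)}\in C^2(\overline\Omega)$ be two solutions of the system with $\|V^{(i)}\|_{C^1(\overline\Omega)}\le K$ and with Cauchy data $(p_0^{(i)},p_1^{(i)})$ on $\Gamma$, and let $\sigma\in(0,\sigma_0)$ be such that $$\|p_0^{(1)}-p_0^{(2)}\|_{H^1(\Gamma)}\le\sigma,\qquad \|p_1^{(1)}-p_1^{(2)}\|_{L_2(\Gamma)}\le\sigma .$$ Then $$\|V^{(1)}-V^{(2)}\|_{H^1(\Omega_{d+c})}\le C_2\left(1+\|V^{(1)}-V^{(2)}\|_{H^2(\Omega)}\right)\sigma^{\rho},\qquad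 \rho=\frac{c}{m+c} .$$ Moreover, if $V^{(1)},V^{(2)}\in C^2(\overline\Omega)$ are two solutions of the system (for the same $b$) with $p_0^{(1)}=p_0^{(2)}$ and $p_1^{(1)}=p_1^{(2)}$ on $\Gamma$, then $V^{(1)}=V^{(2)}$ in $\Omega_d$. -/

import Mathlib

open MeasureTheory Set Filter Topology
open scoped ENNReal ContDiff RealInnerProductSpace

namespace TruncatedCIP

/-- The Euclidean space `ℝⁿ`. -/
abbrev Eu (n : ℕ) : Type := EuclideanSpace ℝ (Fin n)

noncomputable section

/-! ### Differential operators -/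

/-- The partial derivative `∂u/∂xᵢ`; it is only used at points of open sets where `u` is
differentiable. -/
def pd {n : ℕ} (i : Fin n) (u : Eu n → ℝ) (x : Eu n) : ℝ :=
  fderiv ℝ u x (EuclideanSpace.single i 1)

/-- The squared length `|∇u(x)|²`. -/
def gradSq {n : ℕ} (u : Eu n → ℝ) (x : Eu n) : ℝ :=
  ∑ i, pd i u x ^ 2

/-- The divergence of a vector field. -/
def divergence {n : ℕ} (U : Eu n → Eu n) (x : Eu n) : ℝ :=
  ∑ i, pd i (fun y => U y i) x

/-- The second order operator `A₀ u = ∑ᵢⱼ aᵢⱼ(x) ∂ᵢ∂ⱼ u`. The matrix of coefficients is not assumed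
to be symmetric, so this is a general homogeneous operator `∑_{|α| = 2} a_α(x) D^α u`. -/
def principalPart {n : ℕ} (a : Fin n → Fin n → Eu n → ℝ) (u : Eu n → ℝ) (x : Eu n) : ℝ :=
  ∑ i, ∑ j, a i j x * pd i (pd j u) x

/-- The set `Ω_d = {x ∈ Ω : ξ(x) > d}`. -/
def superlevel {n : ℕ} (Ω : Set (Eu n)) (ξ : Eu n → ℝ) (d : ℝ) : Set (Eu n) :=
  {x | x ∈ Ω ∧ d < ξ x}

/-- The operator `A₀` admits the pointwise Carleman estimate in the open set `D` with the weight
`φ_λ = exp (λ ξ)`. The field `U` may depend on `λ` and `u`, and is `C¹` up to the boundary so that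
Gauss' formula applies to it. All terms are continuous up to the boundary, so
the inequalities on `D` are the same as those on the closure of `D`. -/
def AdmitsCarleman {n : ℕ} (a : Fin n → Fin n → Eu n → ℝ) (D : Set (Eu n)) (ξ : Eu n → ℝ) : Prop :=
  ∃ lam₀ > (1 : ℝ), ∃ C > (0 : ℝ), ∃ C' > (0 : ℝ), ∀ lam ≥ lam₀, ∀ u : Eu n → ℝ,
    ContDiffOn ℝ 2 u (closure D) →
    ∃ U : Eu n → Eu n, ContDiffOn ℝ 1 U (closure D) ∧ ∀ x ∈ D,
      principalPart a u x ^ 2 * Real.exp (lam * ξ x) ^ 2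
          ≥ C * lam * gradSq u x * Real.exp (lam * ξ x) ^ 2
            + C * lam ^ 3 * u x ^ 2 * Real.exp (lam * ξ x) ^ 2 + divergence U x ∧
      ‖U x‖ ≤ C' * lam ^ 3 * (gradSq u x + u x ^ 2) * Real.exp (lam * ξ x) ^ 2

/-! ### The orthonormal basis of `L₂(0,1)` and the truncated quasilinear system -/

/-- The scalar product of `L₂(0,1)`. -/
def ip (f g : ℝ → ℝ) : ℝ := ∫ t in (0 : ℝ)..1, f t * g t

/-- The functions `ψ₀, ψ₁, …` that the Gram-Schmidt orthonormalization in `L₂(0,1)` makes of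
`e^t, t e^t, t² e^t, …`. -/
def psi (m : ℕ) : ℝ → ℝ :=
  let q : ℝ → ℝ := fun t => t ^ m * Real.exp t
    - ∑ j : Fin m, ip (fun s => s ^ m * Real.exp s) (psi j.1) * psi j.1 t
  fun t => q t / Real.sqrt (ip q q)
termination_by m
decreasing_by all_goals exact j.2

/-- The matrix `M_N` with the entries `[ψ_k', ψ_m]` (row `m`, column `k`), which is upper triangular
with unit diagonal. -/
def basisMatrix (N : ℕ) : Matrix (Fin N) (Fin N) ℝ :=
  Matrix.of fun m k => ip (deriv (psi k)) (psi m)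

/-- For `u = e^v`, the equation `∑ aᵢⱼ ∂ᵢ∂ⱼ u + ∑ bᵢ ∂ᵢ u + a₀ u = 0` is
`A₀ v + F₁(x, ∇v) = -a₀`, with `F₁(x,p) = ∑ᵢⱼ aᵢⱼ(x) pᵢ pⱼ + ∑ᵢ bᵢ(x) pᵢ`. Differentiation in the
parameter `x₀` turns `F₁(x,∇v)` into `F₂(x, ∇v, ∇v_{x₀})`, where `F₂` is the following function,
the derivative of `F₁(x, p)` with respect to `p` in the direction `q`. -/
def F₂ {n : ℕ} (a : Fin n → Fin n → Eu n → ℝ) (b : Fin n → Eu n → ℝ) (x : Eu n)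
    (p q : Fin n → ℝ) : ℝ :=
  ∑ i, ∑ j, a i j x * (p i * q j + q i * p j) + ∑ i, b i x * q i

/-- The nonlinearity `P(x, ∇V) = M_N⁻¹ F(x, ∇V)`, where `G k` stands for `∇v_k(x)` and
`F_m = -[F₂(x, ∑ ψ_k ∇v_k, ∑ ψ_k' ∇v_k), ψ_m]`. It comes from the substitution of
`v(x,x₀) = ∑_{k<N} v_k(x) ψ_k(x₀)` in `A₀ v_{x₀} + F₂(x, ∇v, ∇v_{x₀}) = 0` and the projection on
`ψ₀, …, ψ_{N-1}`. -/
def nonlinearity {n N : ℕ} (a : Fin n → Fin n → Eu n → ℝ) (b : Fin n → Eu n → ℝ) (x : Eu n)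
    (G : Fin N → Fin n → ℝ) : Fin N → ℝ :=
  (basisMatrix N)⁻¹.mulVec fun m =>
    -ip (fun t => F₂ a b x (fun i => ∑ k : Fin N, psi k t * G k i)
      (fun i => ∑ k : Fin N, deriv (psi k) t * G k i)) (psi m)

/-- `V ∈ C²(closure Ω)` solves the system `A₀ V - P(x, ∇V) = 0` in `Ω`. -/
def IsSolution {n N : ℕ} (a : Fin n → Fin n → Eu n → ℝ) (b : Fin n → Eu n → ℝ) (Ω : Set (Eu n))
    (V : Fin N → Eu n → ℝ) : Prop :=
  (∀ k, ContDiffOn ℝ 2 (V k) (closure Ω)) ∧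
    ∀ x ∈ Ω, ∀ k,
      principalPart a (V k) x - nonlinearity a b x (fun l i => pd i (V l) x) k = 0

/-! ### The part `Γ` of the boundary and the Cauchy data on it -/

/-- `x` is a point of `∂Ω` near which `Ω` is the subgraph of a `C²` function `g` over a hyperplane
orthogonal to some unit vector `e`, and `ν` is the outward unit normal to `∂Ω` at `x`. -/
def IsC2BoundaryPoint {n : ℕ} (Ω : Set (Eu n)) (x ν : Eu n) : Prop :=
  x ∈ frontier Ω ∧ ∃ (e : Eu n) (g : Eu n → ℝ) (W : Set (Eu n)),
    ‖e‖ = 1 ∧ ContDiff ℝ 2 g ∧ IsOpen W ∧ x ∈ W ∧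
    (∀ y ∈ W, y ∈ Ω ↔ ⟪e, y⟫ < g (y - ⟪e, y⟫ • e)) ∧
    ν = ‖gradient (fun y => ⟪e, y⟫ - g (y - ⟪e, y⟫ • e)) x‖⁻¹ •
      gradient (fun y => ⟪e, y⟫ - g (y - ⟪e, y⟫ • e)) x

/-- `Γ` is a relatively open part of `∂Ω` of class `C²`, with the outward unit normal field `ν`. -/
def IsC2BoundaryPart {n : ℕ} (Ω Γ : Set (Eu n)) (ν : Eu n → Eu n) : Prop :=
  (∃ W : Set (Eu n), IsOpen W ∧ Γ = W ∩ frontier Ω) ∧ ∀ x ∈ Γ, IsC2BoundaryPoint Ω x (ν x)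

/-- `V = p₀` and `∂_ν V = p₁` on `Γ`, the normal derivative being taken from inside. -/
def HasCauchyData {n N : ℕ} (Γ : Set (Eu n)) (ν : Eu n → Eu n) (V p₀ p₁ : Fin N → Eu n → ℝ) :
    Prop :=
  ∀ x ∈ Γ, ∀ k, V k x = p₀ k x ∧
    HasDerivWithinAt (fun t : ℝ => V k (x + t • ν x)) (p₁ k x) (Iic 0) 0

/-- The squared length of the tangential gradient at `x` of a function `p` on the hypersurface `Γ`.
The vectors `g` with `p y = p x + ⟪g, y - x⟫ + o(|y - x|)`, `y ∈ Γ`, are the tangential gradient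
plus an arbitrary normal vector, so that the tangential gradient is the shortest of them. The value
is `∞` where `p` is not differentiable along `Γ`. -/
def tangentialGradSq {n : ℕ} (Γ : Set (Eu n)) (p : Eu n → ℝ) (x : Eu n) : ℝ≥0∞ :=
  ⨅ g ∈ {g : Eu n | HasGradientWithinAt p g Γ x}, ‖g‖ₑ ^ 2

/-! ### Norms

The norm of a vector function is the square root of the sum of the squares of the norms of its
components. The integral norms have values in `[0, ∞]`, so that no convention on divergent integrals
enters. They are applied to functions with classical derivatives only. -/

/-- The `L₂(Γ)` norm with respect to the surface measure. -/
def normL2Surface {n N : ℕ} (Γ : Set (Eu n)) (p : Fin N → Eu n → ℝ) : ℝ≥0∞ :=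
  (∑ k, ∫⁻ x in Γ, ‖p k x‖ₑ ^ 2 ∂μHE[n - 1]) ^ (1 / 2 : ℝ)

/-- The `H¹(Γ)` norm with respect to the surface measure. -/
def normH1Surface {n N : ℕ} (Γ : Set (Eu n)) (p : Fin N → Eu n → ℝ) : ℝ≥0∞ :=
  (∑ k, ∫⁻ x in Γ, (‖p k x‖ₑ ^ 2 + tangentialGradSq Γ (p k) x) ∂μHE[n - 1]) ^ (1 / 2 : ℝ)

/-- The squared `L₂(D)` norm of a scalar function. -/
def sqL2 {n : ℕ} (D : Set (Eu n)) (u : Eu n → ℝ) : ℝ≥0∞ := ∫⁻ x in D, ‖u x‖ₑ ^ 2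

/-- The `H¹(D)` norm, `D` open. -/
def normH1 {n N : ℕ} (D : Set (Eu n)) (V : Fin N → Eu n → ℝ) : ℝ≥0∞ :=
  (∑ k, (sqL2 D (V k) + ∑ i, sqL2 D (pd i (V k)))) ^ (1 / 2 : ℝ)

/-- The `H²(D)` norm, `D` open; each derivative `D^α`, `|α| ≤ 2`, is counted once. -/
def normH2 {n N : ℕ} (D : Set (Eu n)) (V : Fin N → Eu n → ℝ) : ℝ≥0∞ :=
  (∑ k, (sqL2 D (V k) + ∑ i, sqL2 D (pd i (V k))
    + ∑ i, ∑ j ∈ Finset.Ici i, sqL2 D (pd i (pd j (V k))))) ^ (1 / 2 : ℝ)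

/-- The norm `∑_{|α| ≤ 1} sup |D^α u|` of `C¹(closure Ω)`, `Ω` open and bounded; by continuity the
suprema over `Ω` are the maxima over the closure. -/
def normC1 {n : ℕ} (Ω : Set (Eu n)) (u : Eu n → ℝ) : ℝ :=
  sSup ((fun x => |u x|) '' Ω) + ∑ i, sSup ((fun x => |pd i u x|) '' Ω)

/-- The `C¹(closure Ω)` norm of a vector function. -/
def vecNormC1 {n N : ℕ} (Ω : Set (Eu n)) (V : Fin N → Eu n → ℝ) : ℝ :=
  Real.sqrt (∑ k, normC1 Ω (V k) ^ 2)

end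

end TruncatedCIP

open TruncatedCIP

/-! The difference `w = V₁ - V₂` of two solutions satisfies `|A₀ w_k|² ≤ L (|∇w|² + |w|²)`, because
the nonlinearity is a polynomial of degree two in the gradients and hence Lipschitz on the ball of
radius `K` (`exists_principalPart_sub_sq_le`). The Carleman estimate is applied to `η w_k`, where
the cutoff `η` vanishes near `{ξ = d}` and equals `1` where `ξ > d₁`.

Where `ξ > d₁`, the factor `λ` absorbs the right-hand side `L (|∇w|² + |w|²)` once `λ` is large.
Where `d < ξ ≤ d₁`, the commutator terms are bounded without any smallness, but the weight is at
most `e^{2λd₁}`. The divergence term becomes an integral over `∂Ω ∩ {ξ > d}`, where the weight is at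
most `e^{2λm}` and the Cauchy data control `w` and `∇w`. This gives (`exists_energy_estimate`)
`e^{2λ(d+c)} ‖w‖²_{H¹(Ω_{d+c})} ≤ C₃ (e^{2λd₁} ‖w‖²_{H¹(Ω_d)} + λ³ e^{2λm} · 2σ²)`. With `λ`
proportional to `-log σ` and `d₁ = d + cd/m`, both terms decay like `σ^{2ρ}`, `ρ = c/(m+c)`, after
division by `e^{2λ(d+c)}` (`exists_large_parameter`). Uniqueness follows as `σ → 0`.

Two analytic ingredients are needed. Gauss' formula enters only as an inequality `|∫ div U| ≤ C ∫
|U|` with a surface integral on the right (`exists_divergence_bound`). It comes from cutting the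
field off in a layer of thickness of order `ε` along the boundary, letting `ε → 0`, and patching
charts by a partition of unity. On the boundary, the gradient of `w` splits into a tangential part,
bounded by the tangential gradient of `p₀`, and a normal part, equal to `p₁` (`lintegral_trace_le`).
-/

set_option linter.unusedSectionVars false

/-! ### Derivatives up to the boundary of an open set -/

section Closure

variable {E F : Type*} [NormedAddCommGroup E] [NormedSpace ℝ E] [NormedAddCommGroup F]
  [NormedSpace ℝ F] {Ω : Set E} {w : E → F}

lemma eventually_mem_nhds_of_mem_nhdsWithin_closure (hΩ : IsOpen Ω) {x : E} {u : Set E}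
    (hu : u ∈ 𝓝[closure Ω] x) : ∀ᶠ y in 𝓝[Ω] x, u ∈ 𝓝 y := by
  obtain ⟨o, ho, hxo, hou⟩ := mem_nhdsWithin.1 hu
  filter_upwards [inter_mem_nhdsWithin Ω (ho.mem_nhds hxo)] with y hy
  exact mem_of_superset ((hΩ.inter ho).mem_nhds hy)
    fun z hz => hou ⟨hz.2, subset_closure hz.1⟩

/-- No regularity of `∂Ω` is available here, so derivatives within `closure Ω` need not be unique at
boundary points. The limit from the inside is canonical: any local derivative field on the closure
agrees with `fderiv` on the open set `Ω` and is itself regular at `x`. -/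
lemma exists_local_fderiv {n : ℕ} (hΩ : IsOpen Ω) {x : E} (hx : x ∈ closure Ω)
    (hw : ContDiffWithinAt ℝ (n + 1) w (closure Ω) x) :
    ∃ f' : E → E →L[ℝ] F, HasFDerivWithinAt w (f' x) (closure Ω) x ∧
      ContDiffWithinAt ℝ n f' (closure Ω) x ∧
      ∀ᶠ y in 𝓝[Ω] x, fderiv ℝ w =ᶠ[𝓝 y] f' := by
  obtain ⟨u, hu, -, -, f', hf', hc⟩ :=
    (contDiffWithinAt_succ_iff_hasFDerivWithinAt' (by simp)).1 hw
  rw [insert_eq_of_mem hx] at hu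
  refine ⟨f', hf' x (mem_of_mem_nhdsWithin hx hu), hc, ?_⟩
  filter_upwards [eventually_mem_nhds_of_mem_nhdsWithin_closure hΩ hu,
    self_mem_nhdsWithin] with y hy hyΩ
  filter_upwards [hy, hΩ.mem_nhds hyΩ] with z hz hzΩ
  exact ((hf' z hz).hasFDerivAt (mem_of_superset (hΩ.mem_nhds hzΩ) subset_closure)).fderiv

lemma exists_tendsto_fderiv (hΩ : IsOpen Ω) (hw : ContDiffOn ℝ 1 w (closure Ω)) {x : E}
    (hx : x ∈ closure Ω) :
    ∃ L, HasFDerivWithinAt w L (closure Ω) x ∧ Tendsto (fderiv ℝ w) (𝓝[Ω] x) (𝓝 L) := by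
  obtain ⟨f', h1, h2, h3⟩ := exists_local_fderiv (n := 0) hΩ hx (by simpa using hw x hx)
  refine ⟨f' x, h1, ?_⟩
  refine (h2.continuousWithinAt.mono subset_closure).tendsto.congr' ?_
  filter_upwards [h3] with y hy using hy.self_of_nhds.symm

lemma exists_tendsto_fderiv_fderiv (hΩ : IsOpen Ω) (hw : ContDiffOn ℝ 2 w (closure Ω)) {x : E}
    (hx : x ∈ closure Ω) :
    ∃ L, Tendsto (fderiv ℝ (fderiv ℝ w)) (𝓝[Ω] x) (𝓝 L) := by
  obtain ⟨f', -, h2, h3⟩ := exists_local_fderiv (n := 1) hΩ hx (hw x hx)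
  obtain ⟨f'', -, h5, h6⟩ := exists_local_fderiv (n := 0) hΩ hx (by simpa using h2)
  refine ⟨f'' x, (h5.continuousWithinAt.mono subset_closure).tendsto.congr' ?_⟩
  filter_upwards [h3, h6] with y hy hy'
  rw [hy.fderiv_eq, hy'.self_of_nhds]

/-- The continuous extension to the closure of `Ω` of the derivative of `w`. -/
noncomputable def closureDeriv (Ω : Set E) (w : E → F) : E → E →L[ℝ] F :=
  extendFrom Ω (fderiv ℝ w)

lemma tendsto_closureDeriv (hΩ : IsOpen Ω) (hw : ContDiffOn ℝ 1 w (closure Ω)) {x : E}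
    (hx : x ∈ closure Ω) : Tendsto (fderiv ℝ w) (𝓝[Ω] x) (𝓝 (closureDeriv Ω w x)) := by
  obtain ⟨L, -, hL⟩ := exists_tendsto_fderiv hΩ hw hx
  rw [closureDeriv, extendFrom_eq hx hL]
  exact hL

lemma hasFDerivWithinAt_closureDeriv (hΩ : IsOpen Ω) (hw : ContDiffOn ℝ 1 w (closure Ω)) {x : E}
    (hx : x ∈ closure Ω) : HasFDerivWithinAt w (closureDeriv Ω w x) (closure Ω) x := by
  obtain ⟨L, h, hL⟩ := exists_tendsto_fderiv hΩ hw hx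
  rwa [closureDeriv, extendFrom_eq hx hL]

lemma continuousOn_closureDeriv (hΩ : IsOpen Ω) (hw : ContDiffOn ℝ 1 w (closure Ω)) :
    ContinuousOn (closureDeriv Ω w) (closure Ω) :=
  continuousOn_extendFrom subset_rfl fun _ hx =>
    (exists_tendsto_fderiv hΩ hw hx).imp fun _ h => h.2

/-- A function with limits at every point of the compact closure extends continuously to it, and on
`Ω` the extension is the function itself because the limit filter contains the point. -/
lemma exists_bound_of_tendsto (hΩc : IsCompact (closure Ω)) {G : Type*} [NormedAddCommGroup G]
    {f : E → G} (hf : ∀ x ∈ closure Ω, ∃ L, Tendsto f (𝓝[Ω] x) (𝓝 L)) :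
    ∃ C > (0 : ℝ), ∀ x ∈ Ω, ‖f x‖ ≤ C := by
  obtain ⟨C, hC⟩ := hΩc.exists_bound_of_continuousOn (continuousOn_extendFrom subset_rfl hf)
  refine ⟨max C 1, by positivity, fun x hx => le_max_of_le_left ?_⟩
  obtain ⟨L, hL⟩ := hf x (subset_closure hx)
  have h1 : extendFrom Ω f x = L := extendFrom_eq (subset_closure hx) hL
  have h2 : f x = L :=
    tendsto_nhds_unique (tendsto_pure_nhds f x) (hL.mono_left (pure_le_nhdsWithin hx))
  rw [h2, ← h1]
  exact hC x (subset_closure hx)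

lemma exists_bound_fderiv (hΩ : IsOpen Ω) (hΩc : IsCompact (closure Ω))
    (hw : ContDiffOn ℝ 1 w (closure Ω)) : ∃ C > (0 : ℝ), ∀ x ∈ Ω, ‖fderiv ℝ w x‖ ≤ C :=
  exists_bound_of_tendsto hΩc fun _ hx => ⟨_, tendsto_closureDeriv hΩ hw hx⟩

lemma exists_bound_fderiv_fderiv (hΩ : IsOpen Ω) (hΩc : IsCompact (closure Ω))
    (hw : ContDiffOn ℝ 2 w (closure Ω)) :
    ∃ C > (0 : ℝ), ∀ x ∈ Ω, ‖fderiv ℝ (fderiv ℝ w) x‖ ≤ C :=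
  exists_bound_of_tendsto (G := E →L[ℝ] E →L[ℝ] F) hΩc
    fun _ hx => exists_tendsto_fderiv_fderiv hΩ hw hx

lemma exists_bound_of_contDiffOn_closure (hΩc : IsCompact (closure Ω))
    (hw : ContinuousOn w (closure Ω)) : ∃ C > (0 : ℝ), ∀ x ∈ Ω, ‖w x‖ ≤ C := by
  obtain ⟨C, hC⟩ := hΩc.exists_bound_of_continuousOn hw
  exact ⟨max C 1, by positivity, fun x hx => le_max_of_le_left (hC x (subset_closure hx))⟩

end Closure

/-! ### Integration over graphs and over thin layers below them -/

section Graph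

variable {n : ℕ} {e : Eu n}

/-- Cartesian coordinates with the first axis directed along `e`. -/
noncomputable def axisMap (e : Eu n) (p : ℝ × (ℝ ∙ e)ᗮ) : Eu n := p.1 • e + (p.2 : Eu n)

lemma measurePreserving_smul_add_orthogonal {V : Type*} [NormedAddCommGroup V]
    [InnerProductSpace ℝ V] [MeasurableSpace V] [BorelSpace V] [FiniteDimensional ℝ V] {e : V}
    (he : ‖e‖ = 1) :
    MeasurePreserving (fun p : ℝ × (ℝ ∙ e)ᗮ => p.1 • e + (p.2 : V)) (volume.prod volume) volume := by
  have h1 : MeasurePreserving (Submodule.measurableEquivProd (P := V) (ℝ ∙ e) (0 : V)).symm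
      (volume.prod volume) μHE[Module.finrank ℝ V] :=
    MeasurePreserving.symm _
      (Submodule.measurePreserving_measurableEquivProd (V := V) (P := V) (ℝ ∙ e) 0)
  have h0 : (μHE[Module.finrank ℝ V] : Measure V) = volume :=
    InnerProductSpace.euclideanHausdorffMeasure_eq_volume
  rw [h0] at h1
  let L : ℝ ≃ₗᵢ[ℝ] (ℝ ∙ e) := LinearIsometryEquiv.toSpanUnitSingleton e he
  have h2 : MeasurePreserving (Prod.map (fun t => L t) (fun y : (ℝ ∙ e)ᗮ => y))
      (volume.prod volume) (volume.prod volume) :=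
    L.measurePreserving.prod (MeasurePreserving.id _)
  have h4 : (fun p : ℝ × (ℝ ∙ e)ᗮ => p.1 • e + (p.2 : V)) =
      (Submodule.measurableEquivProd (P := V) (ℝ ∙ e) (0 : V)).symm ∘
        Prod.map (fun t => L t) (fun y : (ℝ ∙ e)ᗮ => y) := by
    ext p
    simp [L]
  rw [h4]
  exact h1.comp h2

lemma measurePreserving_axisMap (he : ‖e‖ = 1) :
    MeasurePreserving (axisMap e) (volume.prod volume) volume :=
  measurePreserving_smul_add_orthogonal he

lemma inner_coe_orthogonal_span_singleton (y : (ℝ ∙ e)ᗮ) : ⟪e, (y : Eu n)⟫ = 0 :=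
  Submodule.mem_orthogonal_singleton_iff_inner_right.1 y.2

lemma inner_axisMap (he : ‖e‖ = 1) (p : ℝ × (ℝ ∙ e)ᗮ) : ⟪e, axisMap e p⟫ = p.1 := by
  simp [axisMap, inner_add_right, inner_smul_right, he, inner_coe_orthogonal_span_singleton]

lemma axisMap_sub (he : ‖e‖ = 1) (p : ℝ × (ℝ ∙ e)ᗮ) :
    axisMap e p - ⟪e, axisMap e p⟫ • e = p.2 := by
  rw [inner_axisMap he, axisMap]
  abel

lemma norm_snd_le_axisMap (he : ‖e‖ = 1) (p : ℝ × (ℝ ∙ e)ᗮ) : ‖p.2‖ ≤ ‖axisMap e p‖ := by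
  have h : ‖axisMap e p‖ ^ 2 = p.1 ^ 2 + ‖p.2‖ ^ 2 := by
    rw [axisMap, norm_add_sq_real, real_inner_smul_left, inner_coe_orthogonal_span_singleton,
      norm_smul, he]
    simp
  refine le_of_sq_le_sq ?_ (norm_nonneg _)
  nlinarith [sq_nonneg p.1]

@[fun_prop]
lemma continuous_axisMap : Continuous (axisMap e) := by
  unfold axisMap
  fun_prop

/-- The defining function of the graph of `g` over the hyperplane orthogonal to `e`. -/
noncomputable def graphFun (e : Eu n) (g : Eu n → ℝ) (x : Eu n) : ℝ :=
  ⟪e, x⟫ - g (x - ⟪e, x⟫ • e)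

lemma graphFun_axisMap (he : ‖e‖ = 1) (g : Eu n → ℝ) (p : ℝ × (ℝ ∙ e)ᗮ) :
    graphFun e g (axisMap e p) = p.1 - g p.2 := by
  rw [graphFun, axisMap_sub he, inner_axisMap he]

lemma contDiff_graphFun {g : Eu n → ℝ} (hg : ContDiff ℝ 2 g) : ContDiff ℝ 2 (graphFun e g) := by
  have h : ContDiff ℝ 2 fun x : Eu n => ⟪e, x⟫ := contDiff_const.inner ℝ contDiff_id
  unfold graphFun
  fun_prop

/-- The parametrization of the graph of `g`. -/
noncomputable def graphMap (e : Eu n) (g : Eu n → ℝ) (y : (ℝ ∙ e)ᗮ) : Eu n := axisMap e (g y, y)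

lemma euclideanHausdorffMeasure_image_le {X Y : Type*} [EMetricSpace X] [EMetricSpace Y]
    [MeasurableSpace X] [MeasurableSpace Y] [BorelSpace X] [BorelSpace Y] {f : X → Y}
    (hf : LipschitzWith 1 f) (d : ℕ) (s : Set X) : (μHE[d] : Measure Y) (f '' s) ≤ μHE[d] s := by
  rw [Measure.euclideanHausdorffMeasure_def, Measure.euclideanHausdorffMeasure_def,
    Measure.smul_apply, Measure.smul_apply]
  gcongr
  simpa using hf.hausdorffMeasure_image_le (d := d) (by positivity) s

/-- The orthogonal projection onto the hyperplane is 1-Lipschitz and inverts `graphMap`, so it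
cannot increase Hausdorff measure. This is the only half of the area formula that is needed: the
density `√(1 + |∇g|²)` is at least `1`. -/
lemma map_graphMap_le (he : ‖e‖ = 1) {g : Eu n → ℝ} (hg : Continuous g) :
    (volume : Measure (ℝ ∙ e)ᗮ).map (graphMap e g) ≤ μHE[n - 1] := by
  have hm : Measurable (graphMap e g) := by
    unfold graphMap
    exact (continuous_axisMap.comp (by fun_prop)).measurable
  refine Measure.le_iff.2 fun A hA => ?_
  have he0 : e ≠ 0 := by
    rintro rfl
    simp at he
  -- A unit vector exists only for `n ≥ 1`, so the truncated subtraction `n - 1` is the true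
  -- dimension.
  have hr : Module.finrank ℝ (ℝ ∙ e)ᗮ = n - 1 := by
    have h := (ℝ ∙ e).finrank_add_finrank_orthogonal
    rw [finrank_span_singleton he0, finrank_euclideanSpace_fin] at h
    omega
  rw [Measure.map_apply hm hA, ← InnerProductSpace.euclideanHausdorffMeasure_eq_volume, hr]
  have hl : LipschitzWith 1 ((ℝ ∙ e)ᗮ).orthogonalProjectionOnto :=
    LipschitzWith.of_dist_le_mul fun x y => by
      rw [dist_eq_norm, dist_eq_norm, ← map_sub, NNReal.coe_one, one_mul]
      exact Submodule.norm_orthogonalProjectionOnto_apply_le _ _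
  refine (measure_mono ?_).trans (euclideanHausdorffMeasure_image_le hl _ A)
  intro y hy
  refine ⟨graphMap e g y, hy, ?_⟩
  rw [graphMap, axisMap, map_add, Submodule.orthogonalProjectionOnto_mem_subspace_eq_self]
  simp

lemma lintegral_graphMap_le (he : ‖e‖ = 1) {g : Eu n → ℝ} (hg : Continuous g)
    {f : Eu n → ℝ≥0∞} (hf : Measurable f) :
    ∫⁻ y, f (graphMap e g y) ≤ ∫⁻ x, f x ∂μHE[n - 1] := by
  have hm : Measurable (graphMap e g) := by
    unfold graphMap
    exact (continuous_axisMap.comp (by fun_prop)).measurable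
  rw [← lintegral_map hf hm]
  exact lintegral_mono' (map_graphMap_le he hg) le_rfl

/-- Each line parallel to `e` is translated by the constant `g y`, so Fubini's theorem reduces the
claim to translation invariance on `ℝ`. -/
lemma measurePreserving_shear (he : ‖e‖ = 1) {g : Eu n → ℝ} (hg : Continuous g) :
    MeasurePreserving (fun p : ℝ × (ℝ ∙ e)ᗮ => axisMap e (p.1 + g p.2, p.2))
      (volume.prod volume) volume := by
  have h : MeasurePreserving (fun p : (ℝ ∙ e)ᗮ × ℝ => (p.1, p.2 + g p.1))
      (volume.prod volume) (volume.prod volume) :=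
    MeasurePreserving.skew_product (g := fun (y : (ℝ ∙ e)ᗮ) (t : ℝ) => t + g y)
      (MeasurePreserving.id _) (by fun_prop)
      (Eventually.of_forall fun y => (measurePreserving_add_right volume (g y)).map_eq)
  exact (measurePreserving_axisMap he).comp
    (Measure.measurePreserving_swap.comp (h.comp Measure.measurePreserving_swap))

/-- The mean values of `f` over thin layers under a graph converge to the integral over the
graph. -/
lemma tendsto_lintegral_layer (he : ‖e‖ = 1) {g : Eu n → ℝ} (hg : Continuous g)
    {f f₀ : Eu n → ℝ≥0∞} (hf : Measurable f) (hf₀ : Measurable f₀) {M : ℝ≥0∞} (hM : M ≠ ⊤)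
    (hfM : ∀ x, f x ≤ M) {R : ℝ} (hR : ∀ x, R < ‖x‖ → f x = 0)
    (hlim : ∀ x, graphFun e g x = 0 → Tendsto f (𝓝[{z | graphFun e g z < 0}] x) (𝓝 (f₀ x))) :
    Tendsto (fun ε : ℝ => ENNReal.ofReal ε⁻¹ *
        ∫⁻ x in {z | graphFun e g z ∈ Ioo (-2 * ε) 0}, f x) (𝓝[>] 0)
      (𝓝 (2 * ∫⁻ y, f₀ (graphMap e g y))) := by
  have hGc : Continuous (graphFun e g) := by
    unfold graphFun
    fun_prop
  have hS : ∀ ε : ℝ, MeasurableSet {z | graphFun e g z ∈ Ioo (-2 * ε) 0} := fun ε =>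
    hGc.measurable measurableSet_Ioo
  have hGm : Measurable (graphMap e g) := by
    unfold graphMap
    exact (continuous_axisMap.comp (by fun_prop)).measurable
  have hY : ∀ ε : ℝ, Measurable fun p : ℝ × (ℝ ∙ e)ᗮ => axisMap e (ε * p.1 + g p.2, p.2) := by
    intro ε
    exact (continuous_axisMap.comp (by fun_prop)).measurable
  -- Straightening the graph by the shear and substituting `t = ε s` makes the domain `-2 < s < 0`
  -- independent of `ε`. The Jacobian `ε` cancels the prefactor.
  have key : ∀ ε : ℝ, 0 < ε → ENNReal.ofReal ε⁻¹ *
      ∫⁻ x in {z | graphFun e g z ∈ Ioo (-2 * ε) 0}, f x =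
      ∫⁻ p : ℝ × (ℝ ∙ e)ᗮ, (Ioo (-2 : ℝ) 0).indicator 1 p.1 *
        f (axisMap e (ε * p.1 + g p.2, p.2)) := by
    intro ε hε
    set h : ℝ × (ℝ ∙ e)ᗮ → ℝ≥0∞ := fun p => (Ioo (-2 * ε) 0).indicator 1 p.1 *
        f (axisMap e (p.1 + g p.2, p.2)) with hh
    have hhm : Measurable h := by
      refine Measurable.mul ?_ (hf.comp ?_)
      · exact (measurable_one.indicator measurableSet_Ioo).comp measurable_fst
      · simpa using hY 1
    have e1 : ∫⁻ x in {z | graphFun e g z ∈ Ioo (-2 * ε) 0}, f x = ∫⁻ p, h p := by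
      rw [← lintegral_indicator (hS ε), ← (measurePreserving_shear he hg).lintegral_comp
        (hf.indicator (hS ε)), Measure.volume_eq_prod]
      refine lintegral_congr fun p => ?_
      simp only [hh, indicator, mem_ofPred_eq, graphFun_axisMap he, add_sub_cancel_right,
        Pi.one_apply]
      split_ifs <;> simp
    have e2 : ∀ k : ℝ → ℝ≥0∞, Measurable k →
        ∫⁻ s, k (ε * s) = ENNReal.ofReal ε⁻¹ * ∫⁻ t, k t := by
      intro k hk
      rw [← lintegral_map hk (measurable_const_mul ε), Real.map_volume_mul_left hε.ne',
        lintegral_smul_measure, abs_of_pos (inv_pos.2 hε), smul_eq_mul]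
    rw [e1, Measure.volume_eq_prod, lintegral_prod _ hhm.aemeasurable, ← e2 _ hhm.lintegral_prod_right',
      lintegral_prod]
    · refine lintegral_congr fun s => lintegral_congr fun y => ?_
      simp only [hh]
      congr 1
      simp only [indicator, mem_Ioo, Pi.one_apply]
      congr 1
      rw [eq_iff_iff]
      constructor <;> rintro ⟨h1, h2⟩ <;> constructor <;> nlinarith
    · refine (Measurable.mul ?_ (hf.comp (hY ε))).aemeasurable
      exact (measurable_one.indicator measurableSet_Ioo).comp measurable_fst
  -- The factor `2` is the length of the interval `(-2, 0)`.
  have lim : 2 * ∫⁻ y, f₀ (graphMap e g y) = ∫⁻ p : ℝ × (ℝ ∙ e)ᗮ,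
      (Ioo (-2 : ℝ) 0).indicator 1 p.1 * f₀ (graphMap e g p.2) := by
    rw [Measure.volume_eq_prod, lintegral_prod_mul (f := (Ioo (-2 : ℝ) 0).indicator 1)
      (g := fun y => f₀ (graphMap e g y)) (measurable_one.indicator measurableSet_Ioo).aemeasurable
      (hf₀.comp hGm).aemeasurable, lintegral_indicator_one measurableSet_Ioo]
    simp
  rw [lim]
  refine Tendsto.congr' (f₁ := fun ε : ℝ => ∫⁻ p : ℝ × (ℝ ∙ e)ᗮ, (Ioo (-2 : ℝ) 0).indicator 1 p.1 *
        f (axisMap e (ε * p.1 + g p.2, p.2))) ?_ ?_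
  · filter_upwards [self_mem_nhdsWithin] with ε hε using (key ε hε).symm
  -- The majorant is `M` on a bounded cylinder: the component in the hyperplane is no longer than
  -- the point itself, so `f` vanishes once `‖p.2‖ > R`.
  refine tendsto_lintegral_filter_of_dominated_convergence
    (fun p => (Ioo (-2 : ℝ) 0).indicator 1 p.1 * (Metric.closedBall 0 R).indicator (fun _ => M) p.2)
    ?_ ?_ ?_ ?_
  · refine Eventually.of_forall fun ε => (Measurable.mul ?_ (hf.comp (hY ε)))
    exact (measurable_one.indicator measurableSet_Ioo).comp measurable_fst
  · refine Eventually.of_forall fun ε => Eventually.of_forall fun p => ?_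
    gcongr
    by_cases hp : p.2 ∈ Metric.closedBall 0 R
    · simp [indicator_of_mem hp, hfM]
    · rw [hR]
      · simp
      · simp only [mem_closedBall_zero_iff, not_le] at hp
        exact hp.trans_le (norm_snd_le_axisMap he (ε * p.1 + g p.2, p.2))
  · rw [Measure.volume_eq_prod, lintegral_prod_mul (f := (Ioo (-2 : ℝ) 0).indicator 1)
      (g := (Metric.closedBall 0 R).indicator (fun _ => M))
      (measurable_one.indicator measurableSet_Ioo).aemeasurable
      (measurable_const.indicator measurableSet_closedBall).aemeasurable,
      lintegral_indicator_one measurableSet_Ioo, lintegral_indicator measurableSet_closedBall]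
    simp only [lintegral_const, MeasurableSet.univ, Measure.restrict_apply, univ_inter]
    refine ENNReal.mul_ne_top (by simp) (ENNReal.mul_ne_top hM ?_)
    exact measure_closedBall_lt_top.ne
  · refine Eventually.of_forall fun p => ?_
    by_cases hp : p.1 ∈ Ioo (-2 : ℝ) 0
    · simp only [indicator_of_mem hp, Pi.one_apply, one_mul]
      refine (hlim (graphMap e g p.2) ?_).comp ?_
      · rw [graphMap, graphFun_axisMap he]
        simp
      · refine tendsto_nhdsWithin_iff.2 ⟨?_, ?_⟩
        · have : Continuous fun ε : ℝ => axisMap e (ε * p.1 + g p.2, p.2) :=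
            continuous_axisMap.comp (by fun_prop)
          have h := this.tendsto 0
          simp only [zero_mul, zero_add] at h
          exact h.mono_left nhdsWithin_le_nhds
        · filter_upwards [self_mem_nhdsWithin] with ε hε
          simp only [graphFun_axisMap he, add_sub_cancel_right]
          exact mul_neg_of_pos_of_neg hε hp.2
    · simp [indicator_of_notMem hp]

end Graph

/-! ### The slope of the smooth step function -/

section Cutoff

lemma deriv_smoothTransition_eq_zero {z : ℝ} (hz : z ∉ Icc (0 : ℝ) 1) :
    deriv Real.smoothTransition z = 0 := by
  rw [mem_Icc, not_and_or, not_le, not_le] at hz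
  rcases hz with hz | hz
  · have : Real.smoothTransition =ᶠ[𝓝 z] fun _ => 0 := by
      filter_upwards [Iio_mem_nhds hz] with t ht using Real.smoothTransition.zero_of_nonpos ht.le
    rw [this.deriv_eq, deriv_const]
  · have : Real.smoothTransition =ᶠ[𝓝 z] fun _ => 1 := by
      filter_upwards [Ioi_mem_nhds hz] with t ht using Real.smoothTransition.one_of_one_le ht.le
    rw [this.deriv_eq, deriv_const]

lemma exists_bound_deriv_smoothTransition :
    ∃ M > (0 : ℝ), ∀ z, |deriv Real.smoothTransition z| ≤ M := by
  have hc : Continuous (deriv Real.smoothTransition) :=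
    (Real.smoothTransition.contDiff (n := 1)).continuous_deriv le_rfl
  obtain ⟨M, hM⟩ := (isCompact_Icc (a := (0 : ℝ)) (b := 1)).exists_bound_of_continuousOn
    hc.continuousOn
  refine ⟨max M 1, by positivity, fun z => ?_⟩
  by_cases hz : z ∈ Icc (0 : ℝ) 1
  · exact (hM z hz).trans (le_max_left _ _)
  · rw [deriv_smoothTransition_eq_zero hz]
    simp

end Cutoff

/-! ### The divergence inequality in one boundary chart -/

section Chart

variable {n : ℕ} {e : Eu n} {g : Eu n → ℝ} {Ω W : Set (Eu n)}

lemma graphFun_add_smul (he : ‖e‖ = 1) (x : Eu n) (t : ℝ) :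
    graphFun e g (x + t • e) = graphFun e g x + t := by
  have h : ⟪e, x + t • e⟫ = ⟪e, x⟫ + t := by
    simp [inner_add_right, inner_smul_right, he]
  have h' : x + t • e - (⟪e, x⟫ + t) • e = x - ⟪e, x⟫ • e := by
    rw [add_smul]
    abel
  rw [graphFun, graphFun, h, h']
  ring

lemma graphFun_eq_zero_of_mem_frontier (hΩ : IsOpen Ω) (hg : ContDiff ℝ 2 g) (hW : IsOpen W)
    (hΩW : ∀ y ∈ W, y ∈ Ω ↔ graphFun e g y < 0) {y : Eu n} (hy : y ∈ frontier Ω) (hyW : y ∈ W) :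
    graphFun e g y = 0 := by
  rw [hΩ.frontier_eq] at hy
  refine le_antisymm ?_ (not_lt.1 fun h => hy.2 ((hΩW y hyW).2 h))
  by_contra! h
  have h1 : {z | 0 < graphFun e g z} ∩ W ∈ 𝓝 y :=
    ((isOpen_lt continuous_const (contDiff_graphFun hg).continuous).inter hW).mem_nhds ⟨h, hyW⟩
  obtain ⟨z, hz, hzΩ⟩ := mem_closure_iff_nhds.1 hy.1 _ h1
  exact lt_asymm hz.1 ((hΩW z hz.2).1 hzΩ)

lemma mem_frontier_of_graphFun_eq_zero (he : ‖e‖ = 1) (hΩ : IsOpen Ω) (hW : IsOpen W)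
    (hΩW : ∀ y ∈ W, y ∈ Ω ↔ graphFun e g y < 0) {y : Eu n} (hy : graphFun e g y = 0)
    (hyW : y ∈ W) : y ∈ frontier Ω := by
  rw [hΩ.frontier_eq]
  refine ⟨?_, fun h => by simpa [hy] using (hΩW y hyW).1 h⟩
  have hc : Tendsto (fun t : ℝ => y + t • e) (𝓝[<] 0) (𝓝 y) := by
    have : Continuous fun t : ℝ => y + t • e := by fun_prop
    have h := this.tendsto 0
    simp only [zero_smul, add_zero] at h
    exact h.mono_left nhdsWithin_le_nhds
  refine mem_closure_of_tendsto hc ?_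
  filter_upwards [hc.eventually (hW.mem_nhds hyW), self_mem_nhdsWithin] with t ht ht0
  rw [hΩW _ ht, graphFun_add_smul he, hy, zero_add]
  exact ht0

/-- Integration by parts against the constant function `1`, one coordinate at a time. -/
lemma integral_divergence_eq_zero {H : Eu n → Eu n} (hH : ContDiff ℝ 1 H)
    (hc : HasCompactSupport H) : ∫ x, divergence H x = 0 := by
  have hi : ∀ i, ContDiff ℝ 1 fun x => H x i := fun i => by fun_prop
  have hic : ∀ i, HasCompactSupport fun x => H x i := fun i =>
    hc.comp_left (g := fun v : Eu n => v i) (by simp)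
  have hpi : ∀ i, Integrable (pd i fun x => H x i) := fun i =>
    (((hi i).continuous_fderiv one_ne_zero).clm_apply continuous_const).integrable_of_hasCompactSupport
      ((hic i).fderiv_apply ℝ _)
  have hpi' : ∀ i, Integrable (fun x => fderiv ℝ (fun x => H x i) x
    (EuclideanSpace.single i 1)) volume := hpi
  unfold divergence
  rw [integral_finsetSum _ fun i _ => hpi i]
  refine Finset.sum_eq_zero fun i _ => ?_
  have h := integral_mul_fderiv_eq_neg_fderiv_mul_of_integrable (μ := (volume : Measure (Eu n)))
    (f := fun _ => (1 : ℝ)) (g := fun x => H x i) (v := EuclideanSpace.single i 1)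
    (by simp)
    (by simpa using hpi' i)
    (by simpa using (hi i).continuous.integrable_of_hasCompactSupport (hic i))
    (fun x _ => by fun_prop) (fun x _ => ((hi i).differentiable one_ne_zero) x)
  simpa [pd] using h

lemma integrableOn_of_continuousOn_of_bound (hΩ : IsOpen Ω) (hΩb : Bornology.IsBounded Ω)
    {f : Eu n → ℝ} (hf : ContinuousOn f Ω) {Q : ℝ} (hQ : ∀ x ∈ Ω, ‖f x‖ ≤ Q) :
    IntegrableOn f Ω := by
  have : IsFiniteMeasure (volume.restrict Ω) := ⟨by simpa using hΩb.measure_lt_top⟩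
  exact Integrable.of_bound (hf.aestronglyMeasurable hΩ.measurableSet) Q
    ((ae_restrict_iff' hΩ.measurableSet).2 (Eventually.of_forall hQ))

lemma continuousOn_divergence (hΩ : IsOpen Ω) {F : Eu n → Eu n} (hF : ContDiffOn ℝ 1 F Ω) :
    ContinuousOn (divergence F) Ω := by
  unfold divergence pd
  refine continuousOn_finsetSum _ fun i _ => ?_
  have : ContDiffOn ℝ 1 (fun y => F y i) Ω := by fun_prop
  exact (this.continuousOn_fderiv_of_isOpen hΩ le_rfl).clm_apply continuousOn_const

lemma measurable_indicator_enorm {S : Set (Eu n)} (hS : MeasurableSet S) {F : Eu n → Eu n}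
    (hF : ContinuousOn F S) : Measurable (S.indicator fun x => ‖F x‖ₑ) := by
  classical
  rw [← piecewise_eq_indicator]
  exact ContinuousOn.measurable_piecewise hF.enorm continuousOn_const hS

lemma divergence_smul {θ : Eu n → ℝ} {F : Eu n → Eu n} {x : Eu n} (hθ : DifferentiableAt ℝ θ x)
    (hF : DifferentiableAt ℝ F x) :
    divergence (fun y => θ y • F y) x = θ x * divergence F x + fderiv ℝ θ x (F x) := by
  have h1 : fderiv ℝ θ x (F x) = ∑ i, F x i * pd i θ x := by
    conv_lhs => rw [← (EuclideanSpace.basisFun (Fin n) ℝ).sum_repr (F x)]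
    simp [pd]
  rw [h1, divergence, divergence, Finset.mul_sum, ← Finset.sum_add_distrib]
  refine Finset.sum_congr rfl fun i _ => ?_
  have hFi : DifferentiableAt ℝ (fun y => F y i) x := by fun_prop
  simp only [pd, PiLp.smul_apply, smul_eq_mul]
  rw [fderiv_fun_mul hθ hFi]
  simp

/-- The divergence theorem in a chart of the boundary, up to a constant factor. -/
lemma exists_divergence_bound_chart (he : ‖e‖ = 1) (hΩ : IsOpen Ω)
    (hΩb : Bornology.IsBounded Ω) (hg : ContDiff ℝ 2 g)
    (hW : IsOpen W) (hΩW : ∀ y ∈ W, y ∈ Ω ↔ graphFun e g y < 0) {x₀ : Eu n} {r : ℝ}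
    (hr : Metric.closedBall x₀ r ⊆ W) :
    ∃ C > (0 : ℝ), ∀ F : Eu n → Eu n, ContDiffOn ℝ 1 F Ω → ContinuousOn F (closure Ω) →
      (∀ x ∉ Metric.closedBall x₀ r, F x = 0) → (∃ M, ∀ x ∈ Ω, |divergence F x| ≤ M) →
      ENNReal.ofReal |∫ x in Ω, divergence F x| ≤
        ENNReal.ofReal C * ∫⁻ x in frontier Ω ∩ W, ‖F x‖ₑ ∂μHE[n - 1] := by
  obtain ⟨M, hM0, hM⟩ := exists_bound_deriv_smoothTransition
  have hG := contDiff_graphFun (e := e) hg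
  have hGc := hG.continuous
  obtain ⟨L, hL⟩ := (isCompact_closedBall x₀ r).exists_bound_of_continuousOn
    (hG.continuous_fderiv two_ne_zero).continuousOn
  have hL' : ∀ x ∈ Metric.closedBall x₀ r, ‖fderiv ℝ (graphFun e g) x‖ ≤ max L 1 :=
    fun x hx => (hL x hx).trans (le_max_left _ _)
  set A := max L 1
  have hA : 0 < A := by positivity
  -- `M` bounds the slope of the step function and `A` the gradient of `graphFun` on the ball. The
  -- `2` is the limit factor of the layer means.
  refine ⟨M * A * 2, by positivity, fun F hF hFc hF0 hdiv => ?_⟩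
  obtain ⟨Q, hQ⟩ := hdiv
  have hFd : ∀ x ∈ Ω, DifferentiableAt ℝ F x := fun x hx =>
    (hF.contDiffAt (hΩ.mem_nhds hx)).differentiableAt one_ne_zero
  have hFev : ∀ x ∉ Metric.closedBall x₀ r, ∀ᶠ y in 𝓝 x, F y = 0 := fun x hx => by
    filter_upwards [Metric.isClosed_closedBall.isOpen_compl.mem_nhds hx] with y hy using hF0 y hy
  -- the functions cutting off a neighbourhood of the boundary
  let θ : ℝ → Eu n → ℝ := fun ε x => Real.smoothTransition (-(graphFun e g x) * ε⁻¹ - 1 / 2)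
  have hθ : ∀ ε, ContDiff ℝ 1 (θ ε) := fun ε => by
    have := hG.of_le (one_le_two)
    exact Real.smoothTransition.contDiff.comp (by fun_prop)
  -- The shift by `1/2` makes `θ ε` vanish on a full neighbourhood of the graph, so that `θ ε • F`
  -- extended by zero is `C¹` although `F` is `C¹` only in `Ω`. The gradient of `θ ε` lives where
  -- `ε/2 ≤ -graphFun ≤ 3ε/2`, inside the layer of thickness `2ε`.
  have hθ0 : ∀ ε > 0, ∀ x, -(ε / 2) < graphFun e g x → θ ε x = 0 := fun ε hε x hx => by
    apply Real.smoothTransition.zero_of_nonpos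
    rw [← div_eq_mul_inv, sub_nonpos, div_le_iff₀ hε]
    linarith
  have hdθ : ∀ ε > 0, ∀ x ∈ Metric.closedBall x₀ r, ‖fderiv ℝ (θ ε) x‖ ≤
      {z | graphFun e g z ∈ Ioo (-2 * ε) 0}.indicator (fun _ => M * A * ε⁻¹) x := by
    intro ε hε x hx
    have h1 : HasFDerivAt (θ ε) (deriv Real.smoothTransition (-(graphFun e g x) * ε⁻¹ - 1 / 2) •
        (-(ε⁻¹) • fderiv ℝ (graphFun e g) x)) x := by
      have h2 : HasFDerivAt (fun x => -(graphFun e g x) * ε⁻¹ - 1 / 2)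
          (-(ε⁻¹) • fderiv ℝ (graphFun e g) x) x := by
        have h3 := (((hG.differentiable two_ne_zero x).hasFDerivAt.neg).mul_const ε⁻¹).sub_const
          (1 / 2)
        convert! h3 using 1
        simp
      exact ((Real.smoothTransition.contDiff (n := 1)).differentiable
        one_ne_zero _).hasDerivAt.comp_hasFDerivAt x h2
    rw [h1.fderiv, norm_smul, norm_smul, norm_neg, norm_inv, Real.norm_of_nonneg hε.le]
    by_cases hz : -(graphFun e g x) * ε⁻¹ - 1 / 2 ∈ Icc (0 : ℝ) 1
    · rw [indicator_of_mem]
      · calc _ ≤ M * (ε⁻¹ * A) := by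
              gcongr
              · exact hM _
              · exact hL' x hx
          _ = _ := by ring
      · obtain ⟨h4, h5⟩ := hz
        rw [← div_eq_mul_inv] at h4 h5
        have h6 : 1 / 2 ≤ -graphFun e g x / ε := by linarith
        have h7 : -graphFun e g x / ε ≤ 3 / 2 := by linarith
        rw [le_div_iff₀ hε] at h6
        rw [div_le_iff₀ hε] at h7
        constructor <;> linarith
    · rw [deriv_smoothTransition_eq_zero hz, norm_zero, zero_mul]
      refine indicator_nonneg (fun _ _ => by positivity) _
  let H : ℝ → Eu n → Eu n := fun ε => Ω.indicator fun x => θ ε x • F x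
  -- near points outside of `Ω` the field vanishes
  have hH0 : ∀ ε > 0, ∀ x ∉ Ω, H ε =ᶠ[𝓝 x] fun _ => 0 := by
    intro ε hε x hx
    by_cases hxr : x ∈ Metric.closedBall x₀ r
    · have h1 : 0 ≤ graphFun e g x := not_lt.1 fun h => hx ((hΩW x (hr hxr)).2 h)
      filter_upwards [hGc.continuousAt.eventually
        (Ioi_mem_nhds (show -(ε / 2) < graphFun e g x by linarith))] with y hy
      simp [H, indicator, hθ0 ε hε y hy]
    · filter_upwards [hFev x hxr] with y hy
      simp [H, indicator, hy]
  have hHin : ∀ ε, ∀ x ∈ Ω, H ε =ᶠ[𝓝 x] fun x => θ ε x • F x := fun ε x hx => by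
    filter_upwards [hΩ.mem_nhds hx] with y hy using indicator_of_mem hy _
  have hHC : ∀ ε > 0, ContDiff ℝ 1 (H ε) := by
    intro ε hε
    refine contDiff_iff_contDiffAt.2 fun x => ?_
    by_cases hx : x ∈ Ω
    · exact ((hθ ε).contDiffAt.smul (hF.contDiffAt (hΩ.mem_nhds hx))).congr_of_eventuallyEq
        (hHin ε x hx)
    · exact contDiffAt_const.congr_of_eventuallyEq (hH0 ε hε x hx)
  have hHs : ∀ ε, HasCompactSupport (H ε) := fun ε =>
    HasCompactSupport.intro (isCompact_closedBall x₀ r) fun x hx => by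
      simp [H, indicator, hF0 x hx]
  have hdivH : ∀ ε > 0, ∀ x, divergence (H ε) x =
      Ω.indicator (fun x => θ ε x * divergence F x + fderiv ℝ (θ ε) x (F x)) x := by
    intro ε hε x
    have hcongr : ∀ K : Eu n → Eu n, H ε =ᶠ[𝓝 x] K → divergence (H ε) x = divergence K x := by
      intro K hK
      unfold divergence pd
      refine Finset.sum_congr rfl fun i _ => ?_
      have : (fun y => H ε y i) =ᶠ[𝓝 x] fun y => K y i := hK.fun_comp fun v : Eu n => v i
      rw [this.fderiv_eq]
    by_cases hx : x ∈ Ω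
    · rw [hcongr _ (hHin ε x hx), indicator_of_mem hx,
        divergence_smul ((hθ ε).differentiable one_ne_zero x) (hFd x hx)]
    · rw [hcongr _ (hH0 ε hε x hx), indicator_of_notMem hx]
      simp [divergence, pd]
  have hFin : ContinuousOn F Ω := hF.continuousOn
  have hdc := continuousOn_divergence hΩ hF
  obtain ⟨B, hB⟩ : ∃ B, ∀ x ∈ closure Ω, ‖F x‖ ≤ B := by
    obtain ⟨B, hB⟩ := (Metric.isCompact_of_isClosed_isBounded isClosed_closure
      hΩb.closure).exists_bound_of_continuousOn hFc
    exact ⟨B, hB⟩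
  have hi1 : ∀ ε, IntegrableOn (fun x => θ ε x * divergence F x) Ω := fun ε =>
    integrableOn_of_continuousOn_of_bound hΩ hΩb ((hθ ε).continuous.continuousOn.mul hdc) (Q := Q)
      fun x hx => by
        rw [norm_mul, Real.norm_eq_abs, Real.norm_eq_abs,
          abs_of_nonneg (Real.smoothTransition.nonneg _)]
        exact (mul_le_of_le_one_left (abs_nonneg _) (Real.smoothTransition.le_one _)).trans
          (hQ x hx)
  have hdF : ∀ ε > 0, ∀ x ∈ Ω, ‖fderiv ℝ (θ ε) x (F x)‖ ≤
      {z | graphFun e g z ∈ Ioo (-2 * ε) 0}.indicator (fun _ => M * A * ε⁻¹) x * ‖F x‖ := by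
    intro ε hε x hx
    by_cases hxr : x ∈ Metric.closedBall x₀ r
    · exact (ContinuousLinearMap.le_opNorm _ _).trans (by gcongr; exact hdθ ε hε x hxr)
    · simp [hF0 x hxr]
  have hi2 : ∀ ε > 0, IntegrableOn (fun x => fderiv ℝ (θ ε) x (F x)) Ω := fun ε hε =>
    integrableOn_of_continuousOn_of_bound hΩ hΩb
      (((hθ ε).continuous_fderiv one_ne_zero).continuousOn.clm_apply hFin) (Q := M * A * ε⁻¹ * B)
      fun x hx => (hdF ε hε x hx).trans <| by
        gcongr
        · exact indicator_le_self' (fun _ _ => by positivity) _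
        · exact hB x (subset_closure hx)
  set f : Eu n → ℝ≥0∞ := Ω.indicator fun x => ‖F x‖ₑ with hf
  set f₀ : Eu n → ℝ≥0∞ := (frontier Ω ∩ W).indicator fun x => ‖F x‖ₑ with hf₀
  have hfW : MeasurableSet (frontier Ω ∩ W) := isClosed_frontier.measurableSet.inter hW.measurableSet
  have hfm : Measurable f := measurable_indicator_enorm hΩ.measurableSet hFin
  have hf₀m : Measurable f₀ := measurable_indicator_enorm hfW
    (hFc.mono (inter_subset_left.trans frontier_subset_closure))
  -- Since `∫ div (θF) = 0`, the integral of `θ div F` is minus that of `∇θ · F`, which is at most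
  -- `M A / ε` times the integral of `|F|` over the layer.
  have hest : ∀ ε > 0, ENNReal.ofReal |∫ x in Ω, θ ε x * divergence F x| ≤
      ENNReal.ofReal (M * A) * (ENNReal.ofReal ε⁻¹ *
        ∫⁻ x in {z | graphFun e g z ∈ Ioo (-2 * ε) 0}, f x) := by
    intro ε hε
    have h0 := integral_divergence_eq_zero (hHC ε hε) (hHs ε)
    rw [funext (hdivH ε hε), integral_indicator hΩ.measurableSet,
      integral_add (hi1 ε) (hi2 ε hε)] at h0
    have hSm : MeasurableSet {z | graphFun e g z ∈ Ioo (-2 * ε) 0} :=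
      hGc.measurable measurableSet_Ioo
    rw [eq_neg_of_add_eq_zero_left h0, abs_neg, ← Real.norm_eq_abs, ofReal_norm]
    refine (enorm_integral_le_lintegral_enorm _).trans ?_
    rw [← mul_assoc, ← ENNReal.ofReal_mul (by positivity), ← lintegral_const_mul _ hfm,
      ← lintegral_indicator hSm, ← lintegral_indicator hΩ.measurableSet]
    refine lintegral_mono fun x => ?_
    by_cases hx : x ∈ Ω
    · have h1 := hdF ε hε x hx
      by_cases hxS : x ∈ {z | graphFun e g z ∈ Ioo (-2 * ε) 0}
      · rw [indicator_of_mem hxS] at h1 ⊢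
        rw [indicator_of_mem hx, hf, indicator_of_mem hx, ← ofReal_norm,
          ← ofReal_norm, ← ENNReal.ofReal_mul (by positivity)]
        exact ENNReal.ofReal_le_ofReal h1
      · rw [indicator_of_notMem hxS, zero_mul, norm_le_zero_iff] at h1
        simp [indicator_of_mem hx, h1]
    · simp [indicator_of_notMem hx]
  have hlim1 : Tendsto (fun ε : ℝ => ∫ x in Ω, θ ε x * divergence F x) (𝓝[>] 0)
      (𝓝 (∫ x in Ω, divergence F x)) := by
    refine tendsto_integral_filter_of_dominated_convergence (fun _ => Q)
      (Eventually.of_forall fun ε => (hi1 ε).aestronglyMeasurable) ?_ ?_ ?_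
    · refine Eventually.of_forall fun ε => (ae_restrict_iff' hΩ.measurableSet).2 ?_
      refine Eventually.of_forall fun x hx => ?_
      rw [norm_mul, Real.norm_eq_abs, Real.norm_eq_abs,
        abs_of_nonneg (Real.smoothTransition.nonneg _)]
      exact (mul_le_of_le_one_left (abs_nonneg _) (Real.smoothTransition.le_one _)).trans (hQ x hx)
    · exact integrableOn_const hΩb.measure_lt_top.ne
    · refine (ae_restrict_iff' hΩ.measurableSet).2 (Eventually.of_forall fun x hx => ?_)
      refine tendsto_const_nhds.congr' ?_
      by_cases hxr : x ∈ Metric.closedBall x₀ r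
      · have h1 : 0 < -graphFun e g x := neg_pos.2 ((hΩW x (hr hxr)).1 hx)
        filter_upwards [Ioo_mem_nhdsGT (show 0 < -graphFun e g x / 2 by positivity)] with ε hε
        have h2 : θ ε x = 1 := by
          apply Real.smoothTransition.one_of_one_le
          rw [← div_eq_mul_inv, le_sub_iff_add_le, le_div_iff₀ hε.1]
          linarith [hε.2]
        rw [h2, one_mul]
      · have h1 : divergence F x = 0 := by
          unfold divergence pd
          refine Finset.sum_eq_zero fun i _ => ?_
          have : (fun y => F y i) =ᶠ[𝓝 x] fun _ => 0 := by
            filter_upwards [hFev x hxr] with y hy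
            simp [hy]
          rw [this.fderiv_eq]
          simp
        simp [h1]
  have hlim2 := tendsto_lintegral_layer he hg.continuous hfm hf₀m (M := ENNReal.ofReal B)
    ENNReal.ofReal_ne_top ?_ (R := ‖x₀‖ + r) ?_ ?_
  · refine (le_of_tendsto_of_tendsto (ENNReal.tendsto_ofReal hlim1.abs)
      (ENNReal.Tendsto.const_mul (a := ENNReal.ofReal (M * A)) hlim2 (Or.inr ENNReal.ofReal_ne_top)) ?_).trans ?_
    · filter_upwards [self_mem_nhdsWithin] with ε hε using hest ε hε
    · rw [ENNReal.ofReal_mul (p := M * A) (by positivity), mul_assoc, ENNReal.ofReal_ofNat,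
        ← lintegral_indicator hfW]
      gcongr
      exact lintegral_graphMap_le he hg.continuous hf₀m
  · intro x
    by_cases hx : x ∈ Ω
    · rw [hf, indicator_of_mem hx, ← ofReal_norm]
      exact ENNReal.ofReal_le_ofReal (hB x (subset_closure hx))
    · simp [hf, indicator_of_notMem hx]
  · intro x hx
    have : x ∉ Metric.closedBall x₀ r := fun h => by
      rw [mem_closedBall_iff_norm] at h
      linarith [norm_le_norm_add_norm_sub' x x₀]
    simp [hf, indicator, hF0 x this]
  · intro x hx
    by_cases hxr : x ∈ Metric.closedBall x₀ r
    · have hxf := mem_frontier_of_graphFun_eq_zero he hΩ hW hΩW hx (hr hxr)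
      rw [hf₀, indicator_of_mem (show x ∈ frontier Ω ∩ W from ⟨hxf, hr hxr⟩)]
      -- Below the graph and close to `x` the points lie in `Ω`, so the limit from below is a limit
      -- within `closure Ω`, where `F` is continuous.
      have h1 : ∀ᶠ z in 𝓝[{z | graphFun e g z < 0}] x, z ∈ Ω := by
        filter_upwards [self_mem_nhdsWithin, nhdsWithin_le_nhds (hW.mem_nhds (hr hxr))]
          with z hz hzW using (hΩW z hzW).2 hz
      have h2 : Tendsto (fun z => ‖F z‖ₑ) (𝓝[{z | graphFun e g z < 0}] x) (𝓝 ‖F x‖ₑ) :=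
        (hFc.enorm x (frontier_subset_closure hxf)).tendsto.mono_left
          (nhdsWithin_le_of_mem (h1.mono fun z hz => subset_closure hz))
      refine h2.congr' ?_
      filter_upwards [h1] with z hz
      exact (indicator_of_mem hz fun x => ‖F x‖ₑ).symm
    · have h1 : f₀ x = 0 := by simp [hf₀, indicator, hF0 x hxr]
      rw [h1]
      refine tendsto_const_nhds.congr' ?_
      filter_upwards [nhdsWithin_le_nhds (hFev x hxr)] with z hz
      simp [hf, indicator, hz]

end Chart

/-! ### The divergence inequality on superlevel sets -/

section Global

variable {n : ℕ} {Ω : Set (Eu n)} {ξ : Eu n → ℝ}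

lemma abs_divergence_le (F : Eu n → Eu n) {x : Eu n} (hF : DifferentiableAt ℝ F x) :
    |divergence F x| ≤ n * ‖fderiv ℝ F x‖ := by
  unfold divergence pd
  refine (Finset.abs_sum_le_sum_abs _ _).trans ?_
  have h : ∀ i : Fin n, |fderiv ℝ (fun y => F y i) x (EuclideanSpace.single i 1)| ≤
      ‖fderiv ℝ F x‖ := fun i => by
    have h1 : HasFDerivAt (fun y => F y i)
        ((EuclideanSpace.proj i : Eu n →L[ℝ] ℝ).comp (fderiv ℝ F x)) x :=
      (EuclideanSpace.proj i : Eu n →L[ℝ] ℝ).hasFDerivAt.comp x hF.hasFDerivAt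
    rw [h1.fderiv, ContinuousLinearMap.comp_apply, ← Real.norm_eq_abs]
    refine (PiLp.norm_apply_le _ i).trans ((ContinuousLinearMap.le_opNorm _ _).trans ?_)
    simp
  simpa using Finset.sum_le_sum fun i (_ : i ∈ Finset.univ) => h i

lemma divergence_congr {F H : Eu n → Eu n} {x : Eu n} (h : F =ᶠ[𝓝 x] H) :
    divergence F x = divergence H x := by
  unfold divergence pd
  refine Finset.sum_congr rfl fun i _ => ?_
  have : (fun y => F y i) =ᶠ[𝓝 x] fun y => H y i := h.fun_comp fun v : Eu n => v i
  rw [this.fderiv_eq]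

lemma divergence_sum {ι : Type*} (s : Finset ι) {F : ι → Eu n → Eu n} {x : Eu n}
    (hF : ∀ j ∈ s, DifferentiableAt ℝ (F j) x) :
    divergence (fun y => ∑ j ∈ s, F j y) x = ∑ j ∈ s, divergence (F j) x := by
  unfold divergence pd
  rw [Finset.sum_comm]
  refine Finset.sum_congr rfl fun i _ => ?_
  have : (fun y => (∑ j ∈ s, F j y) i) = fun y => ∑ j ∈ s, F j y i := by
    ext y
    simp
  rw [this, fderiv_fun_sum]
  · simp
  · intro j hj
    have := hF j hj
    fun_prop

/-- Around an interior point the integral vanishes, because the field has compact support in `Ω`.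
Around a boundary point the chart estimate applies, with the chart shrunk to a set where `ξ > d`
still holds on `closure Ω`. -/
lemma exists_divergence_bound_nhds (hΩ : IsOpen Ω) (hΩb : Bornology.IsBounded Ω)
    (hξ : ContinuousOn ξ (closure Ω)) {d : ℝ}
    (hC : ∀ x ∈ frontier Ω, d < ξ x → ∃ ν, IsC2BoundaryPoint Ω x ν) {x : Eu n}
    (hx : x ∈ closure Ω) (hdx : d < ξ x) :
    ∃ V : Set (Eu n), IsOpen V ∧ x ∈ V ∧ ∃ C > (0 : ℝ), ∀ F : Eu n → Eu n, ContDiffOn ℝ 1 F Ω →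
      ContinuousOn F (closure Ω) → (∀ y ∉ V, F y = 0) → (∃ M, ∀ y ∈ Ω, |divergence F y| ≤ M) →
      ENNReal.ofReal |∫ y in Ω, divergence F y| ≤
        ENNReal.ofReal C * ∫⁻ y in {y | y ∈ frontier Ω ∧ d < ξ y}, ‖F y‖ₑ ∂μHE[n - 1] := by
  by_cases hxΩ : x ∈ Ω
  · obtain ⟨r, hr0, hr⟩ := Metric.nhds_basis_closedBall.mem_iff.1 (hΩ.mem_nhds hxΩ)
    refine ⟨Metric.ball x r, Metric.isOpen_ball, Metric.mem_ball_self hr0, 1, one_pos,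
      fun F hF _ hF0 _ => ?_⟩
    have h0 : ∀ y ∉ Metric.closedBall x r, F y = 0 := fun y hy =>
      hF0 y fun h => hy (Metric.ball_subset_closedBall h)
    have hev : ∀ y ∉ Metric.closedBall x r, F =ᶠ[𝓝 y] fun _ => 0 := fun y hy => by
      filter_upwards [Metric.isClosed_closedBall.isOpen_compl.mem_nhds hy] with z hz using h0 z hz
    have h1 : ContDiff ℝ 1 F := contDiff_iff_contDiffAt.2 fun y => by
      by_cases hy : y ∈ Metric.closedBall x r
      · exact hF.contDiffAt (hΩ.mem_nhds (hr hy))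
      · exact contDiffAt_const.congr_of_eventuallyEq (hev y hy)
    have h2 := integral_divergence_eq_zero h1
      (HasCompactSupport.intro (isCompact_closedBall x r) h0)
    rw [setIntegral_eq_integral_of_forall_compl_eq_zero, h2]
    · simp
    · intro y hy
      rw [divergence_congr (hev y fun h => hy (hr h))]
      simp [divergence, pd]
  · have hxf : x ∈ frontier Ω := by
      rw [hΩ.frontier_eq]
      exact ⟨hx, hxΩ⟩
    obtain ⟨ν, -, e, g, W, he, hg, hW, hxW, hΩW, -⟩ := hC x hxf hdx
    have h1 : ∀ᶠ y in 𝓝[closure Ω] x, d < ξ y := (hξ x hx).eventually (lt_mem_nhds hdx)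
    obtain ⟨O, hO, hxO, hOξ⟩ := mem_nhdsWithin.1 h1
    obtain ⟨r, hr0, hr⟩ := Metric.nhds_basis_closedBall.mem_iff.1 ((hW.inter hO).mem_nhds ⟨hxW, hxO⟩)
    obtain ⟨C, hC0, hC⟩ := exists_divergence_bound_chart he hΩ hΩb hg (hW.inter hO)
      (fun y hy => (hΩW y hy.1).trans sub_neg.symm) hr
    refine ⟨Metric.ball x r, Metric.isOpen_ball, Metric.mem_ball_self hr0, C, hC0,
      fun F hF hFc hF0 hdiv => (hC F hF hFc (fun y hy => hF0 y fun h =>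
        hy (Metric.ball_subset_closedBall h)) hdiv).trans ?_⟩
    gcongr
    exact fun y hy => ⟨hy.1, hOξ ⟨hy.2.2, frontier_subset_closure hy.1⟩⟩

/-- The part of `closure Ω` with `ξ ≥ d'` is compact and is covered by finitely many good
neighbourhoods. A subordinate partition of unity splits the field, and the local constants add up.
-/
lemma exists_divergence_bound_of_vanish (hΩ : IsOpen Ω) (hΩb : Bornology.IsBounded Ω)
    (hξ : ContinuousOn ξ (closure Ω)) {d d' : ℝ} (hd : d < d')
    (hC : ∀ x ∈ frontier Ω, d < ξ x → ∃ ν, IsC2BoundaryPoint Ω x ν) :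
    ∃ C > (0 : ℝ), ∀ F : Eu n → Eu n, ContDiffOn ℝ 1 F Ω →
      ContinuousOn F (closure Ω) → (∀ y ∈ Ω, ξ y < d' → F y = 0) →
      (∃ M, ∀ y ∈ Ω, |divergence F y| ≤ M) →
      ENNReal.ofReal |∫ y in Ω, divergence F y| ≤
        ENNReal.ofReal C * ∫⁻ y in {y | y ∈ frontier Ω ∧ d < ξ y}, ‖F y‖ₑ ∂μHE[n - 1] := by
  have hΩc : IsCompact (closure Ω) :=
    Metric.isCompact_of_isClosed_isBounded isClosed_closure hΩb.closure
  set Q : Set (Eu n) := closure Ω ∩ ξ ⁻¹' Ici d' with hQ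
  have hQc : IsCompact Q := hΩc.of_isClosed_subset
    (hξ.preimage_isClosed_of_isClosed isClosed_closure isClosed_Ici) inter_subset_left
  choose! V hVo hxV C hC0 hCV using fun x (hx : x ∈ Q) =>
    exists_divergence_bound_nhds hΩ hΩb hξ hC hx.1 (hd.trans_le hx.2)
  obtain ⟨t, htQ, htc⟩ := hQc.elim_nhds_subcover V fun x hx => (hVo x hx).mem_nhds (hxV x hx)
  obtain ⟨η, hη⟩ := SmoothPartitionOfUnity.exists_isSubordinate (modelWithCornersSelf ℝ (Eu n))
    hQc.isClosed (fun x : t => V x) (fun x => hVo x (htQ x x.2))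
    (fun x hx => by simpa using htc hx)
  refine ⟨∑ x : t, C x + 1, ?_, fun F hF hFc hF0 hdiv => ?_⟩
  · have : 0 ≤ ∑ x : t, C x := Finset.sum_nonneg fun x _ => (hC0 x (htQ x x.2)).le
    positivity
  obtain ⟨M, hM⟩ := hdiv
  have hηd : ∀ j, ContDiff ℝ 1 (η j) := fun j =>
    ((η j).contMDiff.contDiff).of_le (mod_cast le_top)
  have hFd : ∀ x ∈ Ω, DifferentiableAt ℝ F x := fun x hx =>
    (hF.contDiffAt (hΩ.mem_nhds hx)).differentiableAt one_ne_zero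
  -- The partition sums to `1` only on `Q`. At the other points of `Ω` the field is zero.
  have hsum : ∀ x ∈ Ω, ∑ j, η j x • F x = F x := by
    intro x hx
    by_cases hxd : ξ x < d'
    · simp [hF0 x hx hxd]
    · have h1 := η.sum_eq_one (show x ∈ Q from ⟨subset_closure hx, not_lt.1 hxd⟩)
      rw [finsum_eq_sum_of_fintype] at h1
      rw [← Finset.sum_smul, h1, one_smul]
  have hdivj : ∀ j, ∀ x ∈ Ω, divergence (fun y => η j y • F y) x =
      η j x * divergence F x + fderiv ℝ (η j) x (F x) := fun j x hx =>
    divergence_smul ((hηd j).differentiable one_ne_zero x) (hFd x hx)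
  obtain ⟨B, hB0, hB⟩ := exists_bound_of_contDiffOn_closure hΩc hFc
  have hbd : ∀ j, ∃ M, ∀ y ∈ Ω, |divergence (fun y => η j y • F y) y| ≤ M := by
    intro j
    obtain ⟨L, hL0, hL⟩ := exists_bound_of_contDiffOn_closure hΩc
      ((hηd j).continuous_fderiv one_ne_zero).continuousOn
    refine ⟨M + L * B, fun y hy => ?_⟩
    rw [hdivj j y hy]
    refine (abs_add_le _ _).trans (add_le_add ?_ ?_)
    · rw [abs_mul, abs_of_nonneg (η.nonneg j y)]
      exact (mul_le_of_le_one_left (abs_nonneg _) (η.le_one j y)).trans (hM y hy)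
    · exact (ContinuousLinearMap.le_opNorm _ _).trans
        (mul_le_mul (hL y hy) (hB y hy) (norm_nonneg _) hL0.le)
  have hcd : ∀ j, ContDiffOn ℝ 1 (fun y => η j y • F y) Ω := fun j => (hηd j).contDiffOn.smul hF
  have hint : ∫ y in Ω, divergence F y = ∑ j, ∫ y in Ω, divergence (fun y => η j y • F y) y := by
    rw [← integral_finsetSum]
    · refine setIntegral_congr_fun hΩ.measurableSet fun x hx => ?_
      rw [← divergence_sum _ fun j _ =>
        ((hcd j).contDiffAt (hΩ.mem_nhds hx)).differentiableAt one_ne_zero]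
      refine divergence_congr ?_
      filter_upwards [hΩ.mem_nhds hx] with y hy using (hsum y hy).symm
    · intro j _
      obtain ⟨M', hM'⟩ := hbd j
      exact integrableOn_of_continuousOn_of_bound hΩ hΩb (continuousOn_divergence hΩ (hcd j)) hM'
  have hj : ∀ j : t, ENNReal.ofReal |∫ y in Ω, divergence (fun y => η j y • F y) y| ≤
      ENNReal.ofReal (C j) * ∫⁻ y in {y | y ∈ frontier Ω ∧ d < ξ y}, ‖F y‖ₑ ∂μHE[n - 1] := by
    intro j
    refine (hCV j (htQ j j.2) _ (hcd j) ((hηd j).continuous.continuousOn.smul hFc) ?_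
      (hbd j)).trans ?_
    · intro y hy
      have : η j y = 0 := image_eq_zero_of_notMem_tsupport fun h => hy (hη j h)
      simp [this]
    · gcongr with y
      rw [enorm_smul]
      refine mul_le_of_le_one_left (by simp) ?_
      rw [← ofReal_norm, ENNReal.ofReal_le_one, Real.norm_of_nonneg (η.nonneg j y)]
      exact η.le_one j y
  rw [hint]
  calc _ ≤ ENNReal.ofReal (∑ j, |∫ y in Ω, divergence (fun y => η j y • F y) y|) :=
        ENNReal.ofReal_le_ofReal (Finset.abs_sum_le_sum_abs _ _)
    _ = ∑ j, ENNReal.ofReal |∫ y in Ω, divergence (fun y => η j y • F y) y| :=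
        ENNReal.ofReal_sum_of_nonneg fun _ _ => abs_nonneg _
    _ ≤ ∑ j : t, ENNReal.ofReal (C j) *
        ∫⁻ y in {y | y ∈ frontier Ω ∧ d < ξ y}, ‖F y‖ₑ ∂μHE[n - 1] :=
        Finset.sum_le_sum fun j _ => hj j
    _ = ENNReal.ofReal (∑ j : t, C j) *
        ∫⁻ y in {y | y ∈ frontier Ω ∧ d < ξ y}, ‖F y‖ₑ ∂μHE[n - 1] := by
        rw [← Finset.sum_mul, ENNReal.ofReal_sum_of_nonneg (fun (x : t) _ => (hC0 x (htQ x x.2)).le)]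
    _ ≤ _ := by
        gcongr
        linarith

lemma isOpen_superlevel (hΩ : IsOpen Ω) (hξ : ContinuousOn ξ (closure Ω)) (d : ℝ) :
    IsOpen (superlevel Ω ξ d) :=
  (hξ.mono subset_closure).isOpen_inter_preimage hΩ isOpen_Ioi

/-- Near a point with `ξ > d` the closures of `Ω` and of `Ω_d` coincide. This transfers continuity
up to `∂Ω` from one set to the other, although `ξ` is controlled only on `closure Ω`. -/
lemma mem_nhdsWithin_closure_superlevel (hξ : ContinuousOn ξ (closure Ω)) {d : ℝ} {x : Eu n}
    (hx : x ∈ closure Ω) (hdx : d < ξ x) : closure (superlevel Ω ξ d) ∈ 𝓝[closure Ω] x := by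
  obtain ⟨O, hO, hxO, hOξ⟩ := mem_nhdsWithin.1 ((hξ x hx).eventually (lt_mem_nhds hdx))
  refine mem_nhdsWithin.2 ⟨O, hO, hxO, fun y hy => ?_⟩
  refine closure_mono ?_ (hO.inter_closure hy)
  exact fun z hz => ⟨hz.2, hOξ ⟨hz.1, subset_closure hz.2⟩⟩

/-- Gauss' formula, up to a constant factor, for fields that vanish near the inner part of the
boundary of a superlevel set. -/
lemma exists_divergence_bound (hΩ : IsOpen Ω) (hΩb : Bornology.IsBounded Ω)
    (hξ : ContinuousOn ξ (closure Ω)) {d d' : ℝ} (hd : d < d')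
    (hC : ∀ x ∈ frontier Ω, d < ξ x → ∃ ν, IsC2BoundaryPoint Ω x ν) :
    ∃ C > (0 : ℝ), ∀ U : Eu n → Eu n, ContDiffOn ℝ 1 U (closure (superlevel Ω ξ d)) →
      (∀ y ∈ superlevel Ω ξ d, ξ y < d' → U y = 0) →
      ENNReal.ofReal |∫ y in superlevel Ω ξ d, divergence U y| ≤
        ENNReal.ofReal C * ∫⁻ y in {y | y ∈ frontier Ω ∧ d < ξ y}, ‖U y‖ₑ ∂μHE[n - 1] := by
  obtain ⟨C, hC0, hC⟩ := exists_divergence_bound_of_vanish hΩ hΩb hξ hd hC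
  refine ⟨C, hC0, fun U hU hU0 => ?_⟩
  set D := superlevel Ω ξ d with hD
  have hDo : IsOpen D := isOpen_superlevel hΩ hξ d
  have hDb : Bornology.IsBounded D := hΩb.subset fun x hx => hx.1
  -- By continuity the field also vanishes on the part of `∂Ω` with `d < ξ < d'`.
  have hU0' : ∀ y ∈ closure Ω, d < ξ y → ξ y < d' → U y = 0 := by
    intro y hy hdy hyd
    have h1 : closure D ∈ 𝓝[closure Ω] y := mem_nhdsWithin_closure_superlevel hξ hy hdy
    have hyD : y ∈ closure D := mem_of_mem_nhdsWithin hy h1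
    have hne : (𝓝[D] y).NeBot := mem_closure_iff_nhdsWithin_neBot.1 hyD
    have h2 : Tendsto U (𝓝[D] y) (𝓝 (U y)) :=
      (hU.continuousOn y hyD).tendsto.mono_left (nhdsWithin_mono _ subset_closure)
    refine tendsto_nhds_unique h2 (tendsto_const_nhds.congr' ?_)
    have h3 : ∀ᶠ z in 𝓝[D] y, ξ z < d' := by
      refine ((hξ y hy).eventually (gt_mem_nhds hyd)).filter_mono (nhdsWithin_mono _ ?_)
      exact fun z hz => subset_closure hz.1
    filter_upwards [h3, self_mem_nhdsWithin] with z hz hzD using (hU0 z hzD hz).symm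
  -- `U` means nothing outside the closure of `Ω_d`. It is replaced by its extension by zero to
  -- `closure Ω`, which is regular because `U` vanishes on the strip `d < ξ < d'`.
  set F : Eu n → Eu n := {y | d < ξ y}.indicator U with hFdef
  have hF0 : ∀ y ∈ closure Ω, ξ y < d' → F y = 0 := by
    intro y hy hyd
    by_cases h : d < ξ y
    · rw [hFdef, indicator_of_mem (show y ∈ {y | d < ξ y} from h), hU0' y hy h hyd]
    · rw [hFdef, indicator_of_notMem (show y ∉ {y | d < ξ y} from h)]
  have hev0 : ∀ x ∈ closure Ω, ξ x ≤ d → ∀ᶠ y in 𝓝[closure Ω] x, F y = 0 := by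
    intro x hx hxd
    filter_upwards [(hξ x hx).eventually (gt_mem_nhds (hxd.trans_lt hd)),
      self_mem_nhdsWithin] with y hy hyΩ using hF0 y hyΩ hy
  have hev1 : ∀ x ∈ D, F =ᶠ[𝓝 x] U := fun x hx => by
    filter_upwards [hDo.mem_nhds hx] with y hy
    exact indicator_of_mem (show y ∈ {y | d < ξ y} from hy.2) _
  have hev2 : ∀ x ∈ Ω, x ∉ D → F =ᶠ[𝓝 x] fun _ => 0 := fun x hx hxD => by
    have h := hev0 x (subset_closure hx) (not_lt.1 fun h => hxD ⟨hx, h⟩)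
    rwa [nhdsWithin_eq_nhds.2 (mem_of_superset (hΩ.mem_nhds hx) subset_closure)] at h
  have hUat : ∀ x ∈ D, ContDiffAt ℝ 1 U x := fun x hx =>
    hU.contDiffAt (mem_of_superset (hDo.mem_nhds hx) subset_closure)
  have hF : ContDiffOn ℝ 1 F Ω := fun x hx => by
    refine ContDiffAt.contDiffWithinAt ?_
    by_cases hxD : x ∈ D
    · exact (hUat x hxD).congr_of_eventuallyEq (hev1 x hxD)
    · exact contDiffAt_const.congr_of_eventuallyEq (hev2 x hx hxD)
  have hFc : ContinuousOn F (closure Ω) := by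
    intro x hx
    by_cases hxd : d < ξ x
    · have h1 : closure D ∈ 𝓝[closure Ω] x := mem_nhdsWithin_closure_superlevel hξ hx hxd
      have h2 : ContinuousWithinAt U (closure Ω) x :=
        (hU.continuousOn x (mem_of_mem_nhdsWithin hx h1)).mono_of_mem_nhdsWithin h1
      refine h2.congr_of_eventuallyEq ?_ (indicator_of_mem (show x ∈ {y | d < ξ y} from hxd) _)
      filter_upwards [(hξ x hx).eventually (lt_mem_nhds hxd)] with y hy
      exact indicator_of_mem (show y ∈ {y | d < ξ y} from hy) _
    · have h := hev0 x hx (not_lt.1 hxd)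
      exact continuousWithinAt_const.congr_of_eventuallyEq h (h.self_of_nhdsWithin hx)
  have hdiv : ∀ x ∈ Ω, divergence F x = D.indicator (divergence U) x := by
    intro x hx
    by_cases hxD : x ∈ D
    · rw [divergence_congr (hev1 x hxD), indicator_of_mem hxD]
    · rw [divergence_congr (hev2 x hx hxD), indicator_of_notMem hxD]
      simp [divergence, pd]
  obtain ⟨L, hL0, hL⟩ := exists_bound_fderiv hDo
    (Metric.isCompact_of_isClosed_isBounded isClosed_closure hDb.closure) hU
  have h := hC F hF hFc (fun y hy => hF0 y (subset_closure hy)) ⟨n * L, fun x hx => ?_⟩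
  · rw [setIntegral_congr_fun hΩ.measurableSet hdiv, setIntegral_indicator hDo.measurableSet,
      inter_eq_self_of_subset_right fun x hx => hx.1] at h
    refine h.trans ?_
    gcongr with y
    by_cases hy : d < ξ y
    · rw [hFdef, indicator_of_mem (show y ∈ {y | d < ξ y} from hy)]
    · rw [hFdef, indicator_of_notMem (show y ∉ {y | d < ξ y} from hy)]
      simp
  · rw [hdiv x hx]
    by_cases hxD : x ∈ D
    · rw [indicator_of_mem hxD]
      refine (abs_divergence_le U ((hUat x hxD).differentiableAt one_ne_zero)).trans ?_
      gcongr
      exact hL x hxD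
    · rw [indicator_of_notMem hxD, abs_zero]
      positivity

end Global

/-! ### Cauchy data and the boundary values of the gradient -/

section Trace

variable {n : ℕ} {Ω Γ : Set (Eu n)} {ν : Eu n → Eu n}

lemma fderiv_graphFun_self {e : Eu n} {g : Eu n → ℝ} (he : ‖e‖ = 1) (hg : ContDiff ℝ 2 g)
    (x : Eu n) : fderiv ℝ (graphFun e g) x e = 1 := by
  have h1 : HasFDerivAt (graphFun e g) (fderiv ℝ (graphFun e g) x) (x + (0 : ℝ) • e) := by
    rw [zero_smul, add_zero]
    exact ((contDiff_graphFun hg).differentiable two_ne_zero x).hasFDerivAt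
  have h2 : HasDerivAt (fun t : ℝ => x + t • e) e 0 := by
    simpa using ((hasDerivAt_id (0 : ℝ)).smul_const e).const_add x
  have h3 := h1.comp_hasDerivAt (0 : ℝ) h2
  have h4 : HasDerivAt (graphFun e g ∘ fun t : ℝ => x + t • e) 1 0 := by
    have : (graphFun e g ∘ fun t : ℝ => x + t • e) = fun t => graphFun e g x + t := by
      ext t
      exact graphFun_add_smul he x t
    rw [this]
    exact (hasDerivAt_id (0 : ℝ)).const_add _
  exact h3.unique h4

/-- The line `x + t z`, pushed back onto the graph along `e`, is a curve in the boundary. Its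
velocity at `0` is `z` because the differential of `graphFun` kills `z`, so both `L₁ z` and `L₂ z`
are the derivative of `p` along it. -/
lemma hasFDerivWithinAt_unique_on_tangent {e : Eu n} {g : Eu n → ℝ} {W O : Set (Eu n)}
    (he : ‖e‖ = 1) (hΩ : IsOpen Ω) (hg : ContDiff ℝ 2 g) (hW : IsOpen W)
    (hΩW : ∀ y ∈ W, y ∈ Ω ↔ graphFun e g y < 0) (hO : IsOpen O) {x : Eu n}
    (hx : x ∈ O ∩ frontier Ω) (hxW : x ∈ W) {p : Eu n → ℝ} {L₁ L₂ : Eu n →L[ℝ] ℝ}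
    (h₁ : HasFDerivWithinAt p L₁ (O ∩ frontier Ω) x)
    (h₂ : HasFDerivWithinAt p L₂ (O ∩ frontier Ω) x) {z : Eu n}
    (hz : fderiv ℝ (graphFun e g) x z = 0) : L₁ z = L₂ z := by
  have hG := contDiff_graphFun (e := e) hg
  have hGx : graphFun e g x = 0 := graphFun_eq_zero_of_mem_frontier hΩ hg hW hΩW hx.2 hxW
  let γ : ℝ → Eu n := fun t => x + t • z + (-graphFun e g (x + t • z)) • e
  have hγ0 : γ 0 = x := by simp [γ, hGx]
  have hγ : HasDerivAt γ z 0 := by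
    have h2 : HasDerivAt (fun t : ℝ => x + t • z) z 0 := by
      simpa using ((hasDerivAt_id (0 : ℝ)).smul_const z).const_add x
    have h1 : HasFDerivAt (graphFun e g) (fderiv ℝ (graphFun e g) x) (x + (0 : ℝ) • z) := by
      rw [zero_smul, add_zero]
      exact (hG.differentiable two_ne_zero x).hasFDerivAt
    have h3 := h2.add ((h1.comp_hasDerivAt (0 : ℝ) h2).neg.smul_const e)
    rw [hz, neg_zero, zero_smul, add_zero] at h3
    exact h3
  have hS : {t | γ t ∈ O ∩ frontier Ω} ∈ 𝓝 (0 : ℝ) := by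
    have h := hγ.continuousAt.eventually
      (show W ∩ O ∈ 𝓝 (γ 0) from hγ0 ▸ (hW.inter hO).mem_nhds ⟨hxW, hx.1⟩)
    filter_upwards [h] with t ht
    refine ⟨ht.2, mem_frontier_of_graphFun_eq_zero he hΩ hW hΩW ?_ ht.1⟩
    rw [graphFun_add_smul he]
    ring
  have key : ∀ L : Eu n →L[ℝ] ℝ, HasFDerivWithinAt p L (O ∩ frontier Ω) x →
      HasDerivAt (p ∘ γ) (L z) 0 := fun L hL =>
    ((hγ0.symm ▸ hL).comp_hasDerivWithinAt (t := O ∩ frontier Ω) (s := {t | γ t ∈ O ∩ frontier Ω})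
      0 hγ.hasDerivWithinAt fun t ht => ht).hasDerivAt hS
  exact (key L₁ h₁).unique (key L₂ h₂)

/-- At a point of a `C²` part of the boundary the normal is a unit vector that points out of `Ω`, and
tangential derivatives of functions on the boundary are unique. -/
lemma TruncatedCIP.IsC2BoundaryPart.point (hΩ : IsOpen Ω) (hΓ : IsC2BoundaryPart Ω Γ ν) {x : Eu n}
    (hx : x ∈ Γ) : ‖ν x‖ = 1 ∧ (∀ᶠ t in 𝓝[<] (0 : ℝ), x + t • ν x ∈ Ω) ∧
      ∀ (p : Eu n → ℝ) (L₁ L₂ : Eu n →L[ℝ] ℝ), HasFDerivWithinAt p L₁ Γ x →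
        HasFDerivWithinAt p L₂ Γ x → ∀ z, ⟪ν x, z⟫ = 0 → L₁ z = L₂ z := by
  obtain ⟨⟨O, hO, rfl⟩, hpt⟩ := hΓ
  obtain ⟨-, e, g, W, he, hg, hW, hxW, hΩW, hν⟩ := hpt x hx
  have hΩW' : ∀ y ∈ W, y ∈ Ω ↔ graphFun e g y < 0 := fun y hy => (hΩW y hy).trans sub_neg.symm
  change ν x = ‖gradient (graphFun e g) x‖⁻¹ • gradient (graphFun e g) x at hν
  have hG := contDiff_graphFun (e := e) hg
  have hGe := fderiv_graphFun_self he hg x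
  have hne : gradient (graphFun e g) x ≠ 0 := fun h => by
    rw [← inner_gradient_left, h, inner_zero_left] at hGe
    exact zero_ne_one hGe
  have hn0 : 0 < ‖gradient (graphFun e g) x‖ := norm_pos_iff.2 hne
  refine ⟨?_, ?_, fun p L₁ L₂ h₁ h₂ z hz =>
    hasFDerivWithinAt_unique_on_tangent he hΩ hg hW hΩW' hO hx hxW h₁ h₂ ?_⟩
  · rw [hν, norm_smul, norm_inv, norm_norm, inv_mul_cancel₀ hn0.ne']
  · have hGx : graphFun e g x = 0 := graphFun_eq_zero_of_mem_frontier hΩ hg hW hΩW' hx.2 hxW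
    have h2 : HasDerivAt (fun t : ℝ => x + t • ν x) (ν x) 0 := by
      simpa using ((hasDerivAt_id (0 : ℝ)).smul_const (ν x)).const_add x
    have h1 : HasFDerivAt (graphFun e g) (fderiv ℝ (graphFun e g) x) (x + (0 : ℝ) • ν x) := by
      rw [zero_smul, add_zero]
      exact (hG.differentiable two_ne_zero x).hasFDerivAt
    have h3 := h1.comp_hasDerivAt (0 : ℝ) h2
    -- `graphFun` vanishes at `x` and increases strictly along `ν`, so it is negative for small `t <
    -- 0`.
    have h4 : 0 < fderiv ℝ (graphFun e g) x (ν x) := by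
      rw [← inner_gradient_left, hν, inner_smul_right, real_inner_self_eq_norm_sq]
      positivity
    have h5 := h3.hasDerivWithinAt (s := Iio 0)
    rw [hasDerivWithinAt_iff_tendsto_slope' (by simp)] at h5
    have h6 : ContinuousAt (fun t : ℝ => x + t • ν x) 0 := h2.continuousAt
    have h7 : ∀ᶠ t in 𝓝[<] (0 : ℝ), x + t • ν x ∈ W :=
      nhdsWithin_le_nhds (h6.eventually (hW.mem_nhds (by simpa using hxW)))
    filter_upwards [h5.eventually (lt_mem_nhds h4), h7, self_mem_nhdsWithin] with t ht htW ht0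
    rw [hΩW' _ htW]
    simp only [slope_def_field, Function.comp_apply, zero_smul, add_zero, hGx, sub_zero] at ht
    by_contra! h
    exact absurd ht (not_lt.2 (div_nonpos_of_nonneg_of_nonpos h (le_of_lt ht0)))
  · rw [hν, inner_smul_left, inner_gradient_left] at hz
    simpa [hn0.ne'] using hz

/-- Any competitor `g` in the infimum agrees with the full gradient `v` on tangent vectors. For the
tangential part `z` of `v` this gives `|z|² = ⟪v, z⟫ = ⟪g, z⟫ ≤ |g| |z|`, hence `|z| ≤ |g|`, and
Pythagoras adds the normal part. -/
lemma enorm_sq_closureDeriv_le (hΩ : IsOpen Ω) (hΓ : IsC2BoundaryPart Ω Γ ν) {w p : Eu n → ℝ}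
    (hw : ContDiffOn ℝ 1 w (closure Ω)) (hp : ∀ x ∈ Γ, w x = p x) {x : Eu n} (hx : x ∈ Γ) :
    ‖closureDeriv Ω w x‖ₑ ^ 2 ≤
      tangentialGradSq Γ p x + ‖closureDeriv Ω w x (ν x)‖ₑ ^ 2 := by
  obtain ⟨hν, -, ht⟩ := hΓ.point hΩ hx
  have hΓf : Γ ⊆ frontier Ω := by
    obtain ⟨⟨O, -, rfl⟩, -⟩ := hΓ
    exact inter_subset_right
  set D := closureDeriv Ω w x with hD
  have hwD : HasFDerivWithinAt w D Γ x :=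
    (hasFDerivWithinAt_closureDeriv hΩ hw (frontier_subset_closure (hΓf hx))).mono
      (hΓf.trans frontier_subset_closure)
  -- With the normal term on the left, the bound is checked for each competitor. If there is none,
  -- the infimum is `∞` and nothing remains to be shown.
  rw [← tsub_le_iff_right]
  refine le_iInf₂ fun g hg => ?_
  rw [tsub_le_iff_right]
  have hg' : HasFDerivWithinAt w (InnerProductSpace.toDual ℝ (Eu n) g) Γ x :=
    (show HasGradientWithinAt p g Γ x from hg).hasFDerivWithinAt.congr hp (hp x hx)
  set v := (InnerProductSpace.toDual ℝ (Eu n)).symm D with hv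
  have hDv : ∀ z, D z = ⟪v, z⟫ := fun z => by simp [hv]
  have hvD : ‖D‖ = ‖v‖ := by simp [hv]
  have hz : ⟪ν x, v - ⟪ν x, v⟫ • ν x⟫ = 0 := by
    rw [inner_sub_right, inner_smul_right, real_inner_self_eq_norm_sq, hν]
    ring
  have h1 := ht w _ _ hwD hg' _ hz
  rw [hDv, InnerProductSpace.toDual_apply_apply] at h1
  set z := v - ⟪ν x, v⟫ • ν x with hzdef
  have h2 : ‖v‖ ^ 2 = ‖z‖ ^ 2 + ⟪ν x, v⟫ ^ 2 := by
    have : v = z + ⟪ν x, v⟫ • ν x := by simp [hzdef]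
    conv_lhs => rw [this]
    rw [norm_add_sq_real, inner_smul_right, real_inner_comm (ν x) z, hz, norm_smul, hν]
    simp
  have h3 : ⟪v, z⟫ = ‖z‖ ^ 2 := by
    have : v = z + ⟪ν x, v⟫ • ν x := by simp [hzdef]
    conv_lhs => rw [this]
    rw [inner_add_left, inner_smul_left, hz, real_inner_self_eq_norm_sq]
    simp
  have h4 : ‖z‖ ≤ ‖g‖ := by
    by_contra! h
    have h5 := real_inner_le_norm g z
    rw [← h1, h3] at h5
    nlinarith [norm_nonneg g, norm_nonneg z]
  have h5 : ‖D‖ ^ 2 ≤ ‖g‖ ^ 2 + ‖D (ν x)‖ ^ 2 := by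
    rw [hvD, h2, hDv, real_inner_comm, Real.norm_eq_abs, sq_abs]
    gcongr
  simp only [← ofReal_norm]
  rw [← ENNReal.ofReal_pow (norm_nonneg _), ← ENNReal.ofReal_pow (norm_nonneg _),
    ← ENNReal.ofReal_pow (norm_nonneg _), ← ENNReal.ofReal_add (by positivity) (by positivity)]
  exact ENNReal.ofReal_le_ofReal h5

/-- The points `x + t ν` with small `t < 0` lie in `Ω`, so the chain rule within `closure Ω`
computes the one-sided derivative. -/
lemma closureDeriv_apply_normal (hΩ : IsOpen Ω) (hΓ : IsC2BoundaryPart Ω Γ ν) {w : Eu n → ℝ}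
    (hw : ContDiffOn ℝ 1 w (closure Ω)) {x : Eu n} (hx : x ∈ Γ) {q : ℝ}
    (hq : HasDerivWithinAt (fun t : ℝ => w (x + t • ν x)) q (Iic 0) 0) :
    closureDeriv Ω w x (ν x) = q := by
  obtain ⟨-, hin, -⟩ := hΓ.point hΩ hx
  have hxc : x ∈ closure Ω := by
    obtain ⟨⟨O, -, rfl⟩, -⟩ := hΓ
    exact frontier_subset_closure hx.2
  have h1 : HasFDerivWithinAt w (closureDeriv Ω w x) (closure Ω) (x + (0 : ℝ) • ν x) := by
    rw [zero_smul, add_zero]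
    exact hasFDerivWithinAt_closureDeriv hΩ hw hxc
  have h2 : HasDerivAt (fun t : ℝ => x + t • ν x) (ν x) 0 := by
    simpa using ((hasDerivAt_id (0 : ℝ)).smul_const (ν x)).const_add x
  have h3 := h1.comp_hasDerivWithinAt (s := {t | x + t • ν x ∈ closure Ω}) (0 : ℝ)
    h2.hasDerivWithinAt fun t ht => ht
  have h4 : {t : ℝ | x + t • ν x ∈ closure Ω} ∈ 𝓝[Iic 0] 0 := by
    rw [← Iio_insert, nhdsWithin_insert, mem_sup]
    exact ⟨by simpa using hxc, hin.mono fun t ht => subset_closure ht⟩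
  exact (uniqueDiffOn_Iic (0 : ℝ) 0 self_mem_Iic).eq_deriv _ (h3.mono_of_mem_nhdsWithin h4) hq

/-- The field `ν` is given pointwise, with a chart that may change from point to point. In a fixed
chart it is `± ∇G / |∇G|`, since tangent directions do not depend on the chart, and the square
removes the sign. The purpose is measurability of the normal derivative. -/
lemma continuousOn_sq_apply_normal (hΩ : IsOpen Ω) (hΓ : IsC2BoundaryPart Ω Γ ν)
    {D : Eu n → Eu n →L[ℝ] ℝ} (hD : ContinuousOn D Γ) :
    ContinuousOn (fun x => D x (ν x) ^ 2) Γ := by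
  intro x hx
  have hpt := fun y (hy : y ∈ Γ) => hΓ.point hΩ hy
  obtain ⟨⟨O, hO, rfl⟩, hc⟩ := hΓ
  obtain ⟨-, e, g, W, he, hg, hW, hxW, hΩW, -⟩ := hc x hx
  have hΩW' : ∀ y ∈ W, y ∈ Ω ↔ graphFun e g y < 0 := fun y hy => (hΩW y hy).trans sub_neg.symm
  have hG := contDiff_graphFun (e := e) hg
  have hn0 : ∀ y, 0 < ‖gradient (graphFun e g) y‖ := fun y => norm_pos_iff.2 fun h => by
    have hGe := fderiv_graphFun_self he hg y
    rw [← inner_gradient_left, h, inner_zero_left] at hGe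
    exact zero_ne_one hGe
  have hgc : Continuous (gradient (graphFun e g)) := by
    unfold gradient
    exact (InnerProductSpace.toDual ℝ (Eu n)).symm.continuous.comp
      (hG.continuous_fderiv two_ne_zero)
  have hcont : ContinuousWithinAt (fun y => D y (gradient (graphFun e g) y) ^ 2 /
      ‖gradient (graphFun e g) y‖ ^ 2) (O ∩ frontier Ω) x := by
    refine ContinuousWithinAt.div ?_ (hgc.norm.pow 2).continuousWithinAt (pow_pos (hn0 x) 2).ne'
    exact ((hD x hx).clm_apply hgc.continuousWithinAt).pow 2
  have heq : ∀ y ∈ O ∩ frontier Ω, y ∈ W → D y (ν y) ^ 2 =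
      D y (gradient (graphFun e g) y) ^ 2 / ‖gradient (graphFun e g) y‖ ^ 2 := by
    intro y hy hyW
    obtain ⟨hν, -, hu⟩ := hpt y hy
    have h1 : HasFDerivWithinAt (graphFun e g) (0 : Eu n →L[ℝ] ℝ) (O ∩ frontier Ω) y := by
      refine (hasFDerivWithinAt_const (0 : ℝ) y _).congr_of_eventuallyEq ?_
        (graphFun_eq_zero_of_mem_frontier hΩ hg hW hΩW' hy.2 hyW)
      filter_upwards [self_mem_nhdsWithin, nhdsWithin_le_nhds (hW.mem_nhds hyW)] with z hz hzW
      exact graphFun_eq_zero_of_mem_frontier hΩ hg hW hΩW' hz.2 hzW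
    have h2 := hu _ _ _ (hG.differentiable two_ne_zero y).hasFDerivAt.hasFDerivWithinAt h1
    set v := gradient (graphFun e g) y with hv
    have h3 : v - ⟪ν y, v⟫ • ν y = 0 := by
      have h4 : ⟪ν y, v - ⟪ν y, v⟫ • ν y⟫ = 0 := by
        rw [inner_sub_right, inner_smul_right, real_inner_self_eq_norm_sq, hν]
        ring
      have h5 := h2 _ h4
      rw [← inner_gradient_left, ← hv] at h5
      rw [← inner_self_eq_zero (𝕜 := ℝ), inner_sub_left, inner_smul_left, h4, h5]
      simp
    have h6 : v = ⟪ν y, v⟫ • ν y := sub_eq_zero.1 h3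
    have h7 : ‖v‖ ^ 2 = ⟪ν y, v⟫ ^ 2 := by
      conv_lhs => rw [h6, norm_smul, hν, mul_one, Real.norm_eq_abs, sq_abs]
    have h8 : D y v = ⟪ν y, v⟫ * D y (ν y) := by
      conv_lhs => rw [h6, map_smul, smul_eq_mul]
    have h9 : ⟪ν y, v⟫ ^ 2 ≠ 0 := h7 ▸ (pow_pos (hn0 y) 2).ne'
    rw [h7, h8, mul_pow, mul_div_cancel_left₀ _ h9]
  refine hcont.congr_of_eventuallyEq ?_ (heq x hx hxW)
  filter_upwards [self_mem_nhdsWithin, nhdsWithin_le_nhds (hW.mem_nhds hxW)] with y hy hyW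
  exact heq y hy hyW

lemma TruncatedCIP.IsC2BoundaryPart.measurableSet (hΓ : IsC2BoundaryPart Ω Γ ν) : MeasurableSet Γ := by
  obtain ⟨⟨O, hO, rfl⟩, -⟩ := hΓ
  exact hO.measurableSet.inter isClosed_frontier.measurableSet

/-- The Cauchy data control the boundary values of a function and of all of its first
derivatives. -/
lemma lintegral_trace_le (hΩ : IsOpen Ω) (hΓ : IsC2BoundaryPart Ω Γ ν) {w p q : Eu n → ℝ}
    (hw : ContDiffOn ℝ 1 w (closure Ω)) (hp : ∀ x ∈ Γ, w x = p x)
    (hq : ∀ x ∈ Γ, HasDerivWithinAt (fun t : ℝ => w (x + t • ν x)) (q x) (Iic 0) 0)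
    (μ : Measure (Eu n)) :
    ∫⁻ x in Γ, (‖w x‖ₑ ^ 2 + ‖closureDeriv Ω w x‖ₑ ^ 2) ∂μ ≤
      ∫⁻ x in Γ, (‖p x‖ₑ ^ 2 + tangentialGradSq Γ p x) ∂μ + ∫⁻ x in Γ, ‖q x‖ₑ ^ 2 ∂μ := by
  have hΓc : Γ ⊆ closure Ω := by
    obtain ⟨⟨O, -, rfl⟩, -⟩ := hΓ
    exact inter_subset_right.trans frontier_subset_closure
  have hc : ContinuousOn (fun x => ‖closureDeriv Ω w x (ν x) ^ 2‖ₑ) Γ :=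
    (continuousOn_sq_apply_normal hΩ hΓ ((continuousOn_closureDeriv hΩ hw).mono hΓc)).enorm
  -- Additivity of the upper integral needs one measurable summand. The tangential term is an
  -- infimum of unknown measurability, so the normal one has to serve.
  have hm : AEMeasurable (fun x => ‖q x‖ₑ ^ 2) (μ.restrict Γ) := by
    refine (hc.aemeasurable hΓ.measurableSet).congr ?_
    refine (ae_restrict_iff' hΓ.measurableSet).2 (Eventually.of_forall fun x hx => ?_)
    simp only [closureDeriv_apply_normal hΩ hΓ hw hx (hq x hx), enorm_pow]
  rw [← lintegral_add_right' _ hm]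
  refine setLIntegral_mono' hΓ.measurableSet fun x hx => ?_
  rw [hp x hx, add_assoc]
  gcongr
  rw [← closureDeriv_apply_normal hΩ hΓ hw hx (hq x hx)]
  exact enorm_sq_closureDeriv_le hΩ hΓ hw hp hx

end Trace

/-! ### Polynomial structure and Lipschitz bound of the nonlinearity -/

section Nonlinearity

lemma contDiff_psi (m : ℕ) : ContDiff ℝ 1 (psi m) := by
  induction m using Nat.strong_induction_on with
  | _ m ih =>
    rw [psi]
    simp only
    refine ContDiff.div_const ?_ _
    refine ContDiff.sub (by fun_prop) (ContDiff.sum fun j _ => ?_)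
    exact contDiff_const.mul (ih j j.2)

lemma sum_comm_pairs {ι κ : Type*} [Fintype ι] [Fintype κ] (f : ι → ι → κ → κ → ℝ) :
    ∑ i, ∑ j, ∑ l, ∑ l', f i j l l' = ∑ l, ∑ l', ∑ i, ∑ j, f i j l l' := by
  have h := Finset.sum_comm (s := (Finset.univ : Finset (ι × ι)))
    (t := (Finset.univ : Finset (κ × κ))) (f := fun p q => f p.1 p.2 q.1 q.2)
  simpa only [Fintype.sum_prod_type] using h

/-- The nonlinearity expanded in the components of its argument. -/
lemma exists_nonlinearity_eq_sum {n N : ℕ} (a : Fin n → Fin n → Eu n → ℝ) :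
    ∃ (c : Fin N → Fin N → Fin N → ℝ) (c' : Fin N → Fin N → ℝ), ∀ (b : Fin n → Eu n → ℝ) (x : Eu n)
      (G : Fin N → Fin n → ℝ) (k : Fin N), nonlinearity a b x G k =
        ∑ l, ∑ l', c k l l' * ∑ i, ∑ j, a i j x * (G l i * G l' j + G l' i * G l j) +
          ∑ l, c' k l * ∑ i, b i x * G l i := by
  have hpc : ∀ m, Continuous (psi m) := fun m => (contDiff_psi m).continuous
  have hdc : ∀ m, Continuous (deriv (psi m)) := fun m => (contDiff_psi m).continuous_deriv le_rfl
  -- The coefficients involve only the basis functions, neither `x` nor `b`. This makes the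
  -- Lipschitz constant depend on `b` only through the bound `Z`.
  refine ⟨fun k l l' => ∑ m, (basisMatrix N)⁻¹ k m *
    -∫ t in (0 : ℝ)..1, psi l t * deriv (psi l') t * psi m t,
    fun k l => ∑ m, (basisMatrix N)⁻¹ k m * -∫ t in (0 : ℝ)..1, deriv (psi l) t * psi m t,
    fun b x G k => ?_⟩
  have key : ∀ m : Fin N, ip (fun t => F₂ a b x (fun i => ∑ k : Fin N, psi k t * G k i)
      (fun i => ∑ k : Fin N, deriv (psi k) t * G k i)) (psi m) =
      ∑ l : Fin N, ∑ l' : Fin N, (∫ t in (0 : ℝ)..1, psi l t * deriv (psi l') t * psi m t) *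
        ∑ i, ∑ j, a i j x * (G l i * G l' j + G l' i * G l j) +
      ∑ l : Fin N, (∫ t in (0 : ℝ)..1, deriv (psi l) t * psi m t) * ∑ i, b i x * G l i := by
    intro m
    have hpt : ∀ t, F₂ a b x (fun i => ∑ k : Fin N, psi k t * G k i)
      (fun i => ∑ k : Fin N, deriv (psi k) t * G k i) * psi m t =
      ∑ l : Fin N, ∑ l' : Fin N, (psi l t * deriv (psi l') t * psi m t) *
        (∑ i, ∑ j, a i j x * (G l i * G l' j + G l' i * G l j)) +
      ∑ l : Fin N, (deriv (psi l) t * psi m t) * ∑ i, b i x * G l i := by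
      intro t
      have e1 : ∀ i j, (∑ k : Fin N, psi k t * G k i) * (∑ k : Fin N, deriv (psi k) t * G k j) +
          (∑ k : Fin N, deriv (psi k) t * G k i) * (∑ k : Fin N, psi k t * G k j) =
          ∑ l : Fin N, ∑ l' : Fin N, psi l t * deriv (psi l') t *
            (G l i * G l' j + G l' i * G l j) := by
        intro i j
        rw [mul_comm (∑ k : Fin N, deriv (psi k) t * G k i), Finset.sum_mul_sum,
          Finset.sum_mul_sum, ← Finset.sum_add_distrib]
        refine Finset.sum_congr rfl fun l _ => ?_
        rw [← Finset.sum_add_distrib]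
        refine Finset.sum_congr rfl fun l' _ => ?_
        ring
      rw [F₂, add_mul]
      congr 1
      · simp only [e1]
        simp only [Finset.mul_sum, Finset.sum_mul]
        rw [sum_comm_pairs]
        refine Finset.sum_congr rfl fun l _ => Finset.sum_congr rfl fun l' _ =>
          Finset.sum_congr rfl fun i _ => Finset.sum_congr rfl fun j _ => ?_
        ring
      · simp only [Finset.mul_sum, Finset.sum_mul]
        rw [Finset.sum_comm]
        refine Finset.sum_congr rfl fun l _ => Finset.sum_congr rfl fun i _ => ?_
        ring
    unfold ip
    simp only [hpt]
    rw [intervalIntegral.integral_add, intervalIntegral.integral_finsetSum,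
      intervalIntegral.integral_finsetSum]
    · congr 1
      · refine Finset.sum_congr rfl fun l _ => ?_
        rw [intervalIntegral.integral_finsetSum]
        · simp only [intervalIntegral.integral_mul_const]
        · intro l' _
          exact Continuous.intervalIntegrable (by fun_prop) _ _
      · simp only [intervalIntegral.integral_mul_const]
    · intro l _
      exact Continuous.intervalIntegrable (by fun_prop) _ _
    · intro l _
      exact Continuous.intervalIntegrable (by fun_prop) _ _
    · exact Continuous.intervalIntegrable (by fun_prop) _ _
    · exact Continuous.intervalIntegrable (by fun_prop) _ _
  simp only [nonlinearity, Matrix.mulVec, dotProduct, key]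
  -- The sums over space indices are hidden behind opaque names, so that distributivity acts only on
  -- the sums over basis indices.
  obtain ⟨Q, hQ⟩ : ∃ Q : Fin N → Fin N → ℝ, ∀ l l',
      ∑ i, ∑ j, a i j x * (G l i * G l' j + G l' i * G l j) = Q l l' := ⟨_, fun _ _ => rfl⟩
  obtain ⟨R, hR⟩ : ∃ R : Fin N → ℝ, ∀ l, ∑ i, b i x * G l i = R l := ⟨_, fun _ => rfl⟩
  simp only [hQ, hR]
  simp only [neg_add, mul_add, Finset.sum_add_distrib]
  congr 1
  · simp only [← Finset.sum_neg_distrib, Finset.mul_sum, Finset.sum_mul]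
    rw [Finset.sum_comm]
    refine Finset.sum_congr rfl fun l _ => ?_
    rw [Finset.sum_comm]
    refine Finset.sum_congr rfl fun l' _ => Finset.sum_congr rfl fun m _ => ?_
    ring
  · simp only [← Finset.sum_neg_distrib, Finset.mul_sum, Finset.sum_mul]
    rw [Finset.sum_comm]
    refine Finset.sum_congr rfl fun l _ => Finset.sum_congr rfl fun m _ => ?_
    ring

/-- The nonlinearity is Lipschitz continuous on bounded sets. -/
lemma exists_nonlinearity_lipschitz {n N : ℕ} (a : Fin n → Fin n → Eu n → ℝ) {A K Z : ℝ}
    (hA0 : 0 ≤ A) (hK0 : 0 ≤ K) (hZ0 : 0 ≤ Z) :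
    ∃ L > (0 : ℝ), ∀ (b : Fin n → Eu n → ℝ) (x : Eu n) (G G' : Fin N → Fin n → ℝ) (k : Fin N),
      (∀ i j, |a i j x| ≤ A) → (∀ i, |b i x| ≤ Z) → (∀ l i, |G l i| ≤ K) → (∀ l i, |G' l i| ≤ K) →
      |nonlinearity a b x G k - nonlinearity a b x G' k| ≤ L * ∑ l, ∑ i, |G l i - G' l i| := by
  obtain ⟨c, c', hc⟩ := exists_nonlinearity_eq_sum (N := N) a
  set L₁ := ∑ k, ∑ l, ∑ l', |c k l l'| with hL₁
  set L₂ := ∑ k, ∑ l, |c' k l| with hL₂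
  have hL₁0 : 0 ≤ L₁ := by positivity
  have hL₂0 : 0 ≤ L₂ := by positivity
  refine ⟨L₁ * (n * (n * (A * (4 * K)))) + L₂ * (n * Z) + 1, by positivity,
    fun b x G G' k ha hb hG hG' => ?_⟩
  set S := ∑ l, ∑ i, |G l i - G' l i| with hS
  have hS0 : 0 ≤ S := by positivity
  have hδ : ∀ l i, |G l i - G' l i| ≤ S := fun l i =>
    (Finset.single_le_sum (f := fun i => |G l i - G' l i|) (fun _ _ => abs_nonneg _)
      (Finset.mem_univ i)).trans (Finset.single_le_sum (f := fun l => ∑ i, |G l i - G' l i|)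
      (fun _ _ => by positivity) (Finset.mem_univ l))
  have hprod : ∀ l i l' j, |G l i * G l' j - G' l i * G' l' j| ≤ 2 * K * S := fun l i l' j => by
    have : G l i * G l' j - G' l i * G' l' j =
      (G l i - G' l i) * G l' j + G' l i * (G l' j - G' l' j) := by ring
    rw [this]
    refine (abs_add_le _ _).trans ?_
    rw [abs_mul, abs_mul]
    have h1 := mul_le_mul (hδ l i) (hG l' j) (abs_nonneg _) hS0
    have h2 := mul_le_mul (hG' l i) (hδ l' j) (abs_nonneg _) hK0
    linarith
  rw [hc, hc, add_sub_add_comm, ← Finset.sum_sub_distrib, ← Finset.sum_sub_distrib]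
  have h1 : |∑ l, (∑ l', c k l l' * ∑ i, ∑ j, a i j x * (G l i * G l' j + G l' i * G l j) -
      ∑ l', c k l l' * ∑ i, ∑ j, a i j x * (G' l i * G' l' j + G' l' i * G' l j))| ≤
      L₁ * (n * (n * (A * (4 * K)))) * S := by
    calc _ ≤ ∑ l, ∑ l', |c k l l'| * (n * (n * (A * (4 * K * S)))) := by
          refine (Finset.abs_sum_le_sum_abs _ _).trans (Finset.sum_le_sum fun l _ => ?_)
          rw [← Finset.sum_sub_distrib]
          refine (Finset.abs_sum_le_sum_abs _ _).trans (Finset.sum_le_sum fun l' _ => ?_)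
          rw [← mul_sub, abs_mul]
          gcongr
          rw [← Finset.sum_sub_distrib]
          refine (Finset.abs_sum_le_sum_abs _ _).trans
            ((Finset.sum_le_card_nsmul _ _ (n * (A * (4 * K * S))) fun i _ => ?_).trans (by simp))
          rw [← Finset.sum_sub_distrib]
          refine (Finset.abs_sum_le_sum_abs _ _).trans
            ((Finset.sum_le_card_nsmul _ _ (A * (4 * K * S)) fun j _ => ?_).trans (by simp))
          rw [← mul_sub, abs_mul, add_sub_add_comm]
          gcongr
          · exact ha i j
          · refine (abs_add_le _ _).trans ?_
            linarith [hprod l i l' j, hprod l' i l j]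
      _ = (∑ l, ∑ l', |c k l l'|) * (n * (n * (A * (4 * K)))) * S := by
          simp only [← Finset.sum_mul]
          ring
      _ ≤ _ := by
          gcongr
          exact Finset.single_le_sum (f := fun k => ∑ l, ∑ l', |c k l l'|)
            (fun _ _ => by positivity) (Finset.mem_univ k)
  have h2 : |∑ l, (c' k l * ∑ i, b i x * G l i - c' k l * ∑ i, b i x * G' l i)| ≤
      L₂ * (n * Z) * S := by
    calc _ ≤ ∑ l, |c' k l| * (n * (Z * S)) := by
          refine (Finset.abs_sum_le_sum_abs _ _).trans (Finset.sum_le_sum fun l _ => ?_)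
          rw [← mul_sub, abs_mul]
          gcongr
          rw [← Finset.sum_sub_distrib]
          refine (Finset.abs_sum_le_sum_abs _ _).trans
            ((Finset.sum_le_card_nsmul _ _ (Z * S) fun i _ => ?_).trans (by simp))
          rw [← mul_sub, abs_mul]
          gcongr
          · exact hb i
          · exact hδ l i
      _ = (∑ l, |c' k l|) * (n * Z) * S := by
          simp only [← Finset.sum_mul]
          ring
      _ ≤ _ := by
          gcongr
          exact Finset.single_le_sum (f := fun k => ∑ l, |c' k l|)
            (fun _ _ => by positivity) (Finset.mem_univ k)
  calc _ ≤ L₁ * (n * (n * (A * (4 * K)))) * S + L₂ * (n * Z) * S :=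
        (abs_add_le _ _).trans (add_le_add h1 h2)
    _ ≤ _ := by linarith

end Nonlinearity

/-! ### Pointwise calculus for the second order operator -/

section Pointwise

variable {n : ℕ} {Ω : Set (Eu n)}

lemma abs_pd_le (i : Fin n) (u : Eu n → ℝ) (x : Eu n) : |pd i u x| ≤ ‖fderiv ℝ u x‖ := by
  rw [pd, ← Real.norm_eq_abs]
  refine (ContinuousLinearMap.le_opNorm _ _).trans ?_
  simp

lemma gradSq_nonneg (u : Eu n → ℝ) (x : Eu n) : 0 ≤ gradSq u x :=
  Finset.sum_nonneg fun _ _ => sq_nonneg _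

lemma gradSq_le (u : Eu n → ℝ) (x : Eu n) : gradSq u x ≤ n * ‖fderiv ℝ u x‖ ^ 2 := by
  refine (Finset.sum_le_card_nsmul _ _ (‖fderiv ℝ u x‖ ^ 2) fun i _ => ?_).trans (by simp)
  rw [← sq_abs]
  gcongr
  exact abs_pd_le i u x

lemma pd_congr {u v : Eu n → ℝ} {x : Eu n} (h : u =ᶠ[𝓝 x] v) (i : Fin n) : pd i u x = pd i v x := by
  rw [pd, pd, h.fderiv_eq]

lemma eventuallyEq_pd {u v : Eu n → ℝ} {x : Eu n} (h : u =ᶠ[𝓝 x] v) (i : Fin n) :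
    pd i u =ᶠ[𝓝 x] pd i v :=
  h.eventuallyEq_nhds.mono fun _ hy => pd_congr hy i

lemma gradSq_congr {u v : Eu n → ℝ} {x : Eu n} (h : u =ᶠ[𝓝 x] v) : gradSq u x = gradSq v x := by
  simp only [gradSq, pd_congr h]

lemma principalPart_congr (a : Fin n → Fin n → Eu n → ℝ) {u v : Eu n → ℝ} {x : Eu n}
    (h : u =ᶠ[𝓝 x] v) : principalPart a u x = principalPart a v x := by
  simp only [principalPart, pd_congr (eventuallyEq_pd h _)]

lemma pd_mul {u v : Eu n → ℝ} {x : Eu n} (hu : DifferentiableAt ℝ u x)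
    (hv : DifferentiableAt ℝ v x) (i : Fin n) :
    pd i (fun y => u y * v y) x = u x * pd i v x + v x * pd i u x := by
  rw [pd, fderiv_fun_mul hu hv]
  simp [pd]

lemma pd_sub {u v : Eu n → ℝ} {x : Eu n} (hu : DifferentiableAt ℝ u x)
    (hv : DifferentiableAt ℝ v x) (i : Fin n) : pd i (u - v) x = pd i u x - pd i v x := by
  rw [pd, fderiv_sub hu hv]
  simp [pd]

lemma differentiableAt_fderiv {u : Eu n → ℝ} {x : Eu n} (hu : ContDiffAt ℝ 2 u x) :
    DifferentiableAt ℝ (fderiv ℝ u) x :=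
  (hu.fderiv_right (m := 1) (by norm_num)).differentiableAt one_ne_zero

lemma differentiableAt_pd {u : Eu n → ℝ} {x : Eu n} (hu : ContDiffAt ℝ 2 u x) (i : Fin n) :
    DifferentiableAt ℝ (pd i u) x :=
  (differentiableAt_fderiv hu).clm_apply (differentiableAt_const _)

lemma abs_pd_pd_le {u : Eu n → ℝ} {x : Eu n} (hu : ContDiffAt ℝ 2 u x) (i j : Fin n) :
    |pd i (pd j u) x| ≤ ‖fderiv ℝ (fderiv ℝ u) x‖ := by
  have h : pd i (pd j u) x =
      fderiv ℝ (fderiv ℝ u) x (EuclideanSpace.single i 1) (EuclideanSpace.single j 1) := by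
    have h1 := (differentiableAt_fderiv hu).hasFDerivAt.clm_apply
      (hasFDerivAt_const (EuclideanSpace.single j (1 : ℝ)) x)
    have h2 : fderiv ℝ (pd j u) x = _ := h1.fderiv
    rw [pd, h2]
    simp
  rw [h, ← Real.norm_eq_abs]
  refine (ContinuousLinearMap.le_opNorm₂ _ _ _).trans ?_
  simp

lemma principalPart_sub (a : Fin n → Fin n → Eu n → ℝ) {u v : Eu n → ℝ} {x : Eu n}
    (hu : ContDiffAt ℝ 2 u x) (hv : ContDiffAt ℝ 2 v x) :
    principalPart a (u - v) x = principalPart a u x - principalPart a v x := by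
  have h : ∀ i j, pd i (pd j (u - v)) x = pd i (pd j u) x - pd i (pd j v) x := by
    intro i j
    rw [← pd_sub (differentiableAt_pd hu j) (differentiableAt_pd hv j)]
    refine pd_congr ?_ i
    filter_upwards [hu.eventually (by simp), hv.eventually (by simp)] with y hy hy'
    exact pd_sub (hy.differentiableAt two_ne_zero) (hy'.differentiableAt two_ne_zero) j
  simp only [principalPart, h, mul_sub, Finset.sum_sub_distrib]

lemma pd_pd_mul {u v : Eu n → ℝ} {x : Eu n} (hu : ContDiffAt ℝ 2 u x) (hv : ContDiffAt ℝ 2 v x)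
    (i j : Fin n) : pd i (pd j fun y => u y * v y) x =
      u x * pd i (pd j v) x + (pd i u x * pd j v x + pd j u x * pd i v x) +
        v x * pd i (pd j u) x := by
  have h : (pd j fun y => u y * v y) =ᶠ[𝓝 x] fun y => u y * pd j v y + v y * pd j u y := by
    filter_upwards [hu.eventually (by simp), hv.eventually (by simp)] with y hy hy'
    exact pd_mul (hy.differentiableAt two_ne_zero) (hy'.differentiableAt two_ne_zero) j
  have hu1 := hu.differentiableAt two_ne_zero
  have hv1 := hv.differentiableAt two_ne_zero
  have hu2 := differentiableAt_pd hu j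
  have hv2 := differentiableAt_pd hv j
  rw [pd_congr h, pd, fderiv_fun_add (by fun_prop) (by fun_prop), _root_.add_apply]
  change pd i _ x + pd i _ x = _
  rw [pd_mul hu1 hv2, pd_mul hv1 hu2]
  ring

lemma principalPart_mul (a : Fin n → Fin n → Eu n → ℝ) {u v : Eu n → ℝ} {x : Eu n}
    (hu : ContDiffAt ℝ 2 u x) (hv : ContDiffAt ℝ 2 v x) :
    principalPart a (fun y => u y * v y) x = u x * principalPart a v x +
      ∑ i, ∑ j, a i j x * (pd i u x * pd j v x + pd j u x * pd i v x) +
        v x * principalPart a u x := by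
  simp only [principalPart, pd_pd_mul hu hv, Finset.mul_sum, ← Finset.sum_add_distrib]
  refine Finset.sum_congr rfl fun i _ => Finset.sum_congr rfl fun j _ => ?_
  ring

lemma abs_sum_sum_le {f : Fin n → Fin n → ℝ} {B : ℝ} (h : ∀ i j, |f i j| ≤ B) :
    |∑ i, ∑ j, f i j| ≤ n * (n * B) := by
  refine (Finset.abs_sum_le_sum_abs _ _).trans
    ((Finset.sum_le_card_nsmul _ _ (n * B) fun i _ => ?_).trans (by simp))
  refine (Finset.abs_sum_le_sum_abs _ _).trans
    ((Finset.sum_le_card_nsmul _ _ B fun j _ => h i j).trans (by simp))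

lemma contDiffAt_of_contDiffOn_closure (hΩ : IsOpen Ω) {F : Type*} [NormedAddCommGroup F]
    [NormedSpace ℝ F] {k : ℕ∞ω} {u : Eu n → F} (hu : ContDiffOn ℝ k u (closure Ω)) {x : Eu n}
    (hx : x ∈ Ω) : ContDiffAt ℝ k u x :=
  hu.contDiffAt (mem_of_superset (hΩ.mem_nhds hx) subset_closure)

lemma exists_bound_family {ι : Type*} [Finite ι] {P : ι → ℝ → Prop}
    (hP : ∀ i B B', B ≤ B' → P i B → P i B') (h : ∀ i, ∃ B, P i B) :
    ∃ B > (0 : ℝ), ∀ i, P i B := by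
  cases nonempty_fintype ι
  choose B hB using h
  refine ⟨∑ i, |B i| + 1, by positivity, fun i => hP i _ _ ?_ (hB i)⟩
  have := Finset.single_le_sum (f := fun i => |B i|) (fun _ _ => abs_nonneg _) (Finset.mem_univ i)
  linarith [le_abs_self (B i)]

lemma exists_bound_coeff (hΩc : IsCompact (closure Ω)) {a : Fin n → Fin n → Eu n → ℝ}
    (ha : ∀ i j, ContDiff ℝ 1 (a i j)) : ∃ A > (0 : ℝ), ∀ x ∈ Ω, ∀ i j, |a i j x| ≤ A := by
  obtain ⟨A, hA, h⟩ := exists_bound_family (ι := Fin n × Fin n)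
    (P := fun p B => ∀ x ∈ Ω, |a p.1 p.2 x| ≤ B) (fun p B B' hB h x hx => (h x hx).trans hB)
    (fun p => by
      obtain ⟨B, -, hB⟩ := exists_bound_of_contDiffOn_closure hΩc
        (ha p.1 p.2).continuous.continuousOn
      exact ⟨B, hB⟩)
  exact ⟨A, hA, fun x hx i j => h (i, j) x hx⟩

/-- Multiplication by a fixed function is bounded with respect to the quantities in the Carleman
estimate. -/
lemma exists_bound_mul (hΩ : IsOpen Ω) (hΩc : IsCompact (closure Ω))
    {a : Fin n → Fin n → Eu n → ℝ} (ha : ∀ i j, ContDiff ℝ 1 (a i j)) {η : Eu n → ℝ}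
    (hη : ContDiffOn ℝ 2 η (closure Ω)) :
    ∃ M > (0 : ℝ), ∀ w : Eu n → ℝ, ContDiffOn ℝ 2 w (closure Ω) → ∀ x ∈ Ω,
      principalPart a (fun y => η y * w y) x ^ 2 ≤
        M * (principalPart a w x ^ 2 + (gradSq w x + w x ^ 2)) ∧
      gradSq (fun y => η y * w y) x + (η x * w x) ^ 2 ≤ M * (gradSq w x + w x ^ 2) := by
  obtain ⟨A, hA, hAb⟩ := exists_bound_coeff hΩc ha
  obtain ⟨H₀, hH₀, h₀⟩ := exists_bound_of_contDiffOn_closure hΩc hη.continuousOn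
  obtain ⟨H₁, hH₁, h₁⟩ := exists_bound_fderiv hΩ hΩc (hη.of_le one_le_two)
  obtain ⟨H₂, hH₂, h₂⟩ := exists_bound_fderiv_fderiv hΩ hΩc hη
  -- `M₁`, `M₂`, `M₃` bound the terms with `A₀ w`, `∇w` and `w` in `A₀(ηw)`. The factor `3` comes
  -- from squaring a sum of three terms. `M₄` serves the term `w ∇η` in `∇(ηw)`.
  set M₁ := 3 * H₀ ^ 2 with hM₁
  set M₂ := 3 * (n * (n * (A * (2 * H₁)))) ^ 2 with hM₂
  set M₃ := 3 * (n * (n * (A * H₂))) ^ 2 with hM₃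
  set M₄ := 2 * n * H₁ ^ 2 with hM₄
  refine ⟨M₁ + M₂ + M₃ + M₄, by positivity, fun w hw x hx => ?_⟩
  have hηx := contDiffAt_of_contDiffOn_closure hΩ hη hx
  have hwx := contDiffAt_of_contDiffOn_closure hΩ hw hx
  have hM₁0 : 0 ≤ M₁ := by positivity
  have hM₂0 : 0 ≤ M₂ := by positivity
  have hM₃0 : 0 ≤ M₃ := by positivity
  have hM₄0 : 0 ≤ M₄ := by positivity
  have hg0 := gradSq_nonneg w x
  have hη0 : η x ^ 2 ≤ H₀ ^ 2 := sq_le_sq' (neg_le_of_abs_le (h₀ x hx)) (le_of_abs_le (h₀ x hx))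
  have hpη : ∀ i, |pd i η x| ≤ H₁ := fun i => (abs_pd_le i η x).trans (h₁ x hx)
  constructor
  · rw [principalPart_mul a hηx hwx]
    set T₁ := η x * principalPart a w x
    set T₂ := ∑ i, ∑ j, a i j x * (pd i η x * pd j w x + pd j η x * pd i w x)
    set T₃ := w x * principalPart a η x
    have e1 : T₁ ^ 2 ≤ H₀ ^ 2 * principalPart a w x ^ 2 := by
      rw [mul_pow]
      gcongr
    have hpw : ∀ i, |pd i w x| ≤ √(gradSq w x) := fun i => by
      rw [← Real.sqrt_sq_eq_abs]
      exact Real.sqrt_le_sqrt (Finset.single_le_sum (f := fun i => pd i w x ^ 2)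
        (fun _ _ => sq_nonneg _) (Finset.mem_univ i))
    have e2 : T₂ ^ 2 ≤ (n * (n * (A * (2 * H₁)))) ^ 2 * gradSq w x := by
      have : |T₂| ≤ n * (n * (A * (2 * H₁ * √(gradSq w x)))) := abs_sum_sum_le fun i j => by
        rw [abs_mul]
        gcongr
        · exact hAb x hx i j
        · refine (abs_add_le _ _).trans ?_
          rw [abs_mul, abs_mul]
          have := mul_le_mul (hpη i) (hpw j) (abs_nonneg _) hH₁.le
          have := mul_le_mul (hpη j) (hpw i) (abs_nonneg _) hH₁.le
          linarith
      calc T₂ ^ 2 = |T₂| ^ 2 := (sq_abs _).symm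
        _ ≤ (n * (n * (A * (2 * H₁ * √(gradSq w x))))) ^ 2 := by gcongr
        _ = (n * (n * (A * (2 * H₁)))) ^ 2 * √(gradSq w x) ^ 2 := by ring
        _ = _ := by rw [Real.sq_sqrt hg0]
    have e3 : T₃ ^ 2 ≤ (n * (n * (A * H₂))) ^ 2 * w x ^ 2 := by
      have : |principalPart a η x| ≤ n * (n * (A * H₂)) := abs_sum_sum_le fun i j => by
        rw [abs_mul]
        gcongr
        · exact hAb x hx i j
        · exact (abs_pd_pd_le hηx i j).trans (h₂ x hx)
      rw [mul_pow, mul_comm]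
      exact mul_le_mul_of_nonneg_right
        (sq_le_sq' (neg_le_of_abs_le this) (le_of_abs_le this)) (sq_nonneg _)
    have e4 : (T₁ + T₂ + T₃) ^ 2 ≤ 3 * (T₁ ^ 2 + T₂ ^ 2 + T₃ ^ 2) := by
      nlinarith [sq_nonneg (T₁ - T₂), sq_nonneg (T₁ - T₃), sq_nonneg (T₂ - T₃)]
    calc _ ≤ M₁ * principalPart a w x ^ 2 + M₂ * gradSq w x + M₃ * w x ^ 2 := by
          rw [hM₁, hM₂, hM₃]
          linarith
      _ ≤ _ := by
          have f1 := sq_nonneg (principalPart a w x)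
          have f2 := sq_nonneg (w x)
          nlinarith [mul_nonneg hM₁0 hg0, mul_nonneg hM₁0 f2, mul_nonneg hM₂0 f1,
            mul_nonneg hM₂0 f2, mul_nonneg hM₃0 f1, mul_nonneg hM₃0 hg0, mul_nonneg hM₄0 f1,
            mul_nonneg hM₄0 f2, mul_nonneg hM₄0 hg0]
  · have e1 : gradSq (fun y => η y * w y) x ≤ 2 * H₀ ^ 2 * gradSq w x + M₄ * w x ^ 2 := by
      have : 2 * H₀ ^ 2 * gradSq w x + M₄ * w x ^ 2 =
          ∑ i, (2 * H₀ ^ 2 * pd i w x ^ 2 + 2 * H₁ ^ 2 * w x ^ 2) := by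
        rw [Finset.sum_add_distrib, ← Finset.mul_sum, hM₄, gradSq]
        simp
        ring
      rw [this, gradSq]
      refine Finset.sum_le_sum fun i _ => ?_
      rw [pd_mul (hηx.differentiableAt two_ne_zero) (hwx.differentiableAt two_ne_zero)]
      have h3 : pd i η x ^ 2 ≤ H₁ ^ 2 :=
        sq_le_sq' (neg_le_of_abs_le (hpη i)) (le_of_abs_le (hpη i))
      have h4 := mul_le_mul_of_nonneg_right hη0 (sq_nonneg (pd i w x))
      have h5 := mul_le_mul_of_nonneg_right h3 (sq_nonneg (w x))
      nlinarith [sq_nonneg (η x * pd i w x - w x * pd i η x)]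
    have e2 : (η x * w x) ^ 2 ≤ H₀ ^ 2 * w x ^ 2 := by
      rw [mul_pow]
      gcongr
    have f2 := sq_nonneg (w x)
    have f3 : M₁ = 3 * H₀ ^ 2 := rfl
    nlinarith [mul_nonneg hM₁0 hg0, mul_nonneg hM₁0 f2,
            mul_nonneg hM₂0 f2, mul_nonneg hM₂0 hg0, mul_nonneg hM₃0 hg0, mul_nonneg hM₃0 f2,
            mul_nonneg hM₄0 f2, mul_nonneg hM₄0 hg0]

end Pointwise

/-! ### The weighted energy estimate -/

section Energy

variable {n N : ℕ} {Ω : Set (Eu n)}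

/-- The density of the squared `H¹` norm. -/
noncomputable def energyDensity (w : Fin N → Eu n → ℝ) (x : Eu n) : ℝ :=
  ∑ k, (gradSq (w k) x + w k x ^ 2)

lemma energyDensity_nonneg (w : Fin N → Eu n → ℝ) (x : Eu n) : 0 ≤ energyDensity w x :=
  Finset.sum_nonneg fun _ _ => add_nonneg (gradSq_nonneg _ _) (sq_nonneg _)

lemma continuousOn_pd (hΩ : IsOpen Ω) {u : Eu n → ℝ} (hu : ContDiffOn ℝ 1 u (closure Ω))
    (i : Fin n) : ContinuousOn (pd i u) Ω :=
  ((hu.mono subset_closure).continuousOn_fderiv_of_isOpen hΩ le_rfl).clm_apply continuousOn_const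

lemma integrableOn_gradSq (hΩ : IsOpen Ω) (hΩb : Bornology.IsBounded Ω) {u : Eu n → ℝ}
    (hu : ContDiffOn ℝ 1 u (closure Ω)) : IntegrableOn (gradSq u) Ω := by
  have hΩc : IsCompact (closure Ω) :=
    Metric.isCompact_of_isClosed_isBounded isClosed_closure hΩb.closure
  obtain ⟨L, -, hL⟩ := exists_bound_fderiv hΩ hΩc hu
  refine integrableOn_of_continuousOn_of_bound hΩ hΩb ?_ (Q := n * L ^ 2) fun x hx => ?_
  · exact continuousOn_finsetSum _ fun i _ => (continuousOn_pd hΩ hu i).pow 2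
  · rw [Real.norm_of_nonneg (gradSq_nonneg u x)]
    refine (gradSq_le u x).trans ?_
    gcongr
    exact hL x hx

lemma integrableOn_sq (hΩ : IsOpen Ω) (hΩb : Bornology.IsBounded Ω) {u : Eu n → ℝ}
    (hu : ContinuousOn u (closure Ω)) : IntegrableOn (fun x => u x ^ 2) Ω := by
  have hΩc : IsCompact (closure Ω) :=
    Metric.isCompact_of_isClosed_isBounded isClosed_closure hΩb.closure
  obtain ⟨L, -, hL⟩ := exists_bound_of_contDiffOn_closure hΩc hu
  refine integrableOn_of_continuousOn_of_bound hΩ hΩb ((hu.mono subset_closure).pow 2)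
    (Q := L ^ 2) fun x hx => ?_
  rw [norm_pow]
  gcongr
  exact hL x hx

lemma integrableOn_energyDensity (hΩ : IsOpen Ω) (hΩb : Bornology.IsBounded Ω)
    {w : Fin N → Eu n → ℝ} (hw : ∀ k, ContDiffOn ℝ 1 (w k) (closure Ω)) :
    IntegrableOn (energyDensity w) Ω :=
  integrable_finsetSum _ fun k _ => (integrableOn_gradSq hΩ hΩb (hw k)).add
    (integrableOn_sq hΩ hΩb (hw k).continuousOn)

/-- A smooth cutoff function with the level sets of `ξ`. -/
lemma exists_cutoff {ξ : Eu n → ℝ} (hξ : ContDiffOn ℝ 2 ξ (closure Ω)) {d' d₁ : ℝ} (h : d' < d₁) :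
    ∃ η : Eu n → ℝ, ContDiffOn ℝ 2 η (closure Ω) ∧ (∀ x, ξ x < d' → η x = 0) ∧
      ∀ x, d₁ < ξ x → η x = 1 := by
  have hpos := sub_pos.2 h
  refine ⟨fun x => Real.smoothTransition ((ξ x - d') / (d₁ - d')), ?_, fun x hx => ?_,
    fun x hx => ?_⟩
  · exact Real.smoothTransition.contDiff.comp_contDiffOn
      ((hξ.sub contDiffOn_const).div_const _)
  · exact Real.smoothTransition.zero_of_nonpos
      (div_nonpos_of_nonpos_of_nonneg (by linarith) hpos.le)
  · refine Real.smoothTransition.one_of_one_le ?_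
    rw [le_div_iff₀ hpos]
    linarith

/-- This is the Carleman estimate integrated over `Ω_d` for `η w_k` and summed over `k`. The
constants precede `w` and `B` and do not refer to `Γ`, as the uniformity in the theorem requires. -/
lemma exists_energy_estimate (hΩ : IsOpen Ω) (hΩb : Bornology.IsBounded Ω) {ξ : Eu n → ℝ}
    (hξ : ContDiffOn ℝ 2 ξ (closure Ω)) {d d₁ d₂ m L : ℝ} (hd : d < d₁) (hd₁₂ : d₁ ≤ d₂)
    (hm : ∀ x ∈ superlevel Ω ξ d, ξ x ≤ m) (hL : 0 < L)
    {a : Fin n → Fin n → Eu n → ℝ} (ha : ∀ i j, ContDiff ℝ 1 (a i j))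
    (hCarleman : AdmitsCarleman a (superlevel Ω ξ d) ξ)
    (hC2 : ∀ x ∈ frontier Ω, d < ξ x → ∃ ν, IsC2BoundaryPoint Ω x ν) :
    ∃ lam₁ ≥ (1 : ℝ), ∃ C₃ > (0 : ℝ), ∀ w : Fin N → Eu n → ℝ,
      (∀ k, ContDiffOn ℝ 2 (w k) (closure Ω)) →
      (∀ k, ∀ x ∈ Ω, principalPart a (w k) x ^ 2 ≤ L * energyDensity w x) →
      ∀ B : ℝ, 0 ≤ B →
      (∀ k, ∫⁻ x in {x | x ∈ frontier Ω ∧ d < ξ x},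
        (‖w k x‖ₑ ^ 2 + ‖closureDeriv Ω (w k) x‖ₑ ^ 2) ∂μHE[n - 1] ≤ ENNReal.ofReal B) →
      ∀ lam ≥ lam₁, Real.exp (lam * d₂) ^ 2 * ∫ x in superlevel Ω ξ d₂, energyDensity w x ≤
        C₃ * (Real.exp (lam * d₁) ^ 2 * (∫ x in superlevel Ω ξ d, energyDensity w x) +
          lam ^ 3 * Real.exp (lam * m) ^ 2 * B) := by
  have hΩc : IsCompact (closure Ω) :=
    Metric.isCompact_of_isClosed_isBounded isClosed_closure hΩb.closure
  have hξc := hξ.continuousOn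
  obtain ⟨lam₀, hlam₀, C, hC, C', hC', hCarl⟩ := hCarleman
  -- The gap between `d` and `d'` makes `η w_k`, and with it `U`, vanish near the inner boundary `{ξ
  -- = d}`, where no data are given.
  obtain ⟨d', hd', hd'₁⟩ := exists_between hd
  obtain ⟨η, hη, hη0, hη1⟩ := exists_cutoff hξ hd'₁
  obtain ⟨M, hM, hMb⟩ := exists_bound_mul hΩ hΩc ha hη
  obtain ⟨Cg, hCg, hG⟩ := exists_divergence_bound hΩ hΩb hξc hd' hC2
  set D := superlevel Ω ξ d with hD
  have hDo : IsOpen D := isOpen_superlevel hΩ hξc d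
  have hDΩ : D ⊆ Ω := fun x hx => hx.1
  have hDb : Bornology.IsBounded D := hΩb.subset hDΩ
  have hDc : IsCompact (closure D) :=
    Metric.isCompact_of_isClosed_isBounded isClosed_closure hDb.closure
  have hD₂o : IsOpen (superlevel Ω ξ d₂) := isOpen_superlevel hΩ hξc d₂
  set R := N * (M * (L + 1)) with hR
  set R' := N * (Cg * (C' * (M * (n + 1)))) with hR'
  have hR0 : 0 ≤ R := by positivity
  have hR'0 : 0 ≤ R' := by positivity
  -- The second threshold is `C λ ≥ C + N L`: it absorbs the `N` right-hand sides and leaves one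
  -- copy of `C` times the energy.
  refine ⟨max lam₀ ((C + N * L) / C), (hlam₀.le.trans (le_max_left _ _)), (R + R' + 1) / C,
    by positivity, fun w hw hA B hB0 hB lam hlam => ?_⟩
  have hl₀ : lam₀ ≤ lam := (le_max_left _ _).trans hlam
  have hl1 : 1 ≤ lam := hlam₀.le.trans hl₀
  have hlC : C + N * L ≤ C * lam := by
    have := (le_max_right _ _).trans hlam
    rw [div_le_iff₀ hC] at this
    linarith
  have hl3 : lam ≤ lam ^ 3 := le_self_pow₀ hl1 (by norm_num)
  set S := energyDensity w with hS
  have hS0 : ∀ x, 0 ≤ S x := energyDensity_nonneg w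
  have hSi : IntegrableOn S Ω := integrableOn_energyDensity hΩ hΩb fun k => (hw k).of_le one_le_two
  have hu : ∀ k, ContDiffOn ℝ 2 (fun x => η x * w k x) (closure D) := fun k =>
    (hη.mul (hw k)).mono (closure_mono hDΩ)
  choose U hU hUb using fun k => hCarl lam hl₀ _ (hu k)
  have hUat : ∀ k, ∀ x ∈ D, DifferentiableAt ℝ (U k) x := fun k x hx =>
    (contDiffAt_of_contDiffOn_closure hDo (hU k) hx).differentiableAt one_ne_zero
  have hUi : ∀ k, IntegrableOn (divergence (U k)) D := fun k => by
    obtain ⟨Q, -, hQ⟩ := exists_bound_fderiv hDo hDc (hU k)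
    refine integrableOn_of_continuousOn_of_bound hDo hDb
      (continuousOn_divergence hDo ((hU k).mono subset_closure)) (Q := n * Q) fun x hx => ?_
    refine (abs_divergence_le _ (hUat k x hx)).trans ?_
    gcongr
    exact hQ x hx
  have hExp : ∀ {s t : ℝ}, s ≤ t → Real.exp (lam * s) ^ 2 ≤ Real.exp (lam * t) ^ 2 := fun h => by
    gcongr
  -- the pointwise inequality
  have hpt : ∀ x ∈ D, C * Real.exp (lam * d₂) ^ 2 * (superlevel Ω ξ d₂).indicator S x ≤
      R * Real.exp (lam * d₁) ^ 2 * S x - ∑ k, divergence (U k) x := by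
    intro x hx
    have hxΩ := hDΩ hx
    set E := Real.exp (lam * ξ x) ^ 2 with hE
    have hE0 : 0 < E := by positivity
    by_cases hx1 : d₁ < ξ x
    · have hk : ∀ k, divergence (U k) x ≤
          (L * S x - C * lam * (gradSq (w k) x + w k x ^ 2)) * E := by
        intro k
        have hev : (fun x => η x * w k x) =ᶠ[𝓝 x] w k := by
          filter_upwards [(isOpen_superlevel hΩ hξc d₁).mem_nhds ⟨hxΩ, hx1⟩] with y hy
          rw [hη1 y hy.2, one_mul]
        have h1 := (hUb k x hx).1
        simp only [principalPart_congr a hev, gradSq_congr hev, hη1 x hx1, one_mul] at h1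
        have h2 := mul_le_mul_of_nonneg_right (hA k x hxΩ) hE0.le
        -- The zero order term is weakened from `λ³` to `λ`, so that it joins the gradient term in
        -- the energy density.
        have h3 : 0 ≤ (lam ^ 3 - lam) * (C * (w k x ^ 2 * E)) :=
          mul_nonneg (sub_nonneg.2 hl3) (by positivity)
        linarith
      have hsum : ∑ k, divergence (U k) x ≤ (N * L - C * lam) * (S x * E) := by
        refine (Finset.sum_le_sum fun k _ => hk k).trans (le_of_eq ?_)
        have h : ∑ k, (gradSq (w k) x + w k x ^ 2) = S x := rfl
        rw [← Finset.sum_mul, Finset.sum_sub_distrib, Finset.sum_const, Finset.card_univ,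
          Fintype.card_fin, nsmul_eq_mul, ← Finset.mul_sum, h]
        ring
      have h4 : (N * L - C * lam) * (S x * E) ≤ -C * (S x * E) :=
        mul_le_mul_of_nonneg_right (by linarith) (mul_nonneg (hS0 x) hE0.le)
      have h5 : C * Real.exp (lam * d₂) ^ 2 * (superlevel Ω ξ d₂).indicator S x ≤
          C * (S x * E) := by
        by_cases hx2 : x ∈ superlevel Ω ξ d₂
        · rw [indicator_of_mem hx2, mul_assoc, mul_comm (S x)]
          gcongr
          · exact hS0 x
          · exact hExp hx2.2.le
        · rw [indicator_of_notMem hx2, mul_zero]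
          have := hS0 x
          positivity
      have h6 : 0 ≤ R * Real.exp (lam * d₁) ^ 2 * S x := by
        have := hS0 x
        positivity
      linarith
    · have hx2 : x ∉ superlevel Ω ξ d₂ := fun h => hx1 (hd₁₂.trans_lt h.2)
      rw [indicator_of_notMem hx2, mul_zero, sub_nonneg]
      -- In the cutoff zone the positive Carleman terms are dropped, and all of `(A₀(ηw))²` is paid
      -- for with the small weight `e^{2λd₁}`.
      have hk : ∀ k ∈ (Finset.univ : Finset (Fin N)), divergence (U k) x ≤
          M * (L + 1) * Real.exp (lam * d₁) ^ 2 * S x := by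
        intro k _
        have h1 := (hUb k x hx).1
        have h2 : 0 ≤ C * lam * gradSq (fun x => η x * w k x) x * E +
            C * lam ^ 3 * (η x * w k x) ^ 2 * E := by
          have := gradSq_nonneg (fun x => η x * w k x) x
          positivity
        have h3 : gradSq (w k) x + w k x ^ 2 ≤ S x :=
          Finset.single_le_sum (f := fun k => gradSq (w k) x + w k x ^ 2)
            (fun k _ => add_nonneg (gradSq_nonneg _ _) (sq_nonneg _)) (Finset.mem_univ k)
        have h4 : principalPart a (fun x => η x * w k x) x ^ 2 ≤ M * (L + 1) * S x := by
          refine ((hMb (w k) (hw k) x hxΩ).1).trans ?_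
          rw [mul_assoc]
          gcongr
          linarith [hA k x hxΩ]
        calc divergence (U k) x ≤ principalPart a (fun x => η x * w k x) x ^ 2 * E := by linarith
          _ ≤ M * (L + 1) * S x * Real.exp (lam * d₁) ^ 2 :=
              mul_le_mul h4 (hExp (not_lt.1 hx1)) hE0.le
                (mul_nonneg (by positivity) (hS0 x))
          _ = _ := by ring
      refine (Finset.sum_le_card_nsmul _ _ _ hk).trans (le_of_eq ?_)
      rw [hR]
      simp
      ring
  -- the boundary term
  set K := C' * lam ^ 3 * (M * (n + 1)) * Real.exp (lam * m) ^ 2 with hK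
  have hK0 : 0 ≤ K := by positivity
  have hUD : ∀ k, ∀ x ∈ D, ‖U k x‖ ≤ K * (w k x ^ 2 + ‖fderiv ℝ (w k) x‖ ^ 2) := by
    intro k x hx
    refine (hUb k x hx).2.trans ?_
    have h1 := (hMb (w k) (hw k) x (hDΩ hx)).2
    have h2 := gradSq_le (w k) x
    have h3 : gradSq (fun x => η x * w k x) x + (η x * w k x) ^ 2 ≤
        M * (n + 1) * (w k x ^ 2 + ‖fderiv ℝ (w k) x‖ ^ 2) := by
      refine h1.trans ?_
      rw [mul_assoc]
      gcongr
      nlinarith [mul_nonneg (Nat.cast_nonneg n : (0 : ℝ) ≤ n) (sq_nonneg (w k x)),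
        sq_nonneg ‖fderiv ℝ (w k) x‖]
    calc _ ≤ C' * lam ^ 3 * (M * (n + 1) * (w k x ^ 2 + ‖fderiv ℝ (w k) x‖ ^ 2)) *
          Real.exp (lam * m) ^ 2 := by
          gcongr
          exact hm x hx
      _ = _ := by rw [hK]; ring
  -- The bound on `U` is known only inside. Both sides have limits at boundary points with `ξ > d`,
  -- and there `fderiv` tends to `closureDeriv`.
  have hUbd : ∀ k, ∀ x ∈ {x | x ∈ frontier Ω ∧ d < ξ x}, ‖U k x‖ₑ ≤
      ENNReal.ofReal K * (‖w k x‖ₑ ^ 2 + ‖closureDeriv Ω (w k) x‖ₑ ^ 2) := by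
    rintro k x ⟨hxf, hxd⟩
    have hxΩ : x ∈ closure Ω := frontier_subset_closure hxf
    have hxD : x ∈ closure D :=
      mem_of_mem_nhdsWithin hxΩ (mem_nhdsWithin_closure_superlevel hξc hxΩ hxd)
    have hne : (𝓝[D] x).NeBot := mem_closure_iff_nhdsWithin_neBot.1 hxD
    have hw1 : ContDiffOn ℝ 1 (w k) (closure Ω) := (hw k).of_le one_le_two
    have t1 : Tendsto (fun y => ‖U k y‖) (𝓝[D] x) (𝓝 ‖U k x‖) :=
      (((hU k).continuousOn x hxD).mono subset_closure).norm
    have t2 : Tendsto (w k) (𝓝[D] x) (𝓝 (w k x)) :=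
      ((hw k).continuousOn x hxΩ).mono (hDΩ.trans subset_closure)
    have t3 : Tendsto (fderiv ℝ (w k)) (𝓝[D] x) (𝓝 (closureDeriv Ω (w k) x)) :=
      (tendsto_closureDeriv hΩ hw1 hxΩ).mono_left (nhdsWithin_mono _ hDΩ)
    have h := le_of_tendsto_of_tendsto t1 (((t2.pow 2).add (t3.norm.pow 2)).const_mul K)
      (by filter_upwards [self_mem_nhdsWithin] with y hy using hUD k y hy)
    simp only [← ofReal_norm]
    rw [← ENNReal.ofReal_pow (norm_nonneg _), ← ENNReal.ofReal_pow (norm_nonneg _),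
      ← ENNReal.ofReal_add (by positivity) (by positivity), ← ENNReal.ofReal_mul hK0,
      Real.norm_eq_abs (w k x), sq_abs]
    exact ENNReal.ofReal_le_ofReal h
  have hbd : ∀ k ∈ (Finset.univ : Finset (Fin N)), -∫ x in D, divergence (U k) x ≤ Cg * K * B := by
    intro k _
    -- The Carleman bound on `|U|` is zero where `η w_k` vanishes locally.
    have h0 : ∀ y ∈ D, ξ y < d' → U k y = 0 := by
      intro y hy hyd
      have hev : (fun x => η x * w k x) =ᶠ[𝓝 y] fun _ => 0 := by
        have h1 : ∀ᶠ z in 𝓝 y, ξ z < d' := by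
          have := (hξc.mono subset_closure).continuousAt (hΩ.mem_nhds (hDΩ hy))
          exact this.eventually (gt_mem_nhds hyd)
        filter_upwards [h1] with z hz
        rw [hη0 z hz, zero_mul]
      have h2 := (hUb k y hy).2
      rw [gradSq_congr hev, hη0 y hyd] at h2
      simpa [gradSq, pd] using h2
    have hfm : MeasurableSet {x | x ∈ frontier Ω ∧ d < ξ x} := by
      obtain ⟨O, hO, hOe⟩ :=
        continuousOn_iff'.1 (hξc.mono frontier_subset_closure) (Ioi d) isOpen_Ioi
      have : {x | x ∈ frontier Ω ∧ d < ξ x} = O ∩ frontier Ω := by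
        rw [← hOe, inter_comm]
        rfl
      rw [this]
      exact hO.measurableSet.inter isClosed_frontier.measurableSet
    have h1 : ENNReal.ofReal |∫ x in D, divergence (U k) x| ≤ ENNReal.ofReal (Cg * K * B) := by
      refine (hG (U k) (hU k) h0).trans ?_
      rw [ENNReal.ofReal_mul (by positivity), ENNReal.ofReal_mul hCg.le, mul_assoc]
      gcongr
      refine (setLIntegral_mono' hfm (hUbd k)).trans ?_
      rw [lintegral_const_mul' _ _ ENNReal.ofReal_ne_top]
      gcongr
      exact hB k
    rw [ENNReal.ofReal_le_ofReal_iff (by positivity)] at h1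
    exact (neg_le_abs _).trans h1
  have hSD : IntegrableOn S D := hSi.mono_set hDΩ
  have hint := setIntegral_mono_on
    (((hSD.indicator hD₂o.measurableSet).const_mul (C * Real.exp (lam * d₂) ^ 2)))
    ((hSD.const_mul (R * Real.exp (lam * d₁) ^ 2)).sub (integrable_finsetSum _ fun k _ => hUi k))
    hDo.measurableSet hpt
  rw [integral_const_mul, integral_sub' (hSD.const_mul _) (integrable_finsetSum _ fun k _ => hUi k),
    integral_const_mul, integral_finsetSum _ fun k _ => hUi k,
    setIntegral_indicator hD₂o.measurableSet] at hint
  by_cases hd₂ : d ≤ d₂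
  swap
  · exact absurd (hd.le.trans hd₁₂) hd₂
  rw [inter_eq_self_of_subset_right (show superlevel Ω ξ d₂ ⊆ D from
    fun x hx => ⟨hx.1, hd₂.trans_lt hx.2⟩)] at hint
  have hsum := Finset.sum_le_card_nsmul _ _ _ hbd
  rw [Finset.sum_neg_distrib, Finset.card_univ, Fintype.card_fin, nsmul_eq_mul] at hsum
  have hfin : N * (Cg * K * B) = R' * (lam ^ 3 * Real.exp (lam * m) ^ 2 * B) := by
    rw [hR', hK]
    ring
  rw [div_mul_eq_mul_div, le_div_iff₀ hC]
  have hI0 : 0 ≤ ∫ x in D, S x := integral_nonneg hS0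
  have g1 : 0 ≤ Real.exp (lam * d₁) ^ 2 * ∫ x in D, S x := by positivity
  have g2 : 0 ≤ lam ^ 3 * Real.exp (lam * m) ^ 2 * B := by positivity
  nlinarith [mul_nonneg hR0 g2, mul_nonneg hR'0 g1]

end Energy

/-! ### Norms, the linearized inequality and the choice of the parameter -/

section Norms

variable {n N : ℕ} {Ω : Set (Eu n)}

lemma abs_le_normC1 (hΩ : IsOpen Ω) (hΩc : IsCompact (closure Ω)) {u : Eu n → ℝ}
    (hu : ContDiffOn ℝ 1 u (closure Ω)) {x : Eu n} (hx : x ∈ Ω) :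
    |u x| ≤ normC1 Ω u ∧ ∀ i, |pd i u x| ≤ normC1 Ω u := by
  obtain ⟨A, -, hA⟩ := exists_bound_of_contDiffOn_closure hΩc hu.continuousOn
  obtain ⟨B, -, hB⟩ := exists_bound_fderiv hΩ hΩc hu
  have h1 : |u x| ≤ sSup ((fun x => |u x|) '' Ω) :=
    le_csSup ⟨A, by rintro _ ⟨y, hy, rfl⟩; exact hA y hy⟩ ⟨x, hx, rfl⟩
  have h2 : ∀ i, |pd i u x| ≤ sSup ((fun x => |pd i u x|) '' Ω) := fun i =>
    le_csSup ⟨B, by rintro _ ⟨y, hy, rfl⟩; exact (abs_pd_le i u y).trans (hB y hy)⟩ ⟨x, hx, rfl⟩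
  have h3 : ∀ i, 0 ≤ sSup ((fun x => |pd i u x|) '' Ω) := fun i => (abs_nonneg _).trans (h2 i)
  unfold normC1
  refine ⟨by linarith [Finset.sum_nonneg fun i (_ : i ∈ Finset.univ) => h3 i], fun i => ?_⟩
  have h4 := Finset.single_le_sum (f := fun i => sSup ((fun x => |pd i u x|) '' Ω))
    (fun i _ => h3 i) (Finset.mem_univ i)
  linarith [h2 i, abs_nonneg (u x)]

lemma normC1_le_vecNormC1 (V : Fin N → Eu n → ℝ) (k : Fin N) : normC1 Ω (V k) ≤ vecNormC1 Ω V :=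
  Real.le_sqrt_of_sq_le (Finset.single_le_sum (f := fun k => normC1 Ω (V k) ^ 2)
    (fun _ _ => sq_nonneg _) (Finset.mem_univ k))

lemma ofReal_integral_sq {D : Set (Eu n)} {u : Eu n → ℝ}
    (hu : IntegrableOn (fun x => u x ^ 2) D) : sqL2 D u = ENNReal.ofReal (∫ x in D, u x ^ 2) := by
  rw [sqL2, ofReal_integral_eq_lintegral_ofReal hu (Eventually.of_forall fun x => sq_nonneg _)]
  refine lintegral_congr fun x => ?_
  rw [← ofReal_norm, ← ENNReal.ofReal_pow (norm_nonneg _), Real.norm_eq_abs, sq_abs]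

lemma integrableOn_pd_sq (hΩ : IsOpen Ω) (hΩb : Bornology.IsBounded Ω) {u : Eu n → ℝ}
    (hu : ContDiffOn ℝ 1 u (closure Ω)) (i : Fin n) : IntegrableOn (fun x => pd i u x ^ 2) Ω := by
  have hΩc : IsCompact (closure Ω) :=
    Metric.isCompact_of_isClosed_isBounded isClosed_closure hΩb.closure
  obtain ⟨L, -, hL⟩ := exists_bound_fderiv hΩ hΩc hu
  refine integrableOn_of_continuousOn_of_bound hΩ hΩb ((continuousOn_pd hΩ hu i).pow 2)
    (Q := L ^ 2) fun x hx => ?_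
  rw [norm_pow]
  gcongr
  exact (abs_pd_le i u x).trans (hL x hx)

lemma normH1_eq (hΩ : IsOpen Ω) (hΩb : Bornology.IsBounded Ω) {w : Fin N → Eu n → ℝ}
    (hw : ∀ k, ContDiffOn ℝ 1 (w k) (closure Ω)) {D : Set (Eu n)} (hD : D ⊆ Ω) :
    normH1 D w = ENNReal.ofReal (√(∫ x in D, energyDensity w x)) := by
  have h1 : ∀ k, IntegrableOn (fun x => w k x ^ 2) D := fun k =>
    (integrableOn_sq hΩ hΩb (hw k).continuousOn).mono_set hD
  have h2 : ∀ k i, IntegrableOn (fun x => pd i (w k) x ^ 2) D := fun k i =>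
    (integrableOn_pd_sq hΩ hΩb (hw k) i).mono_set hD
  have h3 : ∫ x in D, energyDensity w x =
      ∑ k, ((∫ x in D, w k x ^ 2) + ∑ i, ∫ x in D, pd i (w k) x ^ 2) := by
    simp only [energyDensity]
    rw [integral_finsetSum]
    · refine Finset.sum_congr rfl fun k _ => ?_
      simp only [gradSq]
      rw [integral_add (integrable_finsetSum _ fun i _ => h2 k i) (h1 k),
        integral_finsetSum _ fun i _ => h2 k i, add_comm]
    · exact fun k _ => (integrable_finsetSum _ fun i _ => h2 k i).add (h1 k)
  have h4 : ∀ k, 0 ≤ ∫ x in D, w k x ^ 2 := fun k => integral_nonneg fun _ => sq_nonneg _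
  have h5 : ∀ k i, 0 ≤ ∫ x in D, pd i (w k) x ^ 2 := fun k i => integral_nonneg fun _ => sq_nonneg _
  have h6 : ∀ k, 0 ≤ ∑ i, ∫ x in D, pd i (w k) x ^ 2 := fun k => Finset.sum_nonneg fun i _ => h5 k i
  have h7 : ∀ k, sqL2 D (w k) + ∑ i, sqL2 D (pd i (w k)) =
      ENNReal.ofReal ((∫ x in D, w k x ^ 2) + ∑ i, ∫ x in D, pd i (w k) x ^ 2) := fun k => by
    rw [ENNReal.ofReal_add (h4 k) (h6 k), ENNReal.ofReal_sum_of_nonneg fun i _ => h5 k i,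
      ofReal_integral_sq (h1 k)]
    simp only [ofReal_integral_sq (h2 k _)]
  rw [normH1, h3, Real.sqrt_eq_rpow, Finset.sum_congr rfl fun k _ => h7 k,
    ← ENNReal.ofReal_sum_of_nonneg fun k _ => add_nonneg (h4 k) (h6 k),
    ENNReal.ofReal_rpow_of_nonneg (Finset.sum_nonneg fun k _ => add_nonneg (h4 k) (h6 k))
      (by norm_num)]

lemma normH1_le_normH2 {D : Set (Eu n)} (hD : D ⊆ Ω) (w : Fin N → Eu n → ℝ) :
    normH1 D w ≤ normH2 Ω w := by
  unfold normH1 normH2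
  refine ENNReal.rpow_le_rpow (Finset.sum_le_sum fun k _ => ?_) (by norm_num)
  refine le_add_right (add_le_add ?_ (Finset.sum_le_sum fun i _ => ?_)) <;>
  exact lintegral_mono_set hD

lemma sqL2_ne_top (hΩb : Bornology.IsBounded Ω) {u : Eu n → ℝ} {C : ℝ}
    (hC : ∀ x ∈ Ω, |u x| ≤ C) : sqL2 Ω u ≠ ⊤ := by
  refine (setLIntegral_lt_top_of_le_nnreal hΩb.measure_lt_top.ne
    ⟨(C ^ 2).toNNReal, fun x hx => ?_⟩).ne
  rw [← ofReal_norm, ← ENNReal.ofReal_pow (norm_nonneg _)]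
  refine ENNReal.ofReal_le_ofReal ?_
  gcongr
  exact hC x hx

lemma normH2_ne_top (hΩ : IsOpen Ω) (hΩb : Bornology.IsBounded Ω) {w : Fin N → Eu n → ℝ}
    (hw : ∀ k, ContDiffOn ℝ 2 (w k) (closure Ω)) : normH2 Ω w ≠ ⊤ := by
  have hΩc : IsCompact (closure Ω) :=
    Metric.isCompact_of_isClosed_isBounded isClosed_closure hΩb.closure
  refine ENNReal.rpow_ne_top_of_nonneg (by norm_num) (ENNReal.sum_ne_top.2 fun k _ => ?_)
  obtain ⟨A, -, hA⟩ := exists_bound_of_contDiffOn_closure hΩc (hw k).continuousOn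
  obtain ⟨B, -, hB⟩ := exists_bound_fderiv hΩ hΩc ((hw k).of_le one_le_two)
  obtain ⟨C, -, hC⟩ := exists_bound_fderiv_fderiv hΩ hΩc (hw k)
  refine ENNReal.add_ne_top.2 ⟨ENNReal.add_ne_top.2 ⟨sqL2_ne_top hΩb hA,
    ENNReal.sum_ne_top.2 fun i _ => sqL2_ne_top hΩb fun x hx =>
      (abs_pd_le i _ x).trans (hB x hx)⟩,
    ENNReal.sum_ne_top.2 fun i _ => ENNReal.sum_ne_top.2 fun j _ => sqL2_ne_top hΩb
      fun x hx => (abs_pd_pd_le (contDiffAt_of_contDiffOn_closure hΩ (hw k) hx) i j).trans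
        (hC x hx)⟩

lemma le_sq_of_rpow_half_le {A b : ℝ≥0∞} (h : A ^ (1 / 2 : ℝ) ≤ b) : A ≤ b ^ 2 := by
  have h1 : (A ^ (1 / 2 : ℝ)) ^ 2 = A := by
    rw [← ENNReal.rpow_natCast, ← ENNReal.rpow_mul]
    norm_num
  rw [← h1]
  gcongr

/-- The difference of two solutions satisfies a linear differential inequality. -/
lemma exists_principalPart_sub_sq_le (hΩ : IsOpen Ω) (hΩb : Bornology.IsBounded Ω)
    {a : Fin n → Fin n → Eu n → ℝ} (ha : ∀ i j, ContDiff ℝ 1 (a i j)) {K Z : ℝ} (hK : 0 < K)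
    (hZ : 0 < Z) : ∃ L > (0 : ℝ), ∀ b : Fin n → Eu n → ℝ, (∀ i, ContDiff ℝ 1 (b i)) →
      (∀ i, normC1 Ω (b i) ≤ Z) → ∀ V₁ V₂ : Fin N → Eu n → ℝ, IsSolution a b Ω V₁ →
      IsSolution a b Ω V₂ → vecNormC1 Ω V₁ ≤ K → vecNormC1 Ω V₂ ≤ K →
      ∀ k, ∀ x ∈ Ω, principalPart a ((V₁ - V₂) k) x ^ 2 ≤ L * energyDensity (V₁ - V₂) x := by
  have hΩc : IsCompact (closure Ω) :=
    Metric.isCompact_of_isClosed_isBounded isClosed_closure hΩb.closure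
  obtain ⟨A, hA, hAb⟩ := exists_bound_coeff hΩc ha
  obtain ⟨L, hL, hLb⟩ := exists_nonlinearity_lipschitz (N := N) a hA.le hK.le hZ.le
  refine ⟨L ^ 2 * (N * n) + 1, by positivity, fun b hb hbZ V₁ V₂ hV₁ hV₂ hK₁ hK₂ k x hx => ?_⟩
  have hc₁ := fun l => contDiffAt_of_contDiffOn_closure hΩ (hV₁.1 l) hx
  have hc₂ := fun l => contDiffAt_of_contDiffOn_closure hΩ (hV₂.1 l) hx
  have hpd : ∀ l i, pd i ((V₁ - V₂) l) x = pd i (V₁ l) x - pd i (V₂ l) x := fun l i =>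
    pd_sub ((hc₁ l).differentiableAt two_ne_zero) ((hc₂ l).differentiableAt two_ne_zero) i
  have e1 : principalPart a ((V₁ - V₂) k) x =
      nonlinearity a b x (fun l i => pd i (V₁ l) x) k -
        nonlinearity a b x (fun l i => pd i (V₂ l) x) k := by
    rw [Pi.sub_apply, principalPart_sub a (hc₁ k) (hc₂ k)]
    linarith [hV₁.2 x hx k, hV₂.2 x hx k]
  have h1 := hLb b x (fun l i => pd i (V₁ l) x) (fun l i => pd i (V₂ l) x) k (hAb x hx)
    (fun i => ((abs_le_normC1 hΩ hΩc (hb i).contDiffOn hx).1).trans (hbZ i))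
    (fun l i => ((abs_le_normC1 hΩ hΩc ((hV₁.1 l).of_le one_le_two) hx).2 i).trans
      ((normC1_le_vecNormC1 V₁ l).trans hK₁))
    (fun l i => ((abs_le_normC1 hΩ hΩc ((hV₂.1 l).of_le one_le_two) hx).2 i).trans
      ((normC1_le_vecNormC1 V₂ l).trans hK₂))
  rw [← e1] at h1
  simp only [← hpd] at h1
  have hE0 := energyDensity_nonneg (V₁ - V₂) x
  -- Cauchy-Schwarz in both indices gives the factor `N n`.
  have h2 : (∑ l, ∑ i, |pd i ((V₁ - V₂) l) x|) ^ 2 ≤ N * n * energyDensity (V₁ - V₂) x := by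
    calc _ ≤ (N : ℝ) * ∑ l, (∑ i, |pd i ((V₁ - V₂) l) x|) ^ 2 := by
          simpa using sq_sum_le_card_mul_sum_sq (s := Finset.univ)
            (f := fun l => ∑ i, |pd i ((V₁ - V₂) l) x|)
      _ ≤ N * ∑ l, n * (gradSq ((V₁ - V₂) l) x + (V₁ - V₂) l x ^ 2) := by
          gcongr with l
          refine (sq_sum_le_card_mul_sum_sq (s := Finset.univ)).trans ?_
          simp only [sq_abs, Finset.card_univ, Fintype.card_fin]
          gcongr
          exact le_add_of_nonneg_right (sq_nonneg _)
      _ = _ := by rw [← Finset.mul_sum, energyDensity, mul_assoc]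
  calc principalPart a ((V₁ - V₂) k) x ^ 2 = |principalPart a ((V₁ - V₂) k) x| ^ 2 :=
        (sq_abs _).symm
    _ ≤ (L * ∑ l, ∑ i, |pd i ((V₁ - V₂) l) x|) ^ 2 := by gcongr
    _ = L ^ 2 * (∑ l, ∑ i, |pd i ((V₁ - V₂) l) x|) ^ 2 := by ring
    _ ≤ L ^ 2 * (N * n * energyDensity (V₁ - V₂) x) := by gcongr
    _ ≤ _ := by linarith

/-- The choice of the large parameter in the Carleman estimate. -/
lemma exists_large_parameter {d c m lam₁ : ℝ} (hd : 0 < d) (hc : 0 < c) (hm : d + c < m)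
    (hl : 0 < lam₁) : ∃ σ₀ ∈ Ioo (0 : ℝ) 1, ∃ C > (0 : ℝ), ∀ σ ∈ Ioo (0 : ℝ) σ₀, ∃ lam ≥ lam₁,
      Real.exp (lam * (d + c * d / m)) ^ 2 ≤
        Real.exp (lam * (d + c)) ^ 2 * (σ ^ (c / (m + c))) ^ 2 ∧
      lam ^ 3 * Real.exp (lam * m) ^ 2 * σ ^ 2 ≤
        C * (Real.exp (lam * (d + c)) ^ 2 * (σ ^ (c / (m + c))) ^ 2) := by
  have hm0 : 0 < m := by linarith
  have hmd : 0 < m - d := by linarith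
  have hmc : 0 < m + c := by linarith
  -- For `σ = e^{-λ/κ}` the boundary term, with `λ³` absorbed in `e^{2λc}`, scales like `σ^{2(1 -
  -- κ(m-d))}`, and the interior term with `d₁ = d + δ` like `σ^{2κ(c-δ)}`. Both exponents equal
  -- `2c/(m+c)` exactly for this `κ` and `δ = cd/m`.
  set κ := m / ((m - d) * (m + c)) with hκ
  have hκ0 : 0 < κ := by positivity
  -- `σ < σ₀` says precisely that `λ = -κ log σ` exceeds `lam₁`.
  refine ⟨Real.exp (-(lam₁ / κ)), ⟨Real.exp_pos _, ?_⟩, (3 / (2 * c)) ^ 3, by positivity,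
    fun σ hσ => ?_⟩
  · rw [Real.exp_lt_one_iff, neg_lt_zero]
    positivity
  set lam := -(κ * Real.log σ) with hlam
  have hlog : Real.log σ < -(lam₁ / κ) := (Real.log_lt_iff_lt_exp hσ.1).2 hσ.2
  have hlam1 : lam₁ ≤ lam := by
    have h := mul_lt_mul_of_pos_left hlog hκ0
    rw [mul_neg, mul_div_cancel₀ _ hκ0.ne'] at h
    linarith
  have hlam0 : 0 < lam := hl.trans_le hlam1
  have hs : Real.log σ = -lam / κ := by
    rw [hlam]
    field_simp
  have hσe : σ = Real.exp (-lam / κ) := by rw [← hs, Real.exp_log hσ.1]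
  have hρ : σ ^ (c / (m + c)) = Real.exp (-lam / κ * (c / (m + c))) := by
    rw [Real.rpow_def_of_pos hσ.1, hs]
  refine ⟨lam, hlam1, ?_, ?_⟩
  · rw [hρ, ← mul_pow, ← Real.exp_add]
    refine le_of_eq ?_
    congr 2
    rw [hκ]
    field_simp
    ring
  -- This is `t ≤ e^t` with `t = 2cλ/3`, cubed.
  · have h1 : lam ^ 3 ≤ (3 / (2 * c)) ^ 3 * Real.exp (lam * c) ^ 2 := by
      have h2 : 2 * c * lam / 3 ≤ Real.exp (2 * c * lam / 3) :=
        (by linarith : 2 * c * lam / 3 ≤ 2 * c * lam / 3 + 1).trans (Real.add_one_le_exp _)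
      have h3 : (2 * c * lam / 3) ^ 3 ≤ Real.exp (2 * c * lam / 3) ^ 3 := by gcongr
      have h4 : Real.exp (2 * c * lam / 3) ^ 3 = Real.exp (lam * c) ^ 2 := by
        rw [← Real.exp_nat_mul, ← Real.exp_nat_mul]
        congr 1
        push_cast
        ring
      rw [h4] at h3
      calc lam ^ 3 = (3 / (2 * c)) ^ 3 * (2 * c * lam / 3) ^ 3 := by
            field_simp
        _ ≤ _ := by gcongr
    have h5 : Real.exp (lam * c) * Real.exp (lam * m) * Real.exp (-lam / κ) =
        Real.exp (lam * (d + c)) * Real.exp (-lam / κ * (c / (m + c))) := by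
      rw [← Real.exp_add, ← Real.exp_add, ← Real.exp_add]
      congr 1
      rw [hκ]
      field_simp
      ring
    calc lam ^ 3 * Real.exp (lam * m) ^ 2 * σ ^ 2
        ≤ (3 / (2 * c)) ^ 3 * Real.exp (lam * c) ^ 2 * Real.exp (lam * m) ^ 2 * σ ^ 2 := by gcongr
      _ = (3 / (2 * c)) ^ 3 * (Real.exp (lam * c) * Real.exp (lam * m) * σ) ^ 2 := by ring
      _ = _ := by
        rw [hρ]
        nth_rw 1 [hσe]
        rw [h5]
        ring

end Norms

/-! ### Hölder stability and uniqueness -/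

section Stability

variable {n N : ℕ} {Ω Γ : Set (Eu n)} {ξ : Eu n → ℝ} {d : ℝ} {a : Fin n → Fin n → Eu n → ℝ}

lemma lintegral_trace_le_of_cauchyData (hΩ : IsOpen Ω) {ν : Eu n → Eu n}
    (hΓ : IsC2BoundaryPart Ω Γ ν) {V₁ V₂ p₀₁ p₁₁ p₀₂ p₁₂ : Fin N → Eu n → ℝ}
    (hV₁ : ∀ k, ContDiffOn ℝ 1 (V₁ k) (closure Ω)) (hV₂ : ∀ k, ContDiffOn ℝ 1 (V₂ k) (closure Ω))
    (h₁ : HasCauchyData Γ ν V₁ p₀₁ p₁₁) (h₂ : HasCauchyData Γ ν V₂ p₀₂ p₁₂) (k : Fin N) :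
    ∫⁻ x in Γ, (‖(V₁ - V₂) k x‖ₑ ^ 2 + ‖closureDeriv Ω ((V₁ - V₂) k) x‖ₑ ^ 2) ∂μHE[n - 1] ≤
      normH1Surface Γ (p₀₁ - p₀₂) ^ 2 + normL2Surface Γ (p₁₁ - p₁₂) ^ 2 := by
  have h := lintegral_trace_le hΩ hΓ (w := (V₁ - V₂) k) (p := (p₀₁ - p₀₂) k)
    (q := (p₁₁ - p₁₂) k) ((hV₁ k).sub (hV₂ k))
    (fun x hx => by simp [(h₁ x hx k).1, (h₂ x hx k).1])
    (fun x hx => (h₁ x hx k).2.sub (h₂ x hx k).2) μHE[n - 1]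
  refine h.trans (add_le_add ?_ ?_)
  · refine le_trans ?_ (le_sq_of_rpow_half_le le_rfl)
    exact Finset.single_le_sum (f := fun k => ∫⁻ x in Γ,
      (‖(p₀₁ - p₀₂) k x‖ₑ ^ 2 + tangentialGradSq Γ ((p₀₁ - p₀₂) k) x) ∂μHE[n - 1])
      (fun _ _ => zero_le) (Finset.mem_univ k)
  · refine le_trans ?_ (le_sq_of_rpow_half_le le_rfl)
    exact Finset.single_le_sum (f := fun k => ∫⁻ x in Γ, ‖(p₁₁ - p₁₂) k x‖ₑ ^ 2 ∂μHE[n - 1])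
      (fun _ _ => zero_le) (Finset.mem_univ k)

/-- Where `p₀` vanishes on `Γ`, the zero vector is a competitor for the tangential gradient. -/
lemma surface_norms_eq_zero {ν : Eu n → Eu n} (hΓ : IsC2BoundaryPart Ω Γ ν)
    {p₀ p₁ : Fin N → Eu n → ℝ} (h : ∀ x ∈ Γ, ∀ k, p₀ k x = 0 ∧ p₁ k x = 0) :
    normH1Surface Γ p₀ = 0 ∧ normL2Surface Γ p₁ = 0 := by
  have ht : ∀ x ∈ Γ, ∀ k, tangentialGradSq Γ (p₀ k) x = 0 := by
    intro x hx k
    refine le_antisymm ((iInf₂_le (0 : Eu n) ?_).trans (by simp)) zero_le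
    change HasGradientWithinAt (p₀ k) 0 Γ x
    rw [hasGradientWithinAt_iff_hasFDerivWithinAt, map_zero]
    exact (hasFDerivWithinAt_const (0 : ℝ) x Γ).congr (fun y hy => (h y hy k).1) (h x hx k).1
  constructor
  · rw [normH1Surface, Finset.sum_eq_zero, ENNReal.zero_rpow_of_pos (by norm_num)]
    intro k _
    rw [setLIntegral_congr_fun (g := fun _ => 0) hΓ.measurableSet, lintegral_zero]
    intro x hx
    simp [(h x hx k).1, ht x hx k]
  · rw [normL2Surface, Finset.sum_eq_zero, ENNReal.zero_rpow_of_pos (by norm_num)]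
    intro k _
    rw [setLIntegral_congr_fun (g := fun _ => 0) hΓ.measurableSet, lintegral_zero]
    intro x hx
    simp [(h x hx k).2]

lemma holder_stability (hΩo : IsOpen Ω) (hΩb : Bornology.IsBounded Ω)
    (hξ : ContDiffOn ℝ ∞ ξ (closure Ω)) (hd : 0 < d) (ha : ∀ i j, ContDiff ℝ 1 (a i j))
    (hCarleman : AdmitsCarleman a (superlevel Ω ξ d) ξ) {K Z c m : ℝ} (hK : 0 < K) (hZ : 0 < Z)
    (hc : 0 < c) (hne : (superlevel Ω ξ (d + c)).Nonempty)
    (hm : IsGreatest (ξ '' closure (superlevel Ω ξ d)) m) :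
    ∃ σ₀ ∈ Ioo (0 : ℝ) 1, ∃ C₂ > (0 : ℝ),
        ∀ b : Fin n → Eu n → ℝ, (∀ i, ContDiff ℝ 1 (b i)) → (∀ i, normC1 Ω (b i) ≤ Z) →
        ∀ (Γ : Set (Eu n)) (ν : Eu n → Eu n), IsC2BoundaryPart Ω Γ ν →
          {x | x ∈ frontier Ω ∧ d < ξ x} ⊆ Γ →
        ∀ V₁ V₂ p₀₁ p₁₁ p₀₂ p₁₂ : Fin N → Eu n → ℝ,
          IsSolution a b Ω V₁ → IsSolution a b Ω V₂ →
          HasCauchyData Γ ν V₁ p₀₁ p₁₁ → HasCauchyData Γ ν V₂ p₀₂ p₁₂ →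
          vecNormC1 Ω V₁ ≤ K → vecNormC1 Ω V₂ ≤ K →
        ∀ σ ∈ Ioo (0 : ℝ) σ₀,
          normH1Surface Γ (p₀₁ - p₀₂) ≤ ENNReal.ofReal σ →
          normL2Surface Γ (p₁₁ - p₁₂) ≤ ENNReal.ofReal σ →
          normH1 (superlevel Ω ξ (d + c)) (V₁ - V₂) ≤
            ENNReal.ofReal C₂ * (1 + normH2 Ω (V₁ - V₂)) * ENNReal.ofReal (σ ^ (c / (m + c))) := by
  -- The constants are chosen before `Γ`, so the regularity of `∂Ω ∩ {ξ > d}` cannot yet be read off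
  -- from `Γ`. If it fails, no admissible `Γ` exists and any constants will do.
  by_cases hC2 : ∀ x ∈ frontier Ω, d < ξ x → ∃ ν, IsC2BoundaryPoint Ω x ν
  swap
  · refine ⟨1 / 2, by norm_num, 1, one_pos, fun b _ _ Γ ν hΓ hsub => absurd ?_ hC2⟩
    exact fun x hx hxd => ⟨ν x, hΓ.2 x (hsub ⟨hx, hxd⟩)⟩
  have hξm : ∀ x ∈ superlevel Ω ξ d, ξ x ≤ m := fun x hx =>
    hm.2 (mem_image_of_mem _ (subset_closure hx))
  obtain ⟨x₀, hx₀⟩ := hne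
  have hmdc : d + c < m := hx₀.2.trans_le (hξm x₀ ⟨hx₀.1, by linarith [hx₀.2]⟩)
  have hm0 : 0 < m := by linarith
  have hδ0 : 0 < c * d / m := by positivity
  have hδc : c * d / m ≤ c := by
    rw [div_le_iff₀ hm0]
    gcongr
    linarith
  obtain ⟨L, hL, hLb⟩ := exists_principalPart_sub_sq_le (N := N) hΩo hΩb ha hK hZ
  obtain ⟨lam₁, hlam₁, C₃, hC₃, hest⟩ := exists_energy_estimate (N := N) hΩo hΩb
    (contDiffOn_infty.1 hξ 2) (d₁ := d + c * d / m) (d₂ := d + c) (m := m) (by linarith)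
    (by linarith) hξm hL ha hCarleman hC2
  obtain ⟨σ₀, hσ₀, C₅, hC₅, hpar⟩ := exists_large_parameter hd hc hmdc (one_pos.trans_le hlam₁)
  refine ⟨σ₀, hσ₀, √(C₃ * (1 + C₅ * 2)), by positivity, fun b hb hbZ Γ ν hΓ hsub V₁ V₂ p₀₁ p₁₁ p₀₂ p₁₂
    hV₁ hV₂ h₁ h₂ hK₁ hK₂ σ hσ hp₀ hp₁ => ?_⟩
  have hV₁1 := fun k => (hV₁.1 k).of_le one_le_two
  have hV₂1 := fun k => (hV₂.1 k).of_le one_le_two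
  have hw : ∀ k, ContDiffOn ℝ 2 ((V₁ - V₂) k) (closure Ω) := fun k => (hV₁.1 k).sub (hV₂.1 k)
  have hw1 : ∀ k, ContDiffOn ℝ 1 ((V₁ - V₂) k) (closure Ω) := fun k => (hw k).of_le one_le_two
  have hσ0 : 0 < σ := hσ.1
  -- One `σ²` comes from each of the two data norms.
  have hB : ∀ k, ∫⁻ x in {x | x ∈ frontier Ω ∧ d < ξ x},
      (‖(V₁ - V₂) k x‖ₑ ^ 2 + ‖closureDeriv Ω ((V₁ - V₂) k) x‖ₑ ^ 2) ∂μHE[n - 1] ≤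
        ENNReal.ofReal (2 * σ ^ 2) := by
    intro k
    refine (lintegral_mono_set hsub).trans
      ((lintegral_trace_le_of_cauchyData hΩo hΓ hV₁1 hV₂1 h₁ h₂ k).trans ?_)
    rw [two_mul, ENNReal.ofReal_add (by positivity) (by positivity), ENNReal.ofReal_pow hσ0.le]
    gcongr
  obtain ⟨lam, hlam, hl1, hl2⟩ := hpar σ hσ
  have h := hest (V₁ - V₂) hw (hLb b hb hbZ V₁ V₂ hV₁ hV₂ hK₁ hK₂) (2 * σ ^ 2) (by positivity) hB
    lam hlam
  set I₂ := ∫ x in superlevel Ω ξ (d + c), energyDensity (V₁ - V₂) x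
  set I := ∫ x in superlevel Ω ξ d, energyDensity (V₁ - V₂) x
  have hI0 : 0 ≤ I := integral_nonneg fun x => energyDensity_nonneg _ x
  set r := σ ^ (c / (m + c))
  have hr0 : 0 ≤ r := Real.rpow_nonneg hσ0.le _
  set E := Real.exp (lam * (d + c)) ^ 2
  have hE0 : 0 < E := by positivity
  -- Both terms carry the factor `E r²`, and `E` cancels. The bound is then enlarged by `1 + I ≤ (1
  -- + √I)²` to reach the form stated in the theorem.
  have hI₂ : I₂ ≤ (√(C₃ * (1 + C₅ * 2)) * (1 + √I) * r) ^ 2 := by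
    have e1 : E * I₂ ≤ E * (C₃ * (1 + C₅ * 2) * (1 + I) * r ^ 2) := by
      have f1 := mul_le_mul_of_nonneg_right hl1 hI0
      have f2 : 0 ≤ E * r ^ 2 := by positivity
      have f3 : 0 ≤ C₅ * (E * r ^ 2) := by positivity
      have f4 : 0 ≤ C₅ * (E * r ^ 2) * I := by positivity
      calc E * I₂ ≤ C₃ * (E * r ^ 2 * I + C₅ * (E * r ^ 2) * 2) := by
            refine h.trans (mul_le_mul_of_nonneg_left ?_ hC₃.le)
            linarith
        _ ≤ C₃ * (E * r ^ 2 * I + C₅ * (E * r ^ 2) * 2 + E * r ^ 2 +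
              2 * (C₅ * (E * r ^ 2) * I)) := by
            refine mul_le_mul_of_nonneg_left ?_ hC₃.le
            linarith
        _ = _ := by ring
    refine (le_of_mul_le_mul_left e1 hE0).trans ?_
    rw [mul_pow, mul_pow, Real.sq_sqrt (by positivity)]
    gcongr
    nlinarith [Real.sq_sqrt hI0, Real.sqrt_nonneg I]
  have hsubd : superlevel Ω ξ d ⊆ Ω := fun x hx => hx.1
  rw [normH1_eq hΩo hΩb hw1 fun x hx => hx.1]
  calc ENNReal.ofReal √I₂ ≤ ENNReal.ofReal (√(C₃ * (1 + C₅ * 2)) * (1 + √I) * r) :=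
        ENNReal.ofReal_le_ofReal (Real.sqrt_le_iff.2 ⟨by positivity, hI₂⟩)
    _ = ENNReal.ofReal (√(C₃ * (1 + C₅ * 2))) * (1 + normH1 (superlevel Ω ξ d) (V₁ - V₂)) *
          ENNReal.ofReal r := by
        rw [ENNReal.ofReal_mul (by positivity), ENNReal.ofReal_mul (by positivity),
          ENNReal.ofReal_add (by positivity) (by positivity), ENNReal.ofReal_one,
          normH1_eq hΩo hΩb hw1 hsubd]
    _ ≤ _ := by
        gcongr
        exact normH1_le_normH2 hsubd _

/-- The energy density vanishes almost everywhere, and continuity on the open set `D` turns this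
into vanishing everywhere. -/
lemma eqOn_of_normH1_eq_zero (hΩo : IsOpen Ω) (hΩb : Bornology.IsBounded Ω)
    {w : Fin N → Eu n → ℝ} (hw : ∀ k, ContDiffOn ℝ 1 (w k) (closure Ω)) {D : Set (Eu n)}
    (hDo : IsOpen D) (hD : D ⊆ Ω) (h : normH1 D w = 0) (k : Fin N) : EqOn (w k) 0 D := by
  have h1 : IntegrableOn (energyDensity w) D :=
    (integrableOn_energyDensity hΩo hΩb hw).mono_set hD
  rw [normH1_eq hΩo hΩb hw hD, ENNReal.ofReal_eq_zero] at h
  have h2 : ∫ x in D, energyDensity w x = 0 :=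
    le_antisymm (Real.sqrt_eq_zero'.1 (le_antisymm h (Real.sqrt_nonneg _)))
      (integral_nonneg fun x => energyDensity_nonneg w x)
  rw [setIntegral_eq_zero_iff_of_nonneg_ae
    (Eventually.of_forall fun x => energyDensity_nonneg w x) h1] at h2
  refine Measure.eqOn_open_of_ae_eq (μ := volume) ?_ hDo
    ((hw k).continuousOn.mono (hD.trans subset_closure)) continuousOn_const
  filter_upwards [h2] with x hx
  have h3 := (Finset.sum_eq_zero_iff_of_nonneg fun k _ =>
    add_nonneg (gradSq_nonneg (w k) x) (sq_nonneg (w k x))).1 hx k (Finset.mem_univ k)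
  have h4 := gradSq_nonneg (w k) x
  exact pow_eq_zero_iff two_ne_zero |>.1 (le_antisymm (by linarith) (sq_nonneg _))

end Stability

theorem theorem3p1 {n N : ℕ} (Ω : Set (Eu n)) (hΩo : IsOpen Ω) (hΩb : Bornology.IsBounded Ω)
    (ξ : Eu n → ℝ) (hξ : ContDiffOn ℝ ∞ ξ (closure Ω)) (d : ℝ) (hd : 0 < d)
    (a : Fin n → Fin n → Eu n → ℝ) (ha : ∀ i j, ContDiff ℝ 1 (a i j))
    (hCarleman : AdmitsCarleman a (superlevel Ω ξ d) ξ) :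
    -- Hölder stability
    (∀ K Z c m : ℝ, 0 < K → 0 < Z → 0 < c → (superlevel Ω ξ (d + c)).Nonempty →
      IsGreatest (ξ '' closure (superlevel Ω ξ d)) m →
      ∃ σ₀ ∈ Ioo (0 : ℝ) 1, ∃ C₂ > (0 : ℝ),
        ∀ b : Fin n → Eu n → ℝ, (∀ i, ContDiff ℝ 1 (b i)) → (∀ i, normC1 Ω (b i) ≤ Z) →
        ∀ (Γ : Set (Eu n)) (ν : Eu n → Eu n), IsC2BoundaryPart Ω Γ ν →
          {x | x ∈ frontier Ω ∧ d < ξ x} ⊆ Γ →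
        ∀ V₁ V₂ p₀₁ p₁₁ p₀₂ p₁₂ : Fin N → Eu n → ℝ,
          IsSolution a b Ω V₁ → IsSolution a b Ω V₂ →
          HasCauchyData Γ ν V₁ p₀₁ p₁₁ → HasCauchyData Γ ν V₂ p₀₂ p₁₂ →
          vecNormC1 Ω V₁ ≤ K → vecNormC1 Ω V₂ ≤ K →
        ∀ σ ∈ Ioo (0 : ℝ) σ₀,
          normH1Surface Γ (p₀₁ - p₀₂) ≤ ENNReal.ofReal σ →
          normL2Surface Γ (p₁₁ - p₁₂) ≤ ENNReal.ofReal σ →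
          normH1 (superlevel Ω ξ (d + c)) (V₁ - V₂) ≤
            ENNReal.ofReal C₂ * (1 + normH2 Ω (V₁ - V₂)) * ENNReal.ofReal (σ ^ (c / (m + c)))) ∧
    -- uniqueness
    (∀ b : Fin n → Eu n → ℝ, (∀ i, ContDiff ℝ 1 (b i)) →
      ∀ (Γ : Set (Eu n)) (ν : Eu n → Eu n), IsC2BoundaryPart Ω Γ ν →
        {x | x ∈ frontier Ω ∧ d < ξ x} ⊆ Γ →
      ∀ V₁ V₂ p₀₁ p₁₁ p₀₂ p₁₂ : Fin N → Eu n → ℝ,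
        IsSolution a b Ω V₁ → IsSolution a b Ω V₂ →
        HasCauchyData Γ ν V₁ p₀₁ p₁₁ → HasCauchyData Γ ν V₂ p₀₂ p₁₂ →
        (∀ x ∈ Γ, ∀ k, p₀₁ k x = p₀₂ k x ∧ p₁₁ k x = p₁₂ k x) →
        ∀ k, EqOn (V₁ k) (V₂ k) (superlevel Ω ξ d)) := by
  refine ⟨fun K Z c m hK hZ hc hne hm =>
    holder_stability hΩo hΩb hξ hd ha hCarleman hK hZ hc hne hm, ?_⟩
  intro b hb Γ ν hΓ hsub V₁ V₂ p₀₁ p₁₁ p₀₂ p₁₂ hV₁ hV₂ h₁ h₂ heq k x hx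
  -- With this `c` the point `x` lies in `Ω_{d+c}`, so the stability estimate is used separately for
  -- each point.
  set c := (ξ x - d) / 2 with hc
  have hc0 : 0 < c := half_pos (sub_pos.2 hx.2)
  have hxc : x ∈ superlevel Ω ξ (d + c) := ⟨hx.1, by linarith [hx.2]⟩
  have hDc : IsCompact (closure (superlevel Ω ξ d)) :=
    Metric.isCompact_of_isClosed_isBounded isClosed_closure
      (hΩb.subset fun y hy => hy.1).closure
  obtain ⟨m, hm⟩ := (hDc.image_of_continuousOn
    (hξ.continuousOn.mono (closure_mono fun y hy => hy.1))).exists_isGreatest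
      ⟨_, mem_image_of_mem _ (subset_closure hx)⟩
  have hm0 : 0 < m := by linarith [hm.2 (mem_image_of_mem _ (subset_closure hx)), hx.2]
  obtain ⟨σ₀, hσ₀, C₂, hC₂, hst⟩ := holder_stability (N := N) hΩo hΩb hξ hd ha hCarleman
    (K := |vecNormC1 Ω V₁| + |vecNormC1 Ω V₂| + 1) (Z := ∑ i, |normC1 Ω (b i)| + 1)
    (by positivity) (by positivity) hc0 ⟨x, hxc⟩ hm
  have hw : ∀ k, ContDiffOn ℝ 2 ((V₁ - V₂) k) (closure Ω) := fun k => (hV₁.1 k).sub (hV₂.1 k)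
  obtain ⟨hz₀, hz₁⟩ := surface_norms_eq_zero hΓ (p₀ := p₀₁ - p₀₂) (p₁ := p₁₁ - p₁₂)
    fun y hy l => by simp [(heq y hy l).1, (heq y hy l).2]
  have hbZ : ∀ i, normC1 Ω (b i) ≤ ∑ i, |normC1 Ω (b i)| + 1 := fun i => by
    have := Finset.single_le_sum (f := fun i => |normC1 Ω (b i)|) (fun _ _ => abs_nonneg _)
      (Finset.mem_univ i)
    linarith [le_abs_self (normC1 Ω (b i))]
  -- The data differences have norm zero, so every small `σ` is admissible for one and the same pair
  -- of solutions.
  have hall : ∀ᶠ σ in 𝓝[>] (0 : ℝ), normH1 (superlevel Ω ξ (d + c)) (V₁ - V₂) ≤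
      ENNReal.ofReal C₂ * (1 + normH2 Ω (V₁ - V₂)) * ENNReal.ofReal (σ ^ (c / (m + c))) := by
    filter_upwards [Ioo_mem_nhdsGT hσ₀.1] with σ hσ
    refine hst b hb hbZ Γ ν hΓ hsub V₁ V₂ p₀₁ p₁₁ p₀₂ p₁₂ hV₁ hV₂ h₁ h₂ ?_ ?_ σ hσ
      (hz₀.trans_le zero_le) (hz₁.trans_le zero_le)
    · linarith [le_abs_self (vecNormC1 Ω V₁), abs_nonneg (vecNormC1 Ω V₂)]
    · linarith [le_abs_self (vecNormC1 Ω V₂), abs_nonneg (vecNormC1 Ω V₁)]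
  -- The `H²` norm is finite because both solutions are `C²` up to the boundary of a bounded set.
  -- Otherwise the product with the vanishing power of `σ` would not tend to zero.
  have hlim : Tendsto (fun σ : ℝ => ENNReal.ofReal C₂ * (1 + normH2 Ω (V₁ - V₂)) *
      ENNReal.ofReal (σ ^ (c / (m + c)))) (𝓝[>] 0) (𝓝 0) := by
    have hρ : 0 < c / (m + c) := by positivity
    have h3 : Tendsto (fun σ : ℝ => ENNReal.ofReal (σ ^ (c / (m + c)))) (𝓝[>] 0) (𝓝 0) := by
      have h4 := (Real.continuous_rpow_const hρ.le).tendsto 0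
      rw [Real.zero_rpow hρ.ne'] at h4
      have h5 := ENNReal.tendsto_ofReal (h4.mono_left (nhdsWithin_le_nhds (s := Ioi 0)))
      rwa [ENNReal.ofReal_zero] at h5
    have h6 := ENNReal.Tendsto.const_mul
      (a := ENNReal.ofReal C₂ * (1 + normH2 Ω (V₁ - V₂))) h3 (Or.inr (ENNReal.mul_ne_top
        ENNReal.ofReal_ne_top (ENNReal.add_ne_top.2
          ⟨ENNReal.one_ne_top, normH2_ne_top hΩo hΩb hw⟩)))
    rwa [mul_zero] at h6
  have hzero : normH1 (superlevel Ω ξ (d + c)) (V₁ - V₂) = 0 :=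
    le_antisymm (ge_of_tendsto hlim hall) zero_le
  have h := eqOn_of_normH1_eq_zero hΩo hΩb (fun k => (hw k).of_le one_le_two)
    (isOpen_superlevel hΩo hξ.continuousOn _) (fun y hy => hy.1) hzero k hxc
  exact sub_eq_zero.1 h
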